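/- Let $\mathbb{T}=\mathbb{R}/2\pi\mathbb{Z}$ and let $\cdots<\lambda_{-2}<\lambda_{-1}<\lambda_0=0<\lambda_1<\lambda_2<\cdots$ be the eigenvalues, in increasing order, of the wave operator $\Box u=u_{tt}-u_{ss}$ with domain $\{u\in H^2([0,\pi]\times\mathbb{T}) : u(0,t)=u(\pi,t)=0\}$. Put $\mathcal{H}=L^2([0,\pi]\times\mathbb{T})$ (real valued) with norm $\|\cdot\|$. Let $\mathcal{R}$ (respectively $\mathcal{N}$) be the closed linear span in $\mathcal{H}$ of the functions $\sin(ms)\cos(nt)$, $\sin(ms)\sin(nt)$ with integers $m\ge 1$, $n\ge 0$ and $m\ne n$ (respectively $m=n$), and let $\mathcal{H}^1$ be the space of $x\in\mathcal{R}\cap H^1([0,\pi]\times\mathbb{T})$ with zero trace on $s=0$ and $s=\pi$, with the $H^1$ norm. For real $a,b$, a weak solution of $$u_{tt}-u_{ss}=au^+-bu^-\ \text{ in }\ ]0,\pi[\times\mathbb{T},\qquad u(0,t)=u(\pi,t)=0, \tag{1}$$ where $u^+=\max\{u,0\}$ and $u^-=u^+-u$, is a function $u=x+y$, $(x,y)\in\mathcal{H}^1\times\mathcal{N}$,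 such that $(x,y)$ is a critical point of $$\mathcal{I}(x,y)=\tfrac12\left(\|x_s\|^2-\|x_t\|^2-a\|(x+y)^+\|^2-b\|(x+y)^-\|^2\right)\quad\text{on } \mathcal{H}^1\times\mathcal{N}.$$ It is nontrivial if $u\neq0$. Theorem. Fix $k\in\mathbb{Z}$ with $\lambda_k\ne 0$. Let $\check{Q}_k=\,]\lambda_{k-1},+\infty[^2$ if $\lambda_k>0$, and $\check{Q}_k=\,]\lambda_{k-1},0[^2$ if $\lambda_k<0$. There is a continuous curve $\mathcal{C}_k\subset\check{Q}_k$ (the image of a continuous injective map $\mathbb{R}\to\mathbb{R}^2$) with the following properties. 1. $(\lambda_k,\lambda_k)\in\mathcal{C}_k$, and $\mathcal{C}_k$ is symmetric with respect to the line $b=a$. 2. If $k\ne1$, then $\mathcal{C}_k$ is the graph $\{(a,f(a)) : a\in J\}$ of a continuous strictly decreasing function $f$ on an interval $J$. 3. $\check{Q}_k\setminus\mathcal{C}_k$ has exactly two connected components, and $]\lambda_{k-1},\lambda_k[^2\subset\check{Q}_k\setminus\mathcal{C}_k$. A point of $\check{Q}_k\setminus\mathcal{C}_k$ is said to lie below $\mathcal{C}_k$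 if it belongs to the component that contains $]\lambda_{k-1},\lambda_k[^2$. 4. If $(a,b)\in\mathcal{C}_k$, then (1) has a nontrivial weak solution. 5. If $(a,b)\in\check{Q}_k$ lies below $\mathcal{C}_k$, then (1) has no nontrivial weak solution. -/

import Mathlib

open MeasureTheory Set
open scoped ContDiff

noncomputable section

namespace WaveFucik

/-- Lebesgue measure on the cylinder `[0, π] × 𝕋`, where the circle `𝕋 = ℝ / 2πℤ` is represented by
its fundamental domain `[0, 2π]`. Points are written `(s, t)`. -/
def cyl : Measure (ℝ × ℝ) :=
  volume.restrict (Icc 0 Real.pi ×ˢ Icc 0 (2 * Real.pi))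

instance : IsFiniteMeasure cyl := by
  unfold cyl
  exact isFiniteMeasure_restrict.mpr (isCompact_Icc.prod isCompact_Icc).measure_lt_top.ne

/-- The real Hilbert space `L²([0, π] × 𝕋)`. -/
abbrev H : Type := Lp ℝ 2 cyl

/-- `φ_(m,n)(s,t) = (√2 / π) sin (m s) cos (n t)`. -/
def phi (m n : ℕ) (p : ℝ × ℝ) : ℝ :=
  Real.sqrt 2 / Real.pi * Real.sin (m * p.1) * Real.cos (n * p.2)

/-- `ψ_(m,n)(s,t) = (√2 / π) sin (m s) sin (n t)`. -/
def psi (m n : ℕ) (p : ℝ × ℝ) : ℝ :=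
  Real.sqrt 2 / Real.pi * Real.sin (m * p.1) * Real.sin (n * p.2)

/-- The closed span in `L²` of the `φ_(m,n)`, `ψ_(m,n)` with `m ≥ 1`, `n ≥ 0`, `m ≠ n`. -/
def R : Submodule ℝ H :=
  (Submodule.span ℝ {v : H | ∃ m n : ℕ, 1 ≤ m ∧ m ≠ n ∧
    (v =ᵐ[cyl] phi m n ∨ v =ᵐ[cyl] psi m n)}).topologicalClosure

/-- The closed span in `L²` of the `φ_(l,l)`, `ψ_(l,l)` with `l ≥ 1`. -/
def N : Submodule ℝ H :=
  (Submodule.span ℝ {v : H | ∃ l : ℕ, 1 ≤ l ∧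
    (v =ᵐ[cyl] phi l l ∨ v =ᵐ[cyl] psi l l)}).topologicalClosure

/-- Smooth functions on `[0, π] × 𝕋` (smooth up to the boundary), as smooth functions of `(s, t)`
that are `2π`-periodic in `t`. -/
def IsSmoothOnCyl (η : ℝ × ℝ → ℝ) : Prop :=
  ContDiff ℝ ∞ η ∧ ∀ s t : ℝ, η (s, t + 2 * Real.pi) = η (s, t)

/-- Integration by parts, without boundary term, of `u` against `η` in the direction `e`, with `g` in
the role of the derivative of `u` in the direction `e`. -/
def ByParts (e : ℝ × ℝ) (u g : H) (η : ℝ × ℝ → ℝ) : Prop :=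
  ∫ p, u p * fderiv ℝ η p e ∂cyl = -∫ p, g p * η p ∂cyl

/-- `g ∈ L²` is the weak derivative of `u ∈ L²` in the direction `e` on `]0, π[ × 𝕋`: the test
functions are the smooth functions with (compact) support in `]0, π[ × 𝕋`. -/
def IsWeakDeriv (e : ℝ × ℝ) (u g : H) : Prop :=
  ∀ η : ℝ × ℝ → ℝ, IsSmoothOnCyl η → tsupport η ⊆ Ioo 0 Real.pi ×ˢ univ → ByParts e u g η

/-- For `u ∈ H¹([0, π] × 𝕋)` with weak derivative `g = u_s`: the trace of `u` on `s = 0` and on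
`s = π` vanishes, i.e. in Green's formula
`∫ u η_s + ∫ u_s η = ∫_𝕋 (u η)(π, t) dt - ∫_𝕋 (u η)(0, t) dt`
the boundary terms are zero for every `η` that is smooth up to the boundary. -/
def HasZeroTrace (u g : H) : Prop :=
  ∀ η : ℝ × ℝ → ℝ, IsSmoothOnCyl η → ByParts (1, 0) u g η

theorem memLp_of_continuous {f : ℝ × ℝ → ℝ} (hf : Continuous f) : MemLp f 2 cyl := by
  have hK : IsCompact (Icc 0 Real.pi ×ˢ Icc 0 (2 * Real.pi)) := isCompact_Icc.prod isCompact_Icc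
  obtain ⟨C, hC⟩ := hK.exists_bound_of_continuousOn hf.continuousOn
  refine MemLp.of_bound hf.aestronglyMeasurable C ?_
  exact (ae_restrict_iff' hK.measurableSet).mpr (Filter.Eventually.of_forall hC)

theorem integrable_mul (u : H) {f : ℝ × ℝ → ℝ} (hf : Continuous f) :
    Integrable (fun p => u p * f p) cyl :=
  (Lp.memLp u).integrable_mul (memLp_of_continuous hf)

theorem IsSmoothOnCyl.continuous_fderiv {η : ℝ × ℝ → ℝ} (h : IsSmoothOnCyl η) (e : ℝ × ℝ) :
    Continuous fun p => fderiv ℝ η p e :=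
  (h.1.continuous_fderiv (by simp)).clm_apply continuous_const

theorem ByParts.zero (e : ℝ × ℝ) (η : ℝ × ℝ → ℝ) : ByParts e 0 0 η := by
  have h0 : ∀ f : ℝ × ℝ → ℝ, ∫ p, (0 : H) p * f p ∂cyl = 0 := by
    intro f
    rw [integral_congr_ae (g := fun _ => (0 : ℝ))]
    · simp
    · filter_upwards [Lp.coeFn_zero ℝ 2 cyl] with p hp
      rw [hp, Pi.zero_apply, zero_mul]
  unfold ByParts
  rw [h0, h0, neg_zero]

theorem ByParts.add {e : ℝ × ℝ} {u g u' g' : H} {η : ℝ × ℝ → ℝ} (hη : IsSmoothOnCyl η)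
    (h : ByParts e u g η) (h' : ByParts e u' g' η) : ByParts e (u + u') (g + g') η := by
  have key : ∀ (v w : H) (f : ℝ × ℝ → ℝ), Continuous f →
      ∫ p, (v + w : H) p * f p ∂cyl = ∫ p, v p * f p ∂cyl + ∫ p, w p * f p ∂cyl := by
    intro v w f hf
    rw [← integral_add (integrable_mul v hf) (integrable_mul w hf)]
    refine integral_congr_ae ?_
    filter_upwards [Lp.coeFn_add v w] with p hp
    rw [hp, Pi.add_apply, add_mul]
  unfold ByParts at *
  rw [key _ _ _ (hη.continuous_fderiv e), key _ _ _ hη.1.continuous, h, h']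
  ring

theorem ByParts.smul {e : ℝ × ℝ} {u g : H} {η : ℝ × ℝ → ℝ} (c : ℝ)
    (h : ByParts e u g η) : ByParts e (c • u) (c • g) η := by
  have key : ∀ (v : H) (f : ℝ × ℝ → ℝ),
      ∫ p, (c • v : H) p * f p ∂cyl = c * ∫ p, v p * f p ∂cyl := by
    intro v f
    rw [← integral_const_mul]
    refine integral_congr_ae ?_
    filter_upwards [Lp.coeFn_smul c v] with p hp
    rw [hp, Pi.smul_apply, smul_eq_mul, mul_assoc]
  unfold ByParts at *
  rw [key, key, h]
  ring

/-- The space of `x ∈ R ∩ H¹([0, π] × 𝕋)` with zero trace at `s = 0` and `s = π`. An element is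
recorded as the triple `(x, x_s, x_t)` of `x` and its (unique) weak derivatives, so that the norm
inherited from `H × H × H`, the largest of `‖x‖`, `‖x_s‖`, `‖x_t‖`, is equivalent to the `H¹` norm. -/
def H1 : Submodule ℝ (H × H × H) where
  carrier := {q | q.1 ∈ R ∧ IsWeakDeriv (1, 0) q.1 q.2.1 ∧ IsWeakDeriv (0, 1) q.1 q.2.2 ∧
    HasZeroTrace q.1 q.2.1}
  zero_mem' := ⟨R.zero_mem, fun _ _ _ => ByParts.zero _ _, fun _ _ _ => ByParts.zero _ _,
    fun _ _ => ByParts.zero _ _⟩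
  add_mem' := fun h h' => ⟨R.add_mem h.1 h'.1,
    fun η hη hs => (h.2.1 η hη hs).add hη (h'.2.1 η hη hs),
    fun η hη hs => (h.2.2.1 η hη hs).add hη (h'.2.2.1 η hη hs),
    fun η hη => (h.2.2.2 η hη).add hη (h'.2.2.2 η hη)⟩
  smul_mem' := fun c _ h => ⟨R.smul_mem c h.1,
    fun η hη hs => (h.2.1 η hη hs).smul c,
    fun η hη hs => (h.2.2.1 η hη hs).smul c,
    fun η hη => (h.2.2.2 η hη).smul c⟩

/-- The function `u = x + y ∈ L²` given by the pair `(x, y)`. -/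
def toFun (z : H1 × N) : H := (z.1 : H × H × H).1 + (z.2 : H)

/-- The energy functional
`I(x, y) = ½ (‖x_s‖² - ‖x_t‖² - a ‖(x+y)⁺‖² - b ‖(x+y)⁻‖²)`. -/
def energy (a b : ℝ) (z : H1 × N) : ℝ :=
  1 / 2 * (‖(z.1 : H × H × H).2.1‖ ^ 2 - ‖(z.1 : H × H × H).2.2‖ ^ 2
    - a * ‖Lp.posPart (toFun z)‖ ^ 2 - b * ‖Lp.negPart (toFun z)‖ ^ 2)

/-- A weak solution of `u_tt - u_ss = a u⁺ - b u⁻`, `u = 0` at `s = 0, π`, is a critical point of the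
energy functional. -/
def IsWeakSolution (a b : ℝ) (z : H1 × N) : Prop :=
  HasFDerivAt (energy a b) (0 : (H1 × N) →L[ℝ] ℝ) z

/-- The problem with parameters `(a, b)` has a nontrivial weak solution. -/
def HasNontrivialWeakSolution (a b : ℝ) : Prop :=
  ∃ z : H1 × N, IsWeakSolution a b z ∧ toFun z ≠ 0

/-- `c` is an eigenvalue of the wave operator `u ↦ u_tt - u_ss` with domain the
`u ∈ H²([0, π] × 𝕋)` that vanish at `s = 0` and `s = π`. -/
def IsWaveEigenvalue (c : ℝ) : Prop :=
  ∃ u u_s u_t u_ss u_st u_tt : H,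
    IsWeakDeriv (1, 0) u u_s ∧ IsWeakDeriv (0, 1) u u_t ∧
    IsWeakDeriv (1, 0) u_s u_ss ∧ IsWeakDeriv (0, 1) u_s u_st ∧
    IsWeakDeriv (1, 0) u_t u_st ∧ IsWeakDeriv (0, 1) u_t u_tt ∧
    HasZeroTrace u u_s ∧ u ≠ 0 ∧ u_tt - u_ss = c • u

/-- `… < lam (-1) < lam 0 = 0 < lam 1 < …` are all the eigenvalues of the wave operator, in
increasing order (this determines `lam`). -/
def EnumeratesEigenvalues (lam : ℤ → ℝ) : Prop :=
  StrictMono lam ∧ lam 0 = 0 ∧ ∀ c : ℝ, IsWaveEigenvalue c ↔ ∃ k : ℤ, lam k = c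

/-- `]λ_{k-1}, ∞[²` if `λ_k > 0`, and `]λ_{k-1}, 0[²` if `λ_k < 0`. -/
def Q (lam : ℤ → ℝ) (k : ℤ) : Set (ℝ × ℝ) :=
  if 0 < lam k then Ioi (lam (k - 1)) ×ˢ Ioi (lam (k - 1))
  else Ioo (lam (k - 1)) 0 ×ˢ Ioo (lam (k - 1)) 0

/-- The small square `]λ_{k-1}, λ_k[²` in the corner of `Q lam k`. -/
def corner (lam : ℤ → ℝ) (k : ℤ) : Set (ℝ × ℝ) :=
  Ioo (lam (k - 1)) (lam k) ×ˢ Ioo (lam (k - 1)) (lam k)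

/-- The points of `Q lam k` below the curve `C`: those in the connected component of `Q lam k \ C`
that contains `]λ_{k-1}, λ_k[²`. -/
def Below (lam : ℤ → ℝ) (k : ℤ) (C : Set (ℝ × ℝ)) : Set (ℝ × ℝ) :=
  ⋃ q ∈ corner lam k, connectedComponentIn (Q lam k \ C) q

end WaveFucik

end

/-!
The wave operator is diagonal in the orthonormal basis `π⁻¹ sin (m s) (cos (n t) + sin (n t))`,
`m ≥ 1`, `n ∈ ℤ`, of `L²` (`modeBasis`), with eigenvalues `m² - n²` (`modeEv`). Unless
`m = |n|`, both `m` and `|n|` are at most `|m² - n²|`, so every nonzero eigenvalue has finite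
multiplicity, bounded parts of the spectrum contain finitely many nonzero eigenvalues, and the weak
derivatives of a solution are recovered from its coefficients. Hence a nontrivial weak solution
exists if and only if some `u ≠ 0` satisfies the equation coefficient by coefficient
(`hasNontrivialWeakSolution_iff`); the rest of the argument takes place in a Hilbert space with a
diagonal operator and an abstract positive part (`IsPosPart`).

Fix a bounded interval `]α, M[` that contains finitely many eigenvalues. For `a, b ∈ ]α, M[` the
nonlinearity, recentered at the midpoint of the interval, has a Lipschitz constant less than half its
length, so the components of a solution outside the finitely many eigenspaces in the window are
determined by the component `f` in the window through a contraction (`Reduction`,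
`spectralReduction`). This leaves a reduced energy `f ↦ G (a, b) f` on a finite dimensional space,
homogeneous of degree two, whose critical points correspond to the solutions. Its derivatives in `a`
and `b` are `-‖u⁺‖²` and `-‖u⁻‖²`, so `G` is antitone in `(a, b)`. Consequently the parameters for
which `G` is positive off the origin form an open lower set without nontrivial solutions. Where
positivity is lost along a parallel to the diagonal, `G` is nonnegative with a nontrivial zero, which
is a minimizer and hence gives a nontrivial solution (`exists_isSol_of_boundary`). Positivity can be
restated without reference to `M`: there is no solution at any smaller point of the square
(`solutionFree`, `mem_solutionFree_iff`). On the diagonal `a = b = t` the energy is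
`∑ (ev i - t) f_i²`, which places `]λ_{k-1}, λ_k[²` in the region and `(λ_k, λ_k)` on its boundary.

The curve is the upper boundary of this region (`upperBoundary`). For an open, symmetric lower set
it is parametrized by `b - a`, with Lipschitz constant one, over an open interval, and it separates
the square into two connected pieces (`IsLowerRegion.exists_curve`,
`IsLowerRegion.card_components`). If `1` lies outside the side of the square, which is the case for
`k ≠ 1`, all nontrivial solutions change sign: a nonnegative one, tested against the positive mode
`sin s`, forces `a = 1`. Then `G` is strictly decreasing along its solutions, distinct boundary
points are never comparable (`eq_of_le_of_mem_upperBoundary`), and the curve is the graph of a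
decreasing function.
-/

noncomputable section

namespace WaveFucik

open Filter Topology
open scoped InnerProductSpace

/-! ### Positive parts in a Hilbert space -/

section Cone

variable {E : Type*} [NormedAddCommGroup E] [InnerProductSpace ℝ E]

/-- The properties of the positive part `u ↦ u⁺` of `L²` on which the reduction relies; the negative
part of `u` is `(-u)⁺`. -/
structure IsPosPart (pos : E → E) : Prop where
  sub_eq : ∀ u, pos u - pos (-u) = u
  inner_self : ∀ u, ⟪pos u, pos (-u)⟫_ℝ = 0
  inner_nonneg : ∀ u v, 0 ≤ ⟪pos u, pos v⟫_ℝ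
  smul : ∀ (t : ℝ) (u : E), 0 ≤ t → pos (t • u) = t • pos u

/-- The jumping nonlinearity `u ↦ a u⁺ - b u⁻` with `p = (a, b)`. -/
def jump (pos : E → E) (p : ℝ × ℝ) (u : E) : E := p.1 • pos u - p.2 • pos (-u)

variable {pos : E → E}

theorem jump_sub (p q : ℝ × ℝ) (u : E) :
    jump pos (p - q) u = jump pos p u - jump pos q u := by
  simp only [jump, Prod.fst_sub, Prod.snd_sub, sub_smul]; abel

theorem jump_smul_left (t : ℝ) (p : ℝ × ℝ) (u : E) :
    jump pos (t • p) u = t • jump pos p u := by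
  simp only [jump, Prod.smul_fst, Prod.smul_snd, smul_eq_mul, mul_smul, smul_sub]

theorem jump_neg (p : ℝ × ℝ) (u : E) : jump pos p.swap (-u) = - jump pos p u := by
  simp [jump]

namespace IsPosPart

variable (hc : IsPosPart pos)
include hc

theorem jump_diag (t : ℝ) (u : E) : jump pos (t, t) u = t • u := by
  rw [jump, ← smul_sub, hc.sub_eq]

theorem jump_smul (p : ℝ × ℝ) (t : ℝ) (ht : 0 ≤ t) (u : E) :
    jump pos p (t • u) = t • jump pos p u := by
  simp only [jump, ← smul_neg, hc.smul t _ ht, smul_sub, smul_comm _ t]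

theorem jump_zero (p : ℝ × ℝ) : jump pos p (0 : E) = 0 := by
  simpa using hc.jump_smul p 0 le_rfl 0

theorem inner_jump_self (p : ℝ × ℝ) (u : E) :
    ⟪jump pos p u, u⟫_ℝ = p.1 * ‖pos u‖ ^ 2 + p.2 * ‖pos (-u)‖ ^ 2 := by
  have h : ⟪jump pos p u, u⟫_ℝ = ⟪jump pos p u, pos u - pos (-u)⟫_ℝ := by rw [hc.sub_eq]
  have h1 := hc.inner_self u
  have h2 := h1
  rw [real_inner_comm] at h2
  rw [h, jump]
  simp only [inner_sub_left, inner_sub_right, inner_smul_left, h1, h2, real_inner_self_eq_norm_sq]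
  simp

/-- The increments of the positive and of the negative part form an obtuse angle. -/
theorem inner_sub_nonpos (u v : E) : ⟪pos u - pos v, pos (-u) - pos (-v)⟫_ℝ ≤ 0 := by
  have h1 := hc.inner_self u
  have h2 := hc.inner_self v
  have h3 := hc.inner_nonneg u (-v)
  have h4 := hc.inner_nonneg v (-u)
  simp only [inner_sub_left, inner_sub_right]
  linarith

theorem norm_sq_add_norm_sq_le (u v : E) :
    ‖pos u - pos v‖ ^ 2 + ‖pos (-u) - pos (-v)‖ ^ 2 ≤ ‖u - v‖ ^ 2 := by
  have h : u - v = (pos u - pos v) - (pos (-u) - pos (-v)) := by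
    conv_lhs => rw [← hc.sub_eq u, ← hc.sub_eq v]
    abel
  rw [h]
  linarith [hc.inner_sub_nonpos u v,
    norm_sub_sq_real (pos u - pos v) (pos (-u) - pos (-v))]

/-- Since the increments `x`, `y` of the two parts have `⟪x, y⟫ ≤ 0`, the Lipschitz constant is
`max |a| |b|`, which is the sup norm of `p = (a, b)`. -/
theorem norm_jump_sub_le (p : ℝ × ℝ) (u v : E) :
    ‖jump pos p u - jump pos p v‖ ≤ ‖p‖ * ‖u - v‖ := by
  set x := pos u - pos v with hx
  set y := pos (-u) - pos (-v) with hy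
  have h : u - v = x - y := by
    conv_lhs => rw [← hc.sub_eq u, ← hc.sub_eq v]
    rw [hx, hy]; abel
  have h' : jump pos p u - jump pos p v = p.1 • x - p.2 • y := by
    simp only [jump, hx, hy, smul_sub]; abel
  have hxy := hc.inner_sub_nonpos u v
  rw [← hx, ← hy] at hxy
  have h1 : |p.1| ≤ ‖p‖ := norm_fst_le p
  have h2 : |p.2| ≤ ‖p‖ := norm_snd_le p
  have h0 := norm_nonneg p
  rw [h, h']
  refine abs_le_of_sq_le_sq' ?_ (by positivity) |>.2
  rw [mul_pow, norm_sub_sq_real, norm_sub_sq_real, norm_smul, norm_smul, mul_pow, mul_pow,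
    inner_smul_left, inner_smul_right]
  simp only [Real.norm_eq_abs, sq_abs, conj_trivial]
  have e1 : p.1 ^ 2 ≤ ‖p‖ ^ 2 := sq_le_sq' (abs_le.1 h1).1 (abs_le.1 h1).2
  have e2 : p.2 ^ 2 ≤ ‖p‖ ^ 2 := sq_le_sq' (abs_le.1 h2).1 (abs_le.1 h2).2
  have e3 : p.1 * p.2 ≤ ‖p‖ ^ 2 := by nlinarith [sq_nonneg (p.1 - p.2)]
  nlinarith [mul_le_mul_of_nonneg_right e1 (sq_nonneg ‖x‖),
    mul_le_mul_of_nonneg_right e2 (sq_nonneg ‖y‖), mul_nonneg (sub_nonneg.2 e3) (neg_nonneg.2 hxy)]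

/-- The nonlinearity is symmetric up to a quadratic error: the mixed terms `⟪u⁺, v⁻⟫` that
break the symmetry are at most `‖u - v‖²`. -/
theorem abs_inner_jump_sub_le (p : ℝ × ℝ) (u v : E) :
    |⟪jump pos p u, v⟫_ℝ - ⟪jump pos p v, u⟫_ℝ| ≤ 4 * ‖p‖ * ‖u - v‖ ^ 2 := by
  have hu := hc.sub_eq u
  have hv := hc.sub_eq v
  have key : ⟪jump pos p u, v⟫_ℝ - ⟪jump pos p v, u⟫_ℝ
      = (p.1 - p.2) * (⟪pos v, pos (-u)⟫_ℝ - ⟪pos u, pos (-v)⟫_ℝ) := by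
    have h1 : ⟪jump pos p u, v⟫_ℝ = ⟪jump pos p u, pos v - pos (-v)⟫_ℝ := by rw [hv]
    have h2 : ⟪jump pos p v, u⟫_ℝ = ⟪jump pos p v, pos u - pos (-u)⟫_ℝ := by rw [hu]
    rw [h1, h2]
    simp only [jump, inner_sub_left, inner_sub_right, inner_smul_left, conj_trivial]
    rw [real_inner_comm (pos u) (pos v), real_inner_comm (pos (-v)) (pos (-u)),
      real_inner_comm (pos v) (pos (-u)), real_inner_comm (pos u) (pos (-v))]
    ring
  have h1 := hc.inner_self u
  have h2 := hc.inner_self v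
  have h3 := hc.inner_nonneg u (-v)
  have h4 := hc.inner_nonneg v (-u)
  have hsum : ⟪pos v, pos (-u)⟫_ℝ + ⟪pos u, pos (-v)⟫_ℝ
      = -⟪pos u - pos v, pos (-u) - pos (-v)⟫_ℝ := by
    simp only [inner_sub_left, inner_sub_right]; linarith
  have hcs := abs_real_inner_le_norm (pos u - pos v) (pos (-u) - pos (-v))
  have hsq := hc.norm_sq_add_norm_sq_le u v
  have hbd : ⟪pos v, pos (-u)⟫_ℝ + ⟪pos u, pos (-v)⟫_ℝ ≤ ‖u - v‖ ^ 2 := by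
    rw [hsum]
    have := neg_le_abs ⟪pos u - pos v, pos (-u) - pos (-v)⟫_ℝ
    nlinarith [sq_nonneg (‖pos u - pos v‖ - ‖pos (-u) - pos (-v)‖)]
  have habs : |⟪pos v, pos (-u)⟫_ℝ - ⟪pos u, pos (-v)⟫_ℝ| ≤ ‖u - v‖ ^ 2 := by
    rw [abs_le]; constructor <;> linarith
  have hp1 : |p.1| ≤ ‖p‖ := norm_fst_le p
  have hp2 : |p.2| ≤ ‖p‖ := norm_snd_le p
  have hp : |p.1 - p.2| ≤ 2 * ‖p‖ := (abs_sub _ _).trans (by linarith)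
  rw [key, abs_mul]
  calc |p.1 - p.2| * |⟪pos v, pos (-u)⟫_ℝ - ⟪pos u, pos (-v)⟫_ℝ|
      ≤ (2 * ‖p‖) * ‖u - v‖ ^ 2 := by gcongr
    _ ≤ 4 * ‖p‖ * ‖u - v‖ ^ 2 := by
      gcongr; norm_num

end IsPosPart

end Cone

/-! ### Reduction of the equation to finitely many unknowns -/

section Reduction

variable {E : Type*} [NormedAddCommGroup E] [InnerProductSpace ℝ E] {pos : E → E}

theorem IsPosPart.continuous (hc : IsPosPart pos) : Continuous pos := by
  refine (LipschitzWith.of_dist_le_mul (K := 1) fun u v => ?_).continuous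
  rw [dist_eq_norm, dist_eq_norm, NNReal.coe_one, one_mul]
  refine abs_le_of_sq_le_sq' ?_ (norm_nonneg _) |>.2
  nlinarith [hc.norm_sq_add_norm_sq_le u v, sq_nonneg ‖pos (-u) - pos (-v)‖]

theorem IsPosPart.continuous_jump (hc : IsPosPart pos) :
    Continuous fun x : (ℝ × ℝ) × E => jump pos x.1 x.2 := by
  have := hc.continuous
  unfold jump
  fun_prop

/-- The data of a Lyapunov–Schmidt reduction of the equation `L u = p.1 u⁺ - p.2 u⁻`: `K` inverts
the linear operator `L` on the complement of a subspace, and `A` is `L` on that subspace. -/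
structure Reduction (pos : E → E) where
  K : E →L[ℝ] E
  A : E →L[ℝ] E
  r : ℝ
  isPosPart : IsPosPart pos
  r_pos : 0 < r
  K_symm : ∀ v w, ⟪K v, w⟫_ℝ = ⟪v, K w⟫_ℝ
  K_norm : ∀ w, r * ‖K w‖ ≤ ‖w‖
  A_symm : ∀ v w, ⟪A v, w⟫_ℝ = ⟪v, A w⟫_ℝ

namespace Reduction

variable (D : Reduction pos)

open Classical in
/-- The solution `u` of `u = f + K (p.1 u⁺ - p.2 u⁻)`. -/
def sol (p : ℝ × ℝ) (f : E) : E :=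
  if h : ∃ u, u = f + D.K (jump pos p u) then h.choose else 0

/-- The reduced energy of `f`: twice the value of the energy functional at `D.sol p f`. -/
def energy (p : ℝ × ℝ) (f : E) : ℝ := ⟪D.A f, f⟫_ℝ - ⟪jump pos p (D.sol p f), f⟫_ℝ

variable {D}

/-- Lipschitz dependence of the solution of the fixed point equation on `f` and on `p`. -/
theorem norm_sub_le {p p' : ℝ × ℝ} {f f' u u' : E} {ρ : ℝ} (hρ : ‖p'‖ ≤ ρ)
    (hu : u = f + D.K (jump pos p u)) (hu' : u' = f' + D.K (jump pos p' u')) :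
    (D.r - ρ) * ‖u' - u‖ ≤ D.r * ‖f' - f‖ + ‖jump pos (p' - p) u‖ := by
  have h1 : u' - u = (f' - f) + D.K (jump pos p' u' - jump pos p' u)
      + D.K (jump pos (p' - p) u) := by
    rw [jump_sub, map_sub, map_sub]
    nth_rw 1 [hu, hu']
    abel
  have h2 : ‖u' - u‖ ≤ ‖f' - f‖ + ‖D.K (jump pos p' u' - jump pos p' u)‖
      + ‖D.K (jump pos (p' - p) u)‖ := by
    conv_lhs => rw [h1]
    exact norm_add₃_le
  have h3 := D.K_norm (jump pos p' u' - jump pos p' u)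
  have h4 := D.K_norm (jump pos (p' - p) u)
  have h5 := D.isPosPart.norm_jump_sub_le p' u' u
  have h6 : ‖p'‖ * ‖u' - u‖ ≤ ρ * ‖u' - u‖ := by gcongr
  have h7 := mul_le_mul_of_nonneg_left h2 D.r_pos.le
  nlinarith

theorem eq_of_fixed {p : ℝ × ℝ} (hp : ‖p‖ < D.r) {f u u' : E}
    (hu : u = f + D.K (jump pos p u)) (hu' : u' = f + D.K (jump pos p u')) : u' = u := by
  have h := norm_sub_le le_rfl hu hu'
  rw [jump_sub] at h
  simp only [sub_self, norm_zero, mul_zero, add_zero] at h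
  have h1 : ‖u' - u‖ ≤ 0 := by
    by_contra! h2
    nlinarith [mul_pos (sub_pos.2 hp) h2]
  exact sub_eq_zero.1 (norm_le_zero_iff.1 h1)

variable [CompleteSpace E]

theorem sol_eq {p : ℝ × ℝ} (hp : ‖p‖ < D.r) (f : E) :
    D.sol p f = f + D.K (jump pos p (D.sol p f)) := by
  have hex : ∃ u, u = f + D.K (jump pos p u) := by
    have hr := D.r_pos
    have hc : ContractingWith (NNReal.mk (‖p‖ / D.r) (by positivity))
        (fun u => f + D.K (jump pos p u)) := by
      refine ⟨?_, LipschitzWith.of_dist_le_mul fun u v => ?_⟩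
      · rw [← NNReal.coe_lt_coe, NNReal.coe_mk]
        simpa using (div_lt_one hr).2 hp
      · rw [dist_eq_norm, dist_eq_norm, NNReal.coe_mk, add_sub_add_left_eq_sub, ← map_sub,
          div_mul_eq_mul_div, le_div_iff₀ hr, mul_comm]
        exact (D.K_norm _).trans (D.isPosPart.norm_jump_sub_le p u v)
    exact ⟨_, hc.fixedPoint_isFixedPt.symm⟩
  rw [sol, dif_pos hex]
  exact hex.choose_spec

theorem sol_unique {p : ℝ × ℝ} (hp : ‖p‖ < D.r) {f u : E} (hu : u = f + D.K (jump pos p u)) :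
    D.sol p f = u :=
  eq_of_fixed hp hu (sol_eq hp f)

theorem sol_smul {p : ℝ × ℝ} (hp : ‖p‖ < D.r) {t : ℝ} (ht : 0 ≤ t) (f : E) :
    D.sol p (t • f) = t • D.sol p f := by
  refine sol_unique hp ?_
  rw [D.isPosPart.jump_smul p t ht, map_smul, ← smul_add, ← sol_eq hp]

theorem energy_smul {p : ℝ × ℝ} (hp : ‖p‖ < D.r) {t : ℝ} (ht : 0 ≤ t) (f : E) :
    D.energy p (t • f) = t ^ 2 * D.energy p f := by
  simp only [energy, sol_smul hp ht, D.isPosPart.jump_smul p t ht, map_smul, inner_smul_left,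
    inner_smul_right, conj_trivial]
  ring

theorem continuousAt_sol {p : ℝ × ℝ} (hp : ‖p‖ < D.r) (f : E) :
    ContinuousAt (fun x : (ℝ × ℝ) × E => D.sol x.1 x.2) (p, f) := by
  have hj := D.isPosPart.continuous_jump
  obtain ⟨ρ, hpρ, hρ⟩ := exists_between hp
  have hev : ∀ᶠ x : (ℝ × ℝ) × E in 𝓝 (p, f), ‖x.1‖ < ρ :=
    (continuous_fst.norm.tendsto (p, f)).eventually_lt_const hpρ
  rw [ContinuousAt, tendsto_iff_norm_sub_tendsto_zero]
  refine squeeze_zero' (.of_forall fun _ => norm_nonneg _) (g := fun x : (ℝ × ℝ) × E =>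
    (D.r * ‖x.2 - f‖ + ‖jump pos (x.1 - p) (D.sol p f)‖) / (D.r - ρ)) ?_ ?_
  · filter_upwards [hev] with x hx
    rw [le_div_iff₀ (sub_pos.2 hρ), mul_comm]
    exact norm_sub_le hx.le (sol_eq hp f) (sol_eq (hx.trans hρ) x.2)
  · have hc : Continuous fun x : (ℝ × ℝ) × E =>
        (D.r * ‖x.2 - f‖ + ‖jump pos (x.1 - p) (D.sol p f)‖) / (D.r - ρ) := by
      have h2 : Continuous fun x : (ℝ × ℝ) × E => jump pos (x.1 - p) (D.sol p f) :=
        hj.comp (by fun_prop : Continuous fun x : (ℝ × ℝ) × E => (x.1 - p, D.sol p f))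
      fun_prop
    have := hc.tendsto (p, f)
    simpa [jump] using this

theorem continuousAt_energy {p : ℝ × ℝ} (hp : ‖p‖ < D.r) (f : E) :
    ContinuousAt (fun x : (ℝ × ℝ) × E => D.energy x.1 x.2) (p, f) := by
  have h1 := continuousAt_sol hp f
  have h2 : ContinuousAt (fun x : (ℝ × ℝ) × E => jump pos x.1 (D.sol x.1 x.2)) (p, f) :=
    ContinuousAt.comp (f := fun x : (ℝ × ℝ) × E => (x.1, D.sol x.1 x.2))
      D.isPosPart.continuous_jump.continuousAt (continuousAt_fst.prodMk h1)
  unfold energy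
  have h3 : Continuous fun x : (ℝ × ℝ) × E => ⟪D.A x.2, x.2⟫_ℝ := by fun_prop
  exact h3.continuousAt.sub (ContinuousAt.inner (𝕜 := ℝ) h2 continuousAt_snd)

/-- The derivative of the reduced energy in all variables. The derivative of `sol` does not enter,
because `sol` makes the energy stationary in the directions that were eliminated; the estimate rests
on the symmetry of `K` and on the approximate symmetry of the nonlinearity. -/
theorem hasDerivAt_energy {p : ℝ × ℝ} (hp : ‖p‖ < D.r) (q : ℝ × ℝ) (f φ : E) :
    HasDerivAt (fun t : ℝ => D.energy (p + t • q) (f + t • φ))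
      (2 * ⟪D.A f - jump pos p (D.sol p f), φ⟫_ℝ - ⟪jump pos q (D.sol p f), D.sol p f⟫_ℝ) 0 := by
  obtain ⟨ρ, hpρ, hρ⟩ := exists_between hp
  set u := D.sol p f with hu
  set w := jump pos p u with hw
  have hρ0 : 0 ≤ ρ := (norm_nonneg p).trans hpρ.le
  have hrρ : 0 < D.r - ρ := sub_pos.2 hρ
  set B := (D.r * ‖φ‖ + ‖jump pos q u‖) / (D.r - ρ) with hB
  have hB0 : 0 ≤ B := div_nonneg (by have := D.r_pos; positivity) hrρ.le
  set C := ‖D.A φ‖ * ‖φ‖ + (ρ * B + ‖jump pos q u‖) * ‖φ‖ + 4 * ‖p‖ * B ^ 2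
    + ‖q‖ * B * ‖u‖ with hC
  have hev : ∀ᶠ t : ℝ in 𝓝 0, ‖p + t • q‖ < ρ := by
    have : Continuous fun t : ℝ => ‖p + t • q‖ := by fun_prop
    have h := this.tendsto 0
    rw [zero_smul, add_zero] at h
    exact h.eventually_lt_const hpρ
  rw [hasDerivAt_iff_isLittleO]
  have hO : (fun t : ℝ => D.energy (p + t • q) (f + t • φ) - D.energy (p + (0 : ℝ) • q)
      (f + (0 : ℝ) • φ) - (t - 0) • (2 * ⟪D.A f - w, φ⟫_ℝ - ⟪jump pos q u, u⟫_ℝ))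
      =O[𝓝 0] fun t : ℝ => t ^ 2 := by
    refine Asymptotics.IsBigO.of_bound C ?_
    filter_upwards [hev] with t ht
    rw [zero_smul, zero_smul, add_zero, add_zero, sub_zero, smul_eq_mul]
    set p' := p + t • q with hp'
    set f' := f + t • φ with hf'
    have hp'r : ‖p'‖ < D.r := ht.trans hρ
    set u' := D.sol p' f' with hu'
    set w' := jump pos p' u' with hw'
    have e1 : u = f + D.K w := sol_eq hp f
    have e2 : u' = f' + D.K w' := sol_eq hp'r f'
    have hpp : p' - p = t • q := by rw [hp']; abel
    have hdu : ‖u' - u‖ ≤ B * |t| := by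
      have h := norm_sub_le ht.le e1 e2
      rw [hpp, jump_smul_left, hf', add_sub_cancel_left, norm_smul, norm_smul,
        Real.norm_eq_abs] at h
      rw [hB, div_mul_eq_mul_div, le_div_iff₀ hrρ]
      linarith
    have hwsplit : w' = jump pos p u' + t • jump pos q u' := by
      rw [← jump_smul_left, ← hpp, jump_sub]; abel
    have hdw : ‖w' - w‖ ≤ (ρ * B + ‖jump pos q u‖) * |t| := by
      have h : w' - w = (jump pos p' u' - jump pos p' u) + t • jump pos q u := by
        rw [← jump_smul_left, ← hpp, jump_sub]; abel
      rw [h]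
      have h1 := D.isPosPart.norm_jump_sub_le p' u' u
      have h2 : ‖p'‖ * ‖u' - u‖ ≤ ρ * (B * |t|) := by gcongr
      have h3 := norm_add_le (jump pos p' u' - jump pos p' u) (t • jump pos q u)
      rw [norm_smul, Real.norm_eq_abs] at h3
      linarith
    -- The eliminated components `K w`, `K w'` cancel by symmetry of `K`.
    have hswap : ⟪w, u'⟫_ℝ - ⟪w', u⟫_ℝ = ⟪w, f'⟫_ℝ - ⟪w', f⟫_ℝ := by
      have h1 : ⟪w, u'⟫_ℝ = ⟪w, f'⟫_ℝ + ⟪w, D.K w'⟫_ℝ := by rw [← inner_add_right, ← e2]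
      have h2 : ⟪w', u⟫_ℝ = ⟪w', f⟫_ℝ + ⟪w', D.K w⟫_ℝ := by rw [← inner_add_right, ← e1]
      rw [h1, h2, ← D.K_symm w w', real_inner_comm w' (D.K w)]
      ring
    -- An exact expansion in which every term of the remainder is quadratic in `t`.
    have hid : D.energy p' f' - D.energy p f
        - t * (2 * ⟪D.A f - w, φ⟫_ℝ - ⟪jump pos q u, u⟫_ℝ)
        = t ^ 2 * ⟪D.A φ, φ⟫_ℝ - t * ⟪w' - w, φ⟫_ℝ + (⟪w, u'⟫_ℝ - ⟪jump pos p u', u⟫_ℝ)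
          - t * ⟪jump pos q u' - jump pos q u, u⟫_ℝ := by
      have h1 : ⟪w', u⟫_ℝ = ⟪jump pos p u', u⟫_ℝ + t * ⟪jump pos q u', u⟫_ℝ := by
        rw [hwsplit, inner_add_left, inner_smul_left, conj_trivial]
      have h2 : ⟪D.A φ, f⟫_ℝ = ⟪D.A f, φ⟫_ℝ := by rw [D.A_symm, real_inner_comm]
      have h3 : D.energy p' f' = ⟪D.A f', f'⟫_ℝ - ⟪w', f'⟫_ℝ := rfl
      have h4 : D.energy p f = ⟪D.A f, f⟫_ℝ - ⟪w, f⟫_ℝ := rfl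
      rw [h3, h4]
      rw [h1] at hswap
      simp only [hf', map_add, map_smul, inner_add_left, inner_add_right, inner_sub_left,
        inner_smul_left, inner_smul_right, conj_trivial, h2] at hswap ⊢
      linarith
    rw [hid, Real.norm_eq_abs, Real.norm_eq_abs, abs_of_nonneg (sq_nonneg t), hC]
    have b1 : |t ^ 2 * ⟪D.A φ, φ⟫_ℝ| ≤ ‖D.A φ‖ * ‖φ‖ * t ^ 2 := by
      rw [abs_mul, abs_of_nonneg (sq_nonneg t), mul_comm]
      gcongr
      exact abs_real_inner_le_norm _ _
    have b2 : |t * ⟪w' - w, φ⟫_ℝ| ≤ (ρ * B + ‖jump pos q u‖) * ‖φ‖ * t ^ 2 := by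
      rw [abs_mul]
      calc |t| * |⟪w' - w, φ⟫_ℝ| ≤ |t| * (((ρ * B + ‖jump pos q u‖) * |t|) * ‖φ‖) := by
            gcongr
            exact (abs_real_inner_le_norm _ _).trans (by gcongr)
        _ = (ρ * B + ‖jump pos q u‖) * ‖φ‖ * |t| ^ 2 := by ring
        _ = _ := by rw [sq_abs]
    have b3 : |⟪w, u'⟫_ℝ - ⟪jump pos p u', u⟫_ℝ| ≤ 4 * ‖p‖ * B ^ 2 * t ^ 2 := by
      refine (D.isPosPart.abs_inner_jump_sub_le p u u').trans ?_
      rw [norm_sub_rev]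
      calc 4 * ‖p‖ * ‖u' - u‖ ^ 2 ≤ 4 * ‖p‖ * (B * |t|) ^ 2 := by gcongr
        _ = 4 * ‖p‖ * B ^ 2 * t ^ 2 := by rw [mul_pow, sq_abs]; ring
    have b4 : |t * ⟪jump pos q u' - jump pos q u, u⟫_ℝ| ≤ ‖q‖ * B * ‖u‖ * t ^ 2 := by
      rw [abs_mul]
      calc |t| * |⟪jump pos q u' - jump pos q u, u⟫_ℝ| ≤ |t| * ((‖q‖ * (B * |t|)) * ‖u‖) := by
            gcongr
            refine (abs_real_inner_le_norm _ _).trans ?_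
            gcongr
            exact (D.isPosPart.norm_jump_sub_le q u' u).trans (by gcongr)
        _ = ‖q‖ * B * ‖u‖ * |t| ^ 2 := by ring
        _ = _ := by rw [sq_abs]
    rw [abs_le] at *
    constructor <;> linarith [b1.1, b1.2, b2.1, b2.2, b3.1, b3.2, b4.1, b4.2]
  refine hO.trans_isLittleO ?_
  simp only [sub_zero]
  exact Asymptotics.isLittleO_pow_id (by norm_num)

/-- Along any direction with nonnegative entries the reduced energy decreases. -/
theorem energy_anti {p p' : ℝ × ℝ} (hp : ‖p‖ < D.r) (hp' : ‖p'‖ < D.r) (hle : p ≤ p') (f : E) :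
    D.energy p' f ≤ D.energy p f := by
  set q := p' - p with hq
  have hball : ∀ t ∈ Icc (0 : ℝ) 1, ‖p + t • q‖ < D.r := fun t ht => by
    have h := (convex_ball (0 : ℝ × ℝ) D.r).add_smul_sub_mem (mem_ball_zero_iff.2 hp)
      (mem_ball_zero_iff.2 hp') ht
    exact mem_ball_zero_iff.1 h
  have hd : ∀ t ∈ Icc (0 : ℝ) 1, HasDerivAt (fun t : ℝ => D.energy (p + t • q) f)
      (- ⟪jump pos q (D.sol (p + t • q) f), D.sol (p + t • q) f⟫_ℝ) t := fun t ht => by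
    have h := hasDerivAt_energy (hball t ht) q f 0
    simp only [smul_zero, add_zero, inner_zero_right, mul_zero, zero_sub] at h
    rw [← sub_self t] at h
    have h' := h.comp_sub_const t t
    refine h'.congr_of_eventuallyEq (.of_forall fun s => ?_)
    simp only
    rw [add_assoc, ← add_smul, add_sub_cancel]
  have hanti : AntitoneOn (fun t : ℝ => D.energy (p + t • q) f) (Icc 0 1) := by
    refine antitoneOn_of_deriv_nonpos (convex_Icc 0 1)
      (fun t ht => (hd t ht).continuousAt.continuousWithinAt)
      (fun t ht => (hd t (interior_subset ht)).differentiableAt.differentiableWithinAt)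
      fun t ht => ?_
    rw [(hd t (interior_subset ht)).deriv, D.isPosPart.inner_jump_self]
    have h1 : 0 ≤ q.1 := sub_nonneg.2 hle.1
    have h2 : 0 ≤ q.2 := sub_nonneg.2 hle.2
    have := mul_nonneg h1 (sq_nonneg ‖pos (D.sol (p + t • q) f)‖)
    have := mul_nonneg h2 (sq_nonneg ‖pos (-D.sol (p + t • q) f)‖)
    linarith
  have := hanti (left_mem_Icc.2 zero_le_one) (right_mem_Icc.2 zero_le_one) zero_le_one
  simpa [hq] using this

/-- The reduced energy decreases strictly where `sol` changes sign. -/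
theorem energy_lt {p p' : ℝ × ℝ} (hp : ‖p‖ < D.r) (hp' : ‖p'‖ < D.r) (hle : p ≤ p')
    (hne : p ≠ p') {f : E} (h1 : pos (D.sol p f) ≠ 0) (h2 : pos (-D.sol p f) ≠ 0) :
    D.energy p' f < D.energy p f := by
  set q := p' - p with hq
  have hd := hasDerivAt_energy hp q f 0
  simp only [smul_zero, add_zero, inner_zero_right, mul_zero, zero_sub] at hd
  have hneg : - ⟪jump pos q (D.sol p f), D.sol p f⟫_ℝ < 0 := by
    rw [D.isPosPart.inner_jump_self]
    have a1 : 0 < ‖pos (D.sol p f)‖ ^ 2 := by have := norm_pos_iff.2 h1; positivity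
    have a2 : 0 < ‖pos (-D.sol p f)‖ ^ 2 := by have := norm_pos_iff.2 h2; positivity
    have q1 : 0 ≤ q.1 := sub_nonneg.2 hle.1
    have q2 : 0 ≤ q.2 := sub_nonneg.2 hle.2
    rcases q1.eq_or_lt with h | h
    · have : 0 < q.2 := by
        refine q2.lt_of_ne fun h' => hne ?_
        exact (sub_eq_zero.1 (Prod.ext h.symm h'.symm : q = 0)).symm
      have := mul_pos this a2
      rw [← h]; linarith
    · have := mul_pos h a1
      have := mul_nonneg q2 a2.le
      linarith
  have hev := hd.tendsto_slope_zero_right.eventually_lt_const hneg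
  have hev2 : ∀ᶠ t : ℝ in 𝓝[>] 0, t < 1 :=
    nhdsWithin_le_nhds (eventually_lt_nhds zero_lt_one)
  obtain ⟨t, ht, ht1, ht0⟩ := (hev.and (hev2.and self_mem_nhdsWithin)).exists
  have ht0 : 0 < t := ht0
  simp only [zero_add, zero_smul, add_zero, smul_eq_mul] at ht
  have hlt : D.energy (p + t • q) f < D.energy p f := by
    by_contra! hcon
    exact absurd ht (not_lt.2 (mul_nonneg (inv_pos.2 ht0).le (sub_nonneg.2 hcon)))
  have hmem : ‖p + t • q‖ < D.r :=
    mem_ball_zero_iff.1 ((convex_ball (0 : ℝ × ℝ) D.r).add_smul_sub_mem (mem_ball_zero_iff.2 hp)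
      (mem_ball_zero_iff.2 hp') ⟨ht0.le, ht1.le⟩)
  refine (energy_anti hmem hp' ?_ f).trans_lt hlt
  have q1 : 0 ≤ q.1 := sub_nonneg.2 hle.1
  have q2 : 0 ≤ q.2 := sub_nonneg.2 hle.2
  have e : p' = p + q := by rw [hq]; abel
  rw [e]
  constructor
  · simp only [Prod.fst_add, Prod.smul_fst, smul_eq_mul]; nlinarith
  · simp only [Prod.snd_add, Prod.smul_snd, smul_eq_mul]; nlinarith

end Reduction

end Reduction

/-! ### Diagonal operators and spectral reduction -/

section Diagonal

variable {E ι : Type*} [NormedAddCommGroup E] [InnerProductSpace ℝ E] (b : HilbertBasis ι ℝ E)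

theorem hilbertBasis_ext {u v : E} (h : ∀ i, ⟪b i, u⟫_ℝ = ⟪b i, v⟫_ℝ) : u = v := by
  apply b.repr.injective
  ext i
  rw [b.repr_apply_apply, b.repr_apply_apply, h i]

theorem hilbertBasis_hasSum_sq (u : E) : HasSum (fun i => ⟪b i, u⟫_ℝ ^ 2) (‖u‖ ^ 2) := by
  have h := b.hasSum_inner_mul_inner u u
  rw [real_inner_self_eq_norm_sq] at h
  refine h.congr_fun fun i => ?_
  rw [real_inner_comm, sq]

theorem hilbertBasis_exists_of_summable {a : ι → ℝ} (ha : Summable fun i => a i ^ 2) :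
    ∃ u : E, ∀ i, ⟪b i, u⟫_ℝ = a i := by
  have hmem : Memℓp a 2 := memℓp_gen (by simpa using ha)
  refine ⟨b.repr.symm ⟨a, hmem⟩, fun i => ?_⟩
  rw [← b.repr_apply_apply, LinearIsometryEquiv.apply_symm_apply]

theorem exists_diagonal_vector {κ : ι → ℝ} {C : ℝ} (h : ∀ i, |κ i| ≤ C) (w : E) :
    ∃ v : E, ∀ i, ⟪b i, v⟫_ℝ = κ i * ⟪b i, w⟫_ℝ := by
  refine hilbertBasis_exists_of_summable b ?_
  refine Summable.of_nonneg_of_le (fun i => sq_nonneg _) (fun i => ?_)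
    ((hilbertBasis_hasSum_sq b w).summable.mul_left (C ^ 2))
  rw [mul_pow, ← sq_abs (κ i)]
  gcongr
  exact h i

/-- The bounded operator with `b i ↦ κ i • b i`. -/
def diagonalOp (κ : ι → ℝ) (C : ℝ) (h : ∀ i, |κ i| ≤ C) : E →L[ℝ] E :=
  LinearMap.mkContinuous
    { toFun := fun w => (exists_diagonal_vector b h w).choose
      map_add' := fun v w => hilbertBasis_ext b fun i => by
        rw [inner_add_right, (exists_diagonal_vector b h _).choose_spec,
          (exists_diagonal_vector b h _).choose_spec, (exists_diagonal_vector b h _).choose_spec,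
          inner_add_right, mul_add]
      map_smul' := fun t w => hilbertBasis_ext b fun i => by
        rw [RingHom.id_apply, inner_smul_right, (exists_diagonal_vector b h _).choose_spec,
          (exists_diagonal_vector b h _).choose_spec, inner_smul_right]
        ring }
    |C| fun w => by
      have h1 := hilbertBasis_hasSum_sq b (exists_diagonal_vector b h w).choose
      have h2 := (hilbertBasis_hasSum_sq b w).mul_left (|C| ^ 2)
      have h3 := hasSum_le (fun i => ?_) h1 h2
      · rw [← mul_pow] at h3
        exact abs_le_of_sq_le_sq' h3 (by positivity) |>.2
      · rw [(exists_diagonal_vector b h _).choose_spec, mul_pow, ← sq_abs (κ i)]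
        have := (h i).trans (le_abs_self C)
        gcongr

variable {κ : ι → ℝ} {C : ℝ} (h : ∀ i, |κ i| ≤ C)

theorem inner_diagonalOp (w : E) (i : ι) :
    ⟪b i, diagonalOp b κ C h w⟫_ℝ = κ i * ⟪b i, w⟫_ℝ :=
  (exists_diagonal_vector b h w).choose_spec i

theorem norm_diagonalOp_le (hC : 0 ≤ C) (w : E) : ‖diagonalOp b κ C h w‖ ≤ C * ‖w‖ := by
  have := LinearMap.mkContinuous_norm_le _ (abs_nonneg C) _ |> (diagonalOp b κ C h).le_of_opNorm_le
  simpa [abs_of_nonneg hC] using this w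

theorem diagonalOp_symm (v w : E) :
    ⟪diagonalOp b κ C h v, w⟫_ℝ = ⟪v, diagonalOp b κ C h w⟫_ℝ := by
  rw [← b.tsum_inner_mul_inner, ← b.tsum_inner_mul_inner]
  congr 1
  ext i
  rw [real_inner_comm, inner_diagonalOp, inner_diagonalOp, real_inner_comm v]
  ring

variable {b}

theorem mem_span_image_iff {F : Set ι} (hF : F.Finite) {f : E} :
    f ∈ Submodule.span ℝ (b '' F) ↔ ∀ i ∉ F, ⟪b i, f⟫_ℝ = 0 := by
  constructor
  · intro hf i hi
    induction hf using Submodule.span_induction with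
    | mem x hx =>
      obtain ⟨j, hj, rfl⟩ := hx
      exact b.orthonormal.2 fun hij => hi (hij ▸ hj)
    | zero => exact inner_zero_right _
    | add x y _ _ hx hy => rw [inner_add_right, hx, hy, add_zero]
    | smul t x _ hx => rw [inner_smul_right, hx, mul_zero]
  · intro hf
    have h1 := b.hasSum_repr f
    have h2 : HasSum (fun i => b.repr f i • b i) (∑ i ∈ hF.toFinset, b.repr f i • b i) := by
      refine hasSum_sum_of_ne_finset_zero fun i hi => ?_
      rw [b.repr_apply_apply, hf i (by simpa using hi), zero_smul]
    rw [h1.unique h2]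
    refine Submodule.sum_mem _ fun i hi => Submodule.smul_mem _ _ (Submodule.subset_span ?_)
    exact ⟨i, by simpa using hi, rfl⟩

end Diagonal

section Spectral

variable {E ι : Type*} [NormedAddCommGroup E] [InnerProductSpace ℝ E]
  {b : HilbertBasis ι ℝ E} {ev : ι → ℝ} {pos : E → E}

/-- `u` solves `L u = p.1 u⁺ - p.2 u⁻`, where `L` is the diagonal operator with `L (b i) = ev i • b i`.
The equation is tested against each basis vector. -/
def IsSol (b : HilbertBasis ι ℝ E) (ev : ι → ℝ) (pos : E → E) (p : ℝ × ℝ) (u : E) : Prop :=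
  ∀ i, ev i * ⟪b i, u⟫_ℝ = ⟪b i, jump pos p u⟫_ℝ

/-- The equation with parameters `p` has a nontrivial solution. -/
def Solvable (b : HilbertBasis ι ℝ E) (ev : ι → ℝ) (pos : E → E) (p : ℝ × ℝ) : Prop :=
  ∃ u, u ≠ 0 ∧ IsSol b ev pos p u

theorem Solvable.swap {p : ℝ × ℝ} (h : Solvable b ev pos p) :
    Solvable b ev pos p.swap := by
  obtain ⟨u, hu, hs⟩ := h
  refine ⟨-u, neg_ne_zero.2 hu, fun i => ?_⟩
  rw [jump_neg, inner_neg_right, inner_neg_right, ← hs i, mul_neg]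

theorem solvable_diag (hc : IsPosPart pos) (i : ι) : Solvable b ev pos (ev i, ev i) := by
  refine ⟨b i, fun h => ?_, fun j => ?_⟩
  · have := b.orthonormal.1 i
    rw [h, norm_zero] at this
    exact zero_ne_one this
  · rw [hc.jump_diag, inner_smul_right]
    by_cases hij : j = i
    · rw [hij]
    · rw [b.orthonormal.2 hij, mul_zero, mul_zero]

/-- The part of the spectrum in an open interval. -/
def window (ev : ι → ℝ) (α M : ℝ) : Set ι := {i | α < ev i ∧ ev i < M}

/-- A point of the square `]α, M[²`, seen from the centre of the square. -/
def recenter (α M : ℝ) (p : ℝ × ℝ) : ℝ × ℝ := p - ((α + M) / 2, (α + M) / 2)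

theorem norm_recenter_lt {α M : ℝ} {p : ℝ × ℝ} (h1 : p.1 ∈ Ioo α M) (h2 : p.2 ∈ Ioo α M) :
    ‖recenter α M p‖ < (M - α) / 2 := by
  rw [recenter, Prod.norm_def, max_lt_iff]
  simp only [Prod.fst_sub, Prod.snd_sub, Real.norm_eq_abs, abs_lt, mem_Ioo] at *
  refine ⟨⟨?_, ?_⟩, ?_, ?_⟩ <;> linarith

theorem abs_sub_center_ge {α M t : ℝ} (h : ¬ (α < t ∧ t < M)) :
    (M - α) / 2 ≤ |t - (α + M) / 2| := by
  rcases le_or_gt t α with h1 | h1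
  · refine le_trans ?_ (neg_le_abs _); linarith
  · have h2 : M ≤ t := not_lt.1 fun h2 => h ⟨h1, h2⟩
    refine le_trans ?_ (le_abs_self _); linarith

theorem abs_sub_center_le {α M t : ℝ} (h : α < t ∧ t < M) :
    |t - (α + M) / 2| ≤ (M - α) / 2 := by
  rw [abs_le]; constructor <;> linarith [h.1, h.2]

open Classical in
/-- The reduction to the eigenspaces with eigenvalue in `]α, M[`, for `p` in `]α, M[²`. Both sides of
the equation are shifted by the centre of the interval. -/
def spectralReduction (b : HilbertBasis ι ℝ E) (ev : ι → ℝ) (hc : IsPosPart pos) {α M : ℝ}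
    (hαM : α < M) : Reduction pos where
  K := diagonalOp b (fun i => if i ∈ window ev α M then 0 else (ev i - (α + M) / 2)⁻¹)
    ((M - α) / 2)⁻¹ fun i => by
      have hr : 0 < (M - α) / 2 := by linarith
      split_ifs with h
      · rw [abs_zero]; positivity
      · rw [abs_inv]
        exact inv_anti₀ hr (abs_sub_center_ge h)
  A := diagonalOp b (fun i => if i ∈ window ev α M then ev i - (α + M) / 2 else 0)
    ((M - α) / 2) fun i => by
      have hr : 0 < (M - α) / 2 := by linarith
      split_ifs with h
      · exact abs_sub_center_le h
      · rw [abs_zero]; exact hr.le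
  r := (M - α) / 2
  isPosPart := hc
  r_pos := by linarith
  K_symm := diagonalOp_symm b _
  K_norm := fun w => by
    have hr : 0 < (M - α) / 2 := by linarith
    rw [← le_inv_mul_iff₀ hr]
    exact norm_diagonalOp_le b _ (by positivity) w
  A_symm := diagonalOp_symm b _

variable {hc : IsPosPart pos} {α M : ℝ} {hαM : α < M}

theorem inner_K_of_mem {i : ι} (hi : i ∈ window ev α M) (w : E) :
    ⟪b i, (spectralReduction b ev hc hαM).K w⟫_ℝ = 0 := by
  simp only [spectralReduction]
  rw [inner_diagonalOp, if_pos hi, zero_mul]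

theorem inner_K_of_notMem {i : ι} (hi : i ∉ window ev α M) (w : E) :
    (ev i - (α + M) / 2) * ⟪b i, (spectralReduction b ev hc hαM).K w⟫_ℝ = ⟪b i, w⟫_ℝ := by
  simp only [spectralReduction]
  rw [inner_diagonalOp, if_neg hi, mul_inv_cancel_left₀]
  intro h
  have := abs_sub_center_ge hi
  rw [h, abs_zero] at this
  linarith

theorem inner_A_of_mem {i : ι} (hi : i ∈ window ev α M) (w : E) :
    ⟪b i, (spectralReduction b ev hc hαM).A w⟫_ℝ = (ev i - (α + M) / 2) * ⟪b i, w⟫_ℝ := by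
  simp only [spectralReduction]
  rw [inner_diagonalOp, if_pos hi]

theorem jump_recenter (hc : IsPosPart pos) (p : ℝ × ℝ) (u : E) :
    jump pos (recenter α M p) u = jump pos p u - ((α + M) / 2) • u := by
  rw [recenter, jump_sub, hc.jump_diag]

/-- The reduced energy is positive definite on the eigenspaces of the window. -/
def PosBox (b : HilbertBasis ι ℝ E) (ev : ι → ℝ) (hc : IsPosPart pos) {α M : ℝ} (hαM : α < M)
    (p : ℝ × ℝ) : Prop :=
  ∀ f ∈ Submodule.span ℝ (b '' window ev α M), f ≠ 0 →
    0 < (spectralReduction b ev hc hαM).energy (recenter α M p) f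

theorem norm_recenter_lt_r {p : ℝ × ℝ} (h1 : p.1 ∈ Ioo α M) (h2 : p.2 ∈ Ioo α M) :
    ‖recenter α M p‖ < (spectralReduction b ev hc hαM).r := norm_recenter_lt h1 h2

variable [CompleteSpace E]

/-- A nontrivial solution is a nontrivial zero of the reduced energy. -/
theorem not_solvable_of_posBox (hF : (window ev α M).Finite) {p : ℝ × ℝ} (h1 : p.1 ∈ Ioo α M)
    (h2 : p.2 ∈ Ioo α M) (hpos : PosBox b ev hc hαM p) : ¬ Solvable b ev pos p := by
  rintro ⟨u, hu0, hu⟩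
  set D := spectralReduction b ev hc hαM with hD
  have hr : ‖recenter α M p‖ < D.r := norm_recenter_lt_r h1 h2
  set w := jump pos (recenter α M p) u with hw
  have hwi : ∀ i, ⟪b i, w⟫_ℝ = (ev i - (α + M) / 2) * ⟪b i, u⟫_ℝ := fun i => by
    rw [hw, jump_recenter hc, inner_sub_right, ← hu i, inner_smul_right, sub_mul]
  set f := u - D.K w with hf
  have hfout : ∀ i ∉ window ev α M, ⟪b i, f⟫_ℝ = 0 := fun i hi => by
    have hne : ev i - (α + M) / 2 ≠ 0 := fun h => by
      have := abs_sub_center_ge hi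
      rw [h, abs_zero] at this
      linarith
    apply mul_left_cancel₀ hne
    rw [hf, inner_sub_right, mul_sub, inner_K_of_notMem hi, hwi, sub_self, mul_zero]
  have hfin : ∀ i ∈ window ev α M, ⟪b i, f⟫_ℝ = ⟪b i, u⟫_ℝ := fun i hi => by
    rw [hf, inner_sub_right, inner_K_of_mem hi, sub_zero]
  have hsol : D.sol (recenter α M p) f = u := Reduction.sol_unique hr (by rw [hf]; abel)
  have hf0 : f ≠ 0 := fun h => by
    have h0 := Reduction.sol_smul hr le_rfl (0 : E)
    rw [zero_smul, zero_smul] at h0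
    rw [h, h0] at hsol
    exact hu0 hsol.symm
  have hE : D.energy (recenter α M p) f = 0 := by
    rw [Reduction.energy, hsol, ← inner_sub_left, ← b.tsum_inner_mul_inner]
    convert! tsum_zero with i
    by_cases hi : i ∈ window ev α M
    · rw [real_inner_comm, inner_sub_right, inner_A_of_mem hi, hfin i hi, ← hw, hwi, sub_self,
        zero_mul]
    · rw [hfout i hi, mul_zero]
  exact (hpos f ((mem_span_image_iff hF).2 hfout) hf0).ne' hE

theorem PosBox.anti {p p' : ℝ × ℝ} (h1 : p.1 ∈ Ioo α M) (h2 : p.2 ∈ Ioo α M)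
    (h1' : p'.1 ∈ Ioo α M) (h2' : p'.2 ∈ Ioo α M) (hle : p ≤ p')
    (h : PosBox b ev hc hαM p') : PosBox b ev hc hαM p := fun f hf hf0 =>
  (h f hf hf0).trans_le (Reduction.energy_anti (norm_recenter_lt_r h1 h2)
    (norm_recenter_lt_r h1' h2') (sub_le_sub_right hle _) f)

theorem continuous_recenter : Continuous (recenter α M) := by unfold recenter; fun_prop

theorem continuousAt_energy_recenter {p : ℝ × ℝ} (h1 : p.1 ∈ Ioo α M) (h2 : p.2 ∈ Ioo α M)
    (f : E) : ContinuousAt (fun z : (ℝ × ℝ) × E =>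
      (spectralReduction b ev hc hαM).energy (recenter α M z.1) z.2) (p, f) :=
  ContinuousAt.comp (x := (p, f)) (f := fun z : (ℝ × ℝ) × E => (recenter α M z.1, z.2))
    (g := fun x : (ℝ × ℝ) × E => (spectralReduction b ev hc hαM).energy x.1 x.2)
    (Reduction.continuousAt_energy (norm_recenter_lt_r h1 h2) f)
    ((continuous_recenter.comp continuous_fst).prodMk continuous_snd).continuousAt

theorem PosBox.eventually (hF : (window ev α M).Finite) {p : ℝ × ℝ} (h1 : p.1 ∈ Ioo α M)
    (h2 : p.2 ∈ Ioo α M) (h : PosBox b ev hc hαM p) :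
    ∀ᶠ p' in 𝓝 p, PosBox b ev hc hαM p' := by
  set D := spectralReduction b ev hc hαM with hD
  set V := Submodule.span ℝ (b '' window ev α M) with hV
  have : FiniteDimensional ℝ V := FiniteDimensional.span_of_finite ℝ (hF.image _)
  have hS : IsCompact ((↑) '' Metric.sphere (0 : V) 1 : Set E) :=
    (isCompact_sphere (0 : V) 1).image continuous_subtype_val
  have hev : ∀ᶠ p' in 𝓝 p, ∀ f ∈ ((↑) '' Metric.sphere (0 : V) 1 : Set E),
      0 < D.energy (recenter α M p') f := by
    refine hS.eventually_forall_of_forall_eventually ?_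
    rintro _ ⟨f, hf, rfl⟩
    have hf0 : (f : E) ≠ 0 := by
      rintro h0
      rw [mem_sphere_zero_iff_norm, Submodule.coe_norm, h0, norm_zero] at hf
      exact zero_ne_one hf
    exact (continuousAt_energy_recenter h1 h2 (f : E)).eventually_const_lt (h f f.2 hf0)
  have hin : ∀ᶠ p' : ℝ × ℝ in 𝓝 p, p'.1 ∈ Ioo α M ∧ p'.2 ∈ Ioo α M :=
    (continuous_fst.continuousAt.eventually (isOpen_Ioo.mem_nhds h1)).and
      (continuous_snd.continuousAt.eventually (isOpen_Ioo.mem_nhds h2))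
  filter_upwards [hev, hin] with p' hp' hb f hf hf0
  have hn : 0 < ‖f‖ := norm_pos_iff.2 hf0
  have hscale : f = ‖f‖ • (‖f‖⁻¹ • f) := by rw [smul_inv_smul₀ hn.ne']
  rw [hscale, Reduction.energy_smul (norm_recenter_lt_r hb.1 hb.2) hn.le]
  refine mul_pos (by positivity) (hp' _ ⟨⟨‖f‖⁻¹ • f, V.smul_mem _ hf⟩, ?_, rfl⟩)
  rw [mem_sphere_zero_iff_norm, Submodule.coe_norm, norm_smul, norm_inv, norm_norm,
    inv_mul_cancel₀ hn.ne']

/-- For equal parameters the equation is linear and decouples. -/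
theorem posBox_diag (hF : (window ev α M).Finite) {t : ℝ} (ht : t ∈ Ioo α M)
    (hev : ∀ i ∈ window ev α M, t < ev i) : PosBox b ev hc hαM (t, t) := by
  intro f hf hf0
  set D := spectralReduction b ev hc hαM with hD
  have hout := (mem_span_image_iff hF).1 hf
  have hr : ‖recenter α M (t, t)‖ < D.r := norm_recenter_lt_r ht ht
  have hj : jump pos (recenter α M (t, t)) f = (t - (α + M) / 2) • f := by
    rw [jump_recenter hc, hc.jump_diag, sub_smul]
  have hK : D.K f = 0 := by
    refine hilbertBasis_ext b fun i => ?_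
    rw [inner_zero_right]
    by_cases hi : i ∈ window ev α M
    · exact inner_K_of_mem hi f
    · have h := inner_K_of_notMem (b := b) (hc := hc) (hαM := hαM) hi f
      rw [hout i hi] at h
      refine (mul_eq_zero.1 h).resolve_left fun h => ?_
      have := abs_sub_center_ge hi
      rw [h, abs_zero] at this
      linarith
  have hsol : D.sol (recenter α M (t, t)) f = f := by
    refine Reduction.sol_unique hr ?_
    rw [hj, map_smul, hK, smul_zero, add_zero]
  rw [Reduction.energy, hsol, hj, ← inner_sub_left, ← b.tsum_inner_mul_inner]
  have hterm : ∀ i, ⟪D.A f - (t - (α + M) / 2) • f, b i⟫_ℝ * ⟪b i, f⟫_ℝ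
      = (ev i - t) * ⟪b i, f⟫_ℝ ^ 2 := fun i => by
    by_cases hi : i ∈ window ev α M
    · rw [real_inner_comm, inner_sub_right, inner_A_of_mem hi, inner_smul_right]; ring
    · rw [hout i hi]; ring
  have hsum := b.summable_inner_mul_inner (D.A f - (t - (α + M) / 2) • f) f
  simp_rw [hterm] at hsum ⊢
  obtain ⟨i, hi⟩ : ∃ i, ⟪b i, f⟫_ℝ ≠ 0 := by
    by_contra! hcon
    exact hf0 (hilbertBasis_ext b fun i => by rw [hcon i, inner_zero_right])
  have hiF : i ∈ window ev α M := by_contra fun h => hi (hout i h)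
  refine hsum.tsum_pos (fun j => ?_) i (mul_pos (sub_pos.2 (hev i hiF)) (by positivity))
  by_cases hj : j ∈ window ev α M
  · exact mul_nonneg (sub_pos.2 (hev j hj)).le (sq_nonneg _)
  · rw [hout j hj]; simp

/-- On the boundary of the region of positivity the reduced energy attains its minimum `0` at a
nonzero vector, which is then a critical point. -/
theorem exists_isSol_of_boundary (hF : (window ev α M).Finite) {p : ℝ × ℝ} (h1 : p.1 ∈ Ioo α M)
    (h2 : p.2 ∈ Ioo α M) (hn : ¬ PosBox b ev hc hαM p)
    (hfr : ∃ᶠ p' in 𝓝 p, PosBox b ev hc hαM p') :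
    ∃ f ∈ Submodule.span ℝ (b '' window ev α M), f ≠ 0 ∧
      (spectralReduction b ev hc hαM).energy (recenter α M p) f = 0 ∧
      (spectralReduction b ev hc hαM).sol (recenter α M p) f ≠ 0 ∧
      IsSol b ev pos p ((spectralReduction b ev hc hαM).sol (recenter α M p) f) := by
  set D := spectralReduction b ev hc hαM with hD
  set V := Submodule.span ℝ (b '' window ev α M) with hV
  have hr : ‖recenter α M p‖ < D.r := norm_recenter_lt_r h1 h2
  have hnonneg : ∀ f ∈ V, 0 ≤ D.energy (recenter α M p) f := by
    intro f hf
    by_contra! hlt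
    have hf0 : f ≠ 0 := fun h => by
      rw [h, Reduction.energy, inner_zero_right, inner_zero_right, sub_zero] at hlt
      exact hlt.false
    have hcont : ContinuousAt (fun p' => D.energy (recenter α M p') f) p :=
      (continuousAt_energy_recenter h1 h2 f).comp
        (f := fun p' : ℝ × ℝ => (p', f)) (continuousAt_id.prodMk continuousAt_const)
    obtain ⟨p', hp', hp''⟩ := (hfr.and_eventually (hcont.eventually_lt_const hlt)).exists
    exact (hp' f hf hf0).not_gt hp''
  simp only [PosBox, not_forall, not_lt] at hn
  obtain ⟨f, hf, hf0, hle⟩ := hn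
  have hE : D.energy (recenter α M p) f = 0 := le_antisymm hle (hnonneg f hf)
  -- `f` minimizes the energy on `V`, so the gradient at `f` is orthogonal to `V`.
  have hcrit : ∀ φ ∈ V, ⟪D.A f - jump pos (recenter α M p) (D.sol (recenter α M p) f), φ⟫_ℝ = 0 := by
    intro φ hφ
    have hd := Reduction.hasDerivAt_energy hr 0 f φ
    simp only [smul_zero, add_zero] at hd
    have hmin : IsLocalMin (fun t : ℝ => D.energy (recenter α M p) (f + t • φ)) 0 := by
      refine .of_forall fun t => ?_
      simp only [zero_smul, add_zero]
      rw [hE]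
      exact hnonneg _ (V.add_mem hf (V.smul_mem _ hφ))
    have h0 := hmin.hasDerivAt_eq_zero hd
    simpa [jump] using h0
  have hs := Reduction.sol_eq hr f
  set u := D.sol (recenter α M p) f with hu
  set w := jump pos (recenter α M p) u with hw
  have hwi : ∀ i, ⟪b i, w⟫_ℝ = ⟪b i, jump pos p u⟫_ℝ - (α + M) / 2 * ⟪b i, u⟫_ℝ := fun i => by
    rw [hw, jump_recenter hc, inner_sub_right, inner_smul_right]
  have hui : ∀ i, ⟪b i, u⟫_ℝ = ⟪b i, f⟫_ℝ + ⟪b i, D.K w⟫_ℝ := fun i => by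
    rw [← inner_add_right, ← hs]
  have hout := (mem_span_image_iff hF).1 hf
  refine ⟨f, hf, hf0, hE, fun hu0 => ?_, fun i => ?_⟩
  · apply hf0
    rw [← hu] at hu0
    rw [hw, hu0, hc.jump_zero, map_zero, add_zero] at hs
    exact hs.symm
  · by_cases hi : i ∈ window ev α M
    · have h := hcrit (b i) (Submodule.subset_span ⟨i, hi, rfl⟩)
      rw [real_inner_comm, inner_sub_right, inner_A_of_mem hi, hwi] at h
      have h' := hui i
      rw [inner_K_of_mem hi, add_zero] at h'
      rw [← h'] at h
      linarith
    · have h := hui i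
      rw [hout i hi, zero_add] at h
      have h' := inner_K_of_notMem (b := b) (hc := hc) (hαM := hαM) hi w
      rw [← h, hwi] at h'
      linarith

end Spectral

/-! ### The region without solutions -/

/-- The upper boundary, in the square `I ×ˢ I`, of a set `U`: the points outside `U` such that all
points of the square below them on the same parallel to the diagonal belong to `U`. -/
def upperBoundary (I : Set ℝ) (U : Set (ℝ × ℝ)) : Set (ℝ × ℝ) :=
  {p | p ∈ I ×ˢ I ∧ p ∉ U ∧ ∀ ε > 0, p - (ε, ε) ∈ I ×ˢ I → p - (ε, ε) ∈ U}

theorem sub_zero_diag (p : ℝ × ℝ) : p - ((0 : ℝ), (0 : ℝ)) = p := sub_zero p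

/-- The interval `I` has left end point `α`; there are no eigenvalues in `]α, μ[`, the number `μ` is
an eigenvalue, and `I` is exhausted by intervals `]α, M[` that carry finitely many eigenvalues. -/
structure IsSpectralInterval {ι : Type*} (ev : ι → ℝ) (I : Set ℝ) (α μ : ℝ) : Prop where
  subset : I ⊆ Ioi α
  exhaust : ∀ x ∈ I, ∃ M, x < M ∧ Ioo α M ⊆ I ∧ (window ev α M).Finite
  gap : ∀ i, ev i ≤ α ∨ μ ≤ ev i
  mem : μ ∈ I
  eigenvalue : ∃ i, ev i = μ

section Region

variable {E ι : Type*} [NormedAddCommGroup E] [InnerProductSpace ℝ E]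
  {b : HilbertBasis ι ℝ E} {ev : ι → ℝ} {pos : E → E} {I : Set ℝ} {α μ : ℝ}

namespace IsSpectralInterval

variable (hI : IsSpectralInterval ev I α μ)
include hI

theorem isOpen : IsOpen I := by
  refine isOpen_iff_mem_nhds.2 fun x hx => ?_
  obtain ⟨M, hM, hsub, -⟩ := hI.exhaust x hx
  exact mem_of_superset (isOpen_Ioo.mem_nhds ⟨hI.subset hx, hM⟩) hsub

theorem mem_of_le {x y : ℝ} (hx : x ∈ I) (hy : α < y) (hyx : y ≤ x) : y ∈ I := by
  obtain ⟨M, hM, hsub, -⟩ := hI.exhaust x hx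
  exact hsub ⟨hy, hyx.trans_lt hM⟩

theorem ordConnected : I.OrdConnected :=
  ⟨fun _ hx _ hy _ hz => hI.mem_of_le hy (lt_of_lt_of_le (hI.subset hx) hz.1) hz.2⟩

theorem exists_box {p : ℝ × ℝ} (hp : p ∈ I ×ˢ I) :
    ∃ M, p.1 ∈ Ioo α M ∧ p.2 ∈ Ioo α M ∧ Ioo α M ⊆ I ∧ (window ev α M).Finite := by
  have h : max p.1 p.2 ∈ I := by rcases max_choice p.1 p.2 with h | h <;> rw [h]; exacts [hp.1, hp.2]
  obtain ⟨M, hM, hsub, hF⟩ := hI.exhaust _ h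
  exact ⟨M, ⟨hI.subset hp.1, (le_max_left _ _).trans_lt hM⟩,
    ⟨hI.subset hp.2, (le_max_right _ _).trans_lt hM⟩, hsub, hF⟩

end IsSpectralInterval

/-- The points of the square such that neither they nor any smaller point of the square are
solvable. -/
def solutionFree (b : HilbertBasis ι ℝ E) (ev : ι → ℝ) (pos : E → E) (I : Set ℝ) : Set (ℝ × ℝ) :=
  {p | p ∈ I ×ˢ I ∧ ∀ p' ∈ I ×ˢ I, p' ≤ p → ¬ Solvable b ev pos p'}

theorem solutionFree_lower {p p' : ℝ × ℝ} (hp : p ∈ solutionFree b ev pos I)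
    (hp' : p' ∈ I ×ˢ I) (hle : p' ≤ p) : p' ∈ solutionFree b ev pos I :=
  ⟨hp', fun q hq hqp => hp.2 q hq (hqp.trans hle)⟩

theorem solutionFree_swap {p : ℝ × ℝ} (hp : p ∈ solutionFree b ev pos I) :
    p.swap ∈ solutionFree b ev pos I :=
  ⟨⟨hp.1.2, hp.1.1⟩, fun q hq hqp hs =>
    hp.2 q.swap ⟨hq.2, hq.1⟩ ⟨hqp.2, hqp.1⟩ hs.swap⟩

variable [CompleteSpace E]

/-- Positivity of the reduced energy does not depend on the window: it says that nothing below is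
solvable. If positivity fails at `p`, it fails for the first time somewhere on the way to `p` from the
corner of the square, and at that point there is a solution. -/
theorem mem_solutionFree_iff (hI : IsSpectralInterval ev I α μ) (hc : IsPosPart pos) {M : ℝ}
    (hαM : α < M) (hsub : Ioo α M ⊆ I) (hF : (window ev α M).Finite) {p : ℝ × ℝ}
    (h1 : p.1 ∈ Ioo α M) (h2 : p.2 ∈ Ioo α M) :
    p ∈ solutionFree b ev pos I ↔ PosBox b ev hc hαM p := by
  constructor
  · intro hp
    by_contra hn
    have hαμ : α < μ := hI.subset hI.mem
    -- The path `P` starts at a diagonal point below both `p` and `(μ, μ)`, where positivity holds.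
    obtain ⟨t, ht, htm⟩ := exists_between (lt_min (lt_min h1.1 h2.1) hαμ)
    obtain ⟨⟨ht1, ht2⟩, ht3⟩ := (lt_min_iff.1 htm).imp_left lt_min_iff.1
    set p₀ : ℝ × ℝ := (t, t) with hp₀
    set P : ℝ → ℝ × ℝ := fun s => p₀ + s • (p - p₀) with hP
    have hPc : Continuous P := by fun_prop
    have hP1 : P 1 = p := by simp [hP]
    have hP0 : P 0 = p₀ := by simp [hP]
    have hle₀ : p₀ ≤ p := ⟨ht1.le, ht2.le⟩
    have hPmono : Monotone P := fun s s' hss' => by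
      constructor
      · simp only [hP, Prod.fst_add, Prod.smul_fst, Prod.fst_sub, smul_eq_mul]
        nlinarith [hle₀.1]
      · simp only [hP, Prod.snd_add, Prod.smul_snd, Prod.snd_sub, smul_eq_mul]
        nlinarith [hle₀.2]
    have hbox : ∀ s ∈ Icc (0 : ℝ) 1, (P s).1 ∈ Ioo α M ∧ (P s).2 ∈ Ioo α M := fun s hs => by
      have a := hPmono hs.1
      have c := hPmono hs.2
      rw [hP0] at a
      rw [hP1] at c
      exact ⟨⟨ht.trans_le a.1, c.1.trans_lt h1.2⟩, ⟨ht.trans_le a.2, c.2.trans_lt h2.2⟩⟩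
    have hpos0 : PosBox b ev hc hαM p₀ := by
      refine posBox_diag hF ⟨ht, ht1.trans h1.2⟩ fun i hi => ?_
      rcases hI.gap i with h | h
      · exact absurd hi.1 h.not_gt
      · exact ht3.trans_le h
    set T : Set ℝ := {s | s ∈ Icc (0 : ℝ) 1 ∧ ¬ PosBox b ev hc hαM (P s)} with hT
    have hT1 : (1 : ℝ) ∈ T := ⟨right_mem_Icc.2 zero_le_one, by rwa [hP1]⟩
    have hTb : BddBelow T := ⟨0, fun s hs => hs.1.1⟩
    have hsI : sInf T ∈ Icc (0 : ℝ) 1 := ⟨le_csInf ⟨1, hT1⟩ fun s hs => hs.1.1, csInf_le hTb hT1⟩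
    have hsn : ¬ PosBox b ev hc hαM (P (sInf T)) := by
      intro hpos
      have hev := hPc.continuousAt.eventually
        (hpos.eventually hF (hbox _ hsI).1 (hbox _ hsI).2)
      obtain ⟨s, hs, hsT⟩ := (mem_closure_iff_frequently.1
        (csInf_mem_closure ⟨1, hT1⟩ hTb)).and_eventually hev |>.exists
      exact hs.2 hsT
    have hs0 : 0 < sInf T := hsI.1.lt_of_ne fun h => hsn (by rwa [← h, hP0])
    have hfr : ∃ᶠ q in 𝓝 (P (sInf T)), PosBox b ev hc hαM q := by
      have hlt : ∃ᶠ s in 𝓝 (sInf T), PosBox b ev hc hαM (P s) := by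
        have h0 : ∀ᶠ s in 𝓝[<] (sInf T), PosBox b ev hc hαM (P s) := by
          filter_upwards [self_mem_nhdsWithin,
            nhdsWithin_le_nhds (eventually_gt_nhds hs0)] with s hs hs'
          by_contra hcon
          exact (notMem_of_lt_csInf hs hTb) ⟨⟨hs'.le, hs.le.trans hsI.2⟩, hcon⟩
        exact h0.frequently.filter_mono nhdsWithin_le_nhds
      exact hPc.continuousAt.frequently hlt
    obtain ⟨f, -, -, -, hne, hs⟩ := exists_isSol_of_boundary hF (hbox _ hsI).1 (hbox _ hsI).2 hsn hfr
    refine hp.2 _ ⟨hsub (hbox _ hsI).1, hsub (hbox _ hsI).2⟩ ?_ ⟨_, hne, hs⟩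
    have := hPmono hsI.2
    rwa [hP1] at this
  · intro hp
    refine ⟨⟨hsub h1, hsub h2⟩, fun p' hp' hle => ?_⟩
    have h1' : p'.1 ∈ Ioo α M := ⟨hI.subset hp'.1, hle.1.trans_lt h1.2⟩
    have h2' : p'.2 ∈ Ioo α M := ⟨hI.subset hp'.2, hle.2.trans_lt h2.2⟩
    exact not_solvable_of_posBox hF h1' h2' (hp.anti h1' h2' h1 h2 hle)

variable (hI : IsSpectralInterval ev I α μ) (hc : IsPosPart pos)
include hI hc

theorem isOpen_solutionFree : IsOpen (solutionFree b ev pos I) := by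
  refine isOpen_iff_mem_nhds.2 fun p hp => ?_
  obtain ⟨M, h1, h2, hsub, hF⟩ := hI.exists_box hp.1
  have hαM := h1.1.trans h1.2
  have hpos := (mem_solutionFree_iff hI hc hαM hsub hF h1 h2).1 hp
  have hin : ∀ᶠ p' : ℝ × ℝ in 𝓝 p, p'.1 ∈ Ioo α M ∧ p'.2 ∈ Ioo α M :=
    (continuous_fst.continuousAt.eventually (isOpen_Ioo.mem_nhds h1)).and
      (continuous_snd.continuousAt.eventually (isOpen_Ioo.mem_nhds h2))
  filter_upwards [hpos.eventually hF h1 h2, hin] with p' hp' hb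
  exact (mem_solutionFree_iff hI hc hαM hsub hF hb.1 hb.2).2 hp'

theorem corner_subset_solutionFree {p : ℝ × ℝ} (h1 : p.1 ∈ Ioo α μ) (h2 : p.2 ∈ Ioo α μ) :
    p ∈ solutionFree b ev pos I := by
  obtain ⟨M, hμ, -, hsub, hF⟩ := hI.exists_box (p := (μ, μ)) ⟨hI.mem, hI.mem⟩
  have hαM := hμ.1.trans hμ.2
  have hm : max p.1 p.2 ∈ Ioo α μ := ⟨lt_max_of_lt_left h1.1, max_lt h1.2 h2.2⟩
  have hmM : max p.1 p.2 ∈ Ioo α M := ⟨hm.1, hm.2.trans hμ.2⟩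
  have hpos : PosBox b ev hc hαM (max p.1 p.2, max p.1 p.2) :=
    posBox_diag hF hmM fun i hi => by
      rcases hI.gap i with h | h
      · exact absurd hi.1 h.not_gt
      · exact hm.2.trans_le h
  exact solutionFree_lower ((mem_solutionFree_iff hI hc hαM hsub hF hmM hmM).2 hpos)
    ⟨hsub ⟨h1.1, h1.2.trans hμ.2⟩, hsub ⟨h2.1, h2.2.trans hμ.2⟩⟩ ⟨le_max_left _ _, le_max_right _ _⟩

omit [CompleteSpace E] in
theorem notMem_solutionFree : (μ, μ) ∉ solutionFree b ev pos I := fun h => by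
  obtain ⟨i, hi⟩ := hI.eigenvalue
  exact h.2 (μ, μ) ⟨hI.mem, hI.mem⟩ le_rfl (hi ▸ solvable_diag hc i)

omit [CompleteSpace E] hc in
theorem eventually_sub_mem {p : ℝ × ℝ} (hp : p ∈ I ×ˢ I) :
    ∀ᶠ ε : ℝ in 𝓝[>] 0, p - (ε, ε) ∈ I ×ˢ I := by
  have hcont : Continuous fun ε : ℝ => p - (ε, ε) := by fun_prop
  refine nhdsWithin_le_nhds (hcont.continuousAt.preimage_mem_nhds
    ((hI.isOpen.prod hI.isOpen).mem_nhds ?_))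
  rwa [sub_zero_diag]

theorem exists_isSol_of_mem_upperBoundary {p : ℝ × ℝ} {M : ℝ} (hαM : α < M) (hsub : Ioo α M ⊆ I)
    (hF : (window ev α M).Finite) (h1 : p.1 ∈ Ioo α M) (h2 : p.2 ∈ Ioo α M)
    (hp : p ∈ upperBoundary I (solutionFree b ev pos I)) :
    ∃ f ∈ Submodule.span ℝ (b '' window ev α M), f ≠ 0 ∧
      (spectralReduction b ev hc hαM).energy (recenter α M p) f = 0 ∧
      (spectralReduction b ev hc hαM).sol (recenter α M p) f ≠ 0 ∧
      IsSol b ev pos p ((spectralReduction b ev hc hαM).sol (recenter α M p) f) := by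
  have hcont : Continuous fun ε : ℝ => p - (ε, ε) := by fun_prop
  have hev : ∀ᶠ ε : ℝ in 𝓝[>] 0, PosBox b ev hc hαM (p - (ε, ε)) := by
    filter_upwards [eventually_sub_mem hI hp.1, self_mem_nhdsWithin] with ε hε hε0
    have hε0 : 0 < ε := hε0
    refine (mem_solutionFree_iff hI hc hαM hsub hF ⟨hI.subset hε.1, ?_⟩
      ⟨hI.subset hε.2, ?_⟩).1 (hp.2.2 ε hε0 hε)
    · simp only [Prod.fst_sub]; linarith [h1.2]
    · simp only [Prod.snd_sub]; linarith [h2.2]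
  refine exists_isSol_of_boundary hF h1 h2
    (fun h => hp.2.1 ((mem_solutionFree_iff hI hc hαM hsub hF h1 h2).2 h)) ?_
  have := (hcont.tendsto 0).mono_left (nhdsWithin_le_nhds (s := Ioi 0))
  rw [sub_zero_diag] at this
  exact this.frequently hev.frequently

theorem solvable_of_mem_upperBoundary {p : ℝ × ℝ}
    (hp : p ∈ upperBoundary I (solutionFree b ev pos I)) : Solvable b ev pos p := by
  obtain ⟨M, h1, h2, hsub, hF⟩ := hI.exists_box hp.1
  obtain ⟨f, -, -, -, hne, hs⟩ :=
    exists_isSol_of_mem_upperBoundary hI hc (h1.1.trans h1.2) hsub hF h1 h2 hp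
  exact ⟨_, hne, hs⟩

/-- If all nontrivial solutions change sign, the boundary curve is strictly decreasing. -/
theorem eq_of_le_of_mem_upperBoundary
    (hsign : ∀ p ∈ I ×ˢ I, ∀ u, u ≠ 0 → IsSol b ev pos p u → pos u ≠ 0 ∧ pos (-u) ≠ 0)
    {p p' : ℝ × ℝ} (hp : p ∈ upperBoundary I (solutionFree b ev pos I))
    (hp' : p' ∈ upperBoundary I (solutionFree b ev pos I)) (hle : p ≤ p') : p = p' := by
  by_contra hne
  obtain ⟨M, h1', h2', hsub, hF⟩ := hI.exists_box hp'.1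
  have hαM := h1'.1.trans h1'.2
  have h1 : p.1 ∈ Ioo α M := ⟨hI.subset hp.1.1, hle.1.trans_lt h1'.2⟩
  have h2 : p.2 ∈ Ioo α M := ⟨hI.subset hp.1.2, hle.2.trans_lt h2'.2⟩
  obtain ⟨f, hf, hf0, hE, hu0, hs⟩ :=
    exists_isSol_of_mem_upperBoundary hI hc hαM hsub hF h1 h2 hp
  obtain ⟨hs1, hs2⟩ := hsign p hp.1 _ hu0 hs
  -- The zero `f` of the energy at `p` makes the energy negative at `p'`, hence also slightly below
  -- `p'`, where it is positive because `p'` lies on the boundary.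
  have hlt := Reduction.energy_lt (norm_recenter_lt_r h1 h2) (norm_recenter_lt_r h1' h2')
    (sub_le_sub_right hle _) (fun h => hne (sub_left_injective h)) hs1 hs2
  rw [hE] at hlt
  have hcont : ContinuousAt (fun ε : ℝ => (spectralReduction b ev hc hαM).energy
      (recenter α M (p' - (ε, ε))) f) 0 := by
    refine ContinuousAt.comp (f := fun ε : ℝ => (p' - (ε, ε), f))
      (g := fun z : (ℝ × ℝ) × E => (spectralReduction b ev hc hαM).energy (recenter α M z.1) z.2)
      ?_ (by fun_prop)
    rw [sub_zero_diag]
    exact continuousAt_energy_recenter h1' h2' f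
  have hev : ∀ᶠ ε : ℝ in 𝓝 0, (spectralReduction b ev hc hαM).energy
      (recenter α M (p' - (ε, ε))) f < 0 := by
    refine hcont.eventually_lt_const ?_
    beta_reduce
    rwa [sub_zero_diag]
  obtain ⟨ε, hε, hεI, hε0⟩ := ((hev.filter_mono nhdsWithin_le_nhds).and
    ((eventually_sub_mem hI hp'.1).and self_mem_nhdsWithin)).exists
  have hε0 : 0 < ε := hε0
  have hbox1 : (p' - (ε, ε)).1 ∈ Ioo α M := ⟨hI.subset hεI.1, by
    simp only [Prod.fst_sub]; linarith [h1'.2]⟩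
  have hbox2 : (p' - (ε, ε)).2 ∈ Ioo α M := ⟨hI.subset hεI.2, by
    simp only [Prod.snd_sub]; linarith [h2'.2]⟩
  have hpos := (mem_solutionFree_iff hI hc hαM hsub hF hbox1 hbox2).1 (hp'.2.2 ε hε0 hεI)
  exact (hpos f hf hf0).not_gt hε

end Region

/-! ### Boundary curves of lower sets in a square -/

theorem card_connectedComponents_eq_two {X : Type*} [TopologicalSpace X] {S T : Set X}
    (hS : IsOpen S) (hT : IsOpen T) (hdis : Disjoint S T) (hun : S ∪ T = univ)
    (hSc : IsPreconnected S) (hTc : IsPreconnected T) (hSn : S.Nonempty) (hTn : T.Nonempty) :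
    Nat.card (ConnectedComponents X) = 2 := by
  obtain ⟨x, hx⟩ := hSn
  obtain ⟨y, hy⟩ := hTn
  have hcompl : Sᶜ = T := (IsCompl.of_le hdis.le_bot hun.ge).compl_eq
  have hclopen : IsClopen S := ⟨⟨by rwa [hcompl]⟩, hS⟩
  rw [Nat.card_eq_two_iff]
  refine ⟨x, y, fun h => ?_, eq_univ_of_forall fun z => ?_⟩
  · have hxy : y ∈ connectedComponent x := ConnectedComponents.coe_eq_coe'.1 h.symm
    exact disjoint_left.1 hdis (hclopen.connectedComponent_subset hx hxy) hy
  · obtain ⟨z, rfl⟩ := ConnectedComponents.surjective_coe z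
    rcases (hun.ge (mem_univ z) : z ∈ S ∪ T) with hz | hz
    · exact Or.inl (ConnectedComponents.coe_eq_coe'.2 (hSc.subset_connectedComponent hx hz))
    · exact Or.inr (ConnectedComponents.coe_eq_coe'.2 (hTc.subset_connectedComponent hy hz))

/-- An open set of reals that contains `0` and is solid is `]-r, r[` or the whole line, and so a
homeomorphic image of the line. -/
theorem exists_parametrization {D : Set ℝ} (hD : IsOpen D) (h0 : (0 : ℝ) ∈ D)
    (hsolid : ∀ d ∈ D, ∀ d', |d'| ≤ |d| → d' ∈ D) :
    ∃ σ : ℝ → ℝ, Continuous σ ∧ Function.Injective σ ∧ range σ = D := by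
  by_cases hb : BddAbove D
  · set r := sSup D with hr
    have hDr : ∀ d, d ∈ D ↔ |d| < r := by
      refine fun d => ⟨fun hd => ?_, fun hd => ?_⟩
      · have habs : |d| ∈ D := hsolid d hd _ (abs_abs d).le
        obtain ⟨ε, hε, hball⟩ := Metric.isOpen_iff.1 hD _ habs
        have hmem : |d| + ε / 2 ∈ D := hball (by
          rw [Metric.mem_ball, Real.dist_eq, add_sub_cancel_left, abs_of_pos (half_pos hε)]
          exact half_lt_self hε)
        have := le_csSup hb hmem
        linarith
      · obtain ⟨d', hd', hlt⟩ := exists_lt_of_lt_csSup ⟨0, h0⟩ hd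
        exact hsolid d' hd' d (hlt.le.trans (le_abs_self _))
    have hr0 : 0 < r := by simpa using (hDr 0).1 h0
    refine ⟨fun x => r * (orderIsoIooNegOneOne ℝ x : ℝ), ?_, ?_, ?_⟩
    · have : Continuous (orderIsoIooNegOneOne ℝ) := (orderIsoIooNegOneOne ℝ).continuous
      fun_prop
    · intro x y hxy
      exact (orderIsoIooNegOneOne ℝ).injective (Subtype.ext (mul_left_cancel₀ hr0.ne' hxy))
    · ext d
      rw [hDr]
      constructor
      · rintro ⟨x, rfl⟩
        have h := (orderIsoIooNegOneOne ℝ x).2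
        rw [abs_mul, abs_of_pos hr0]
        have : |(orderIsoIooNegOneOne ℝ x : ℝ)| < 1 := abs_lt.2 h
        nlinarith
      · intro hd
        have hmem : d / r ∈ Ioo (-1 : ℝ) 1 := by
          rw [mem_Ioo, ← abs_lt, abs_div, abs_of_pos hr0, div_lt_one hr0]; exact hd
        refine ⟨(orderIsoIooNegOneOne ℝ).symm ⟨d / r, hmem⟩, ?_⟩
        simp only [OrderIso.apply_symm_apply]
        field_simp
  · refine ⟨id, continuous_id, Function.injective_id, ?_⟩
    rw [range_id, eq_comm, eq_univ_iff_forall]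
    intro d
    rw [not_bddAbove_iff] at hb
    obtain ⟨d', hd', hlt⟩ := hb |d|
    exact hsolid d' hd' d (hlt.le.trans (le_abs_self _))

/-- An open symmetric lower subset `U` of the square `I ×ˢ I` that contains the points with
coordinates below `μ`, but not `(μ, μ)`. -/
structure IsLowerRegion (I : Set ℝ) (μ : ℝ) (U : Set (ℝ × ℝ)) : Prop where
  isOpen_I : IsOpen I
  ordConnected : I.OrdConnected
  mem : μ ∈ I
  isOpen : IsOpen U
  subset : U ⊆ I ×ˢ I
  lower : ∀ p ∈ U, ∀ p' ∈ I ×ˢ I, p' ≤ p → p' ∈ U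
  swap : ∀ p ∈ U, p.swap ∈ U
  corner : ∀ p ∈ I ×ˢ I, p.1 < μ → p.2 < μ → p ∈ U
  notMem : (μ, μ) ∉ U

/-- The points of the square strictly above some point of the square outside `U`. -/
def aboveRegion (I : Set ℝ) (U : Set (ℝ × ℝ)) : Set (ℝ × ℝ) :=
  {p | p ∈ I ×ˢ I ∧ ∃ ε > 0, p - (ε, ε) ∈ I ×ˢ I ∧ p - (ε, ε) ∉ U}

namespace IsLowerRegion

variable {I : Set ℝ} {μ : ℝ} {U : Set (ℝ × ℝ)} (h : IsLowerRegion I μ U)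
include h

theorem mem_of_between {p q x : ℝ × ℝ} (hp : p ∈ I ×ˢ I) (hq : q ∈ I ×ˢ I) (hpx : p ≤ x)
    (hxq : x ≤ q) : x ∈ I ×ˢ I :=
  ⟨h.ordConnected.out hp.1 hq.1 ⟨hpx.1, hxq.1⟩, h.ordConnected.out hp.2 hq.2 ⟨hpx.2, hxq.2⟩⟩

theorem mem_above_of_lt {p q : ℝ × ℝ} (hp : p ∈ I ×ˢ I) (hpU : p ∉ U) (hq : q ∈ I ×ˢ I)
    (h1 : p.1 < q.1) (h2 : p.2 < q.2) : q ∈ aboveRegion I U := by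
  have hε : 0 < min (q.1 - p.1) (q.2 - p.2) := lt_min (sub_pos.2 h1) (sub_pos.2 h2)
  have e1 := min_le_left (q.1 - p.1) (q.2 - p.2)
  have e2 := min_le_right (q.1 - p.1) (q.2 - p.2)
  set ε := min (q.1 - p.1) (q.2 - p.2)
  have hle : p ≤ q - (ε, ε) :=
    ⟨by simp only [Prod.fst_sub]; linarith, by simp only [Prod.snd_sub]; linarith⟩
  have hle' : q - (ε, ε) ≤ q :=
    ⟨by simp only [Prod.fst_sub]; linarith, by simp only [Prod.snd_sub]; linarith⟩
  exact ⟨hq, ε, hε, h.mem_of_between hp hq hle hle', fun hU => hpU (h.lower _ hU p hp hle)⟩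

theorem above_upper {p q : ℝ × ℝ} (hp : p ∈ aboveRegion I U) (hq : q ∈ I ×ˢ I) (hpq : p ≤ q) :
    q ∈ aboveRegion I U := by
  obtain ⟨-, ε, hε, hI, hU⟩ := hp
  refine h.mem_above_of_lt hI hU hq ?_ ?_
  · simp only [Prod.fst_sub]; linarith [hpq.1]
  · simp only [Prod.snd_sub]; linarith [hpq.2]

theorem isOpen_above : IsOpen (aboveRegion I U) := by
  refine isOpen_iff_mem_nhds.2 fun p hp => ?_
  obtain ⟨hpI, ε, hε, hI, hU⟩ := hp
  have h1 : ∀ᶠ q : ℝ × ℝ in 𝓝 p, (p - (ε, ε)).1 < q.1 :=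
    continuousAt_fst.eventually_const_lt (by simp only [Prod.fst_sub]; linarith)
  have h2 : ∀ᶠ q : ℝ × ℝ in 𝓝 p, (p - (ε, ε)).2 < q.2 :=
    continuousAt_snd.eventually_const_lt (by simp only [Prod.snd_sub]; linarith)
  filter_upwards [(h.isOpen_I.prod h.isOpen_I).mem_nhds hpI, h1, h2] with q hq hq1 hq2
  exact h.mem_above_of_lt hI hU hq hq1 hq2

theorem disjoint_above : Disjoint U (aboveRegion I U) := by
  refine disjoint_left.2 fun p hp hpa => ?_
  obtain ⟨-, ε, hε, hI, hU⟩ := hpa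
  exact hU (h.lower p hp _ hI
    ⟨by simp only [Prod.fst_sub]; linarith, by simp only [Prod.snd_sub]; linarith⟩)

theorem diff_upperBoundary : (I ×ˢ I) \ upperBoundary I U = U ∪ aboveRegion I U := by
  ext p
  constructor
  · rintro ⟨hpI, hpC⟩
    by_cases hU : p ∈ U
    · exact Or.inl hU
    · refine Or.inr ⟨hpI, ?_⟩
      by_contra! hcon
      exact hpC ⟨hpI, hU, hcon⟩
  · rintro (hU | hA)
    · exact ⟨h.subset hU, fun hC => hC.2.1 hU⟩
    · refine ⟨hA.1, fun hC => ?_⟩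
      obtain ⟨-, ε, hε, hI, hU⟩ := hA
      exact hU (hC.2.2 ε hε hI)

/-- Two points of the boundary are never strictly ordered in both coordinates. -/
theorem not_lt_lt {p q : ℝ × ℝ} (hp : p ∈ upperBoundary I U) (hq : q ∈ upperBoundary I U)
    (h1 : p.1 < q.1) : q.2 ≤ p.2 := by
  by_contra! h2
  have hq' : q ∈ (I ×ˢ I) \ upperBoundary I U :=
    h.diff_upperBoundary.ge (Or.inr (h.mem_above_of_lt hp.1 hp.2.1 hq.1 h1 h2))
  exact hq'.2 hq

/-- The boundary is a Lipschitz curve in the parameter `p.2 - p.1`. -/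
theorem dist_le {p q : ℝ × ℝ} (hp : p ∈ upperBoundary I U) (hq : q ∈ upperBoundary I U) :
    dist p q ≤ |(p.2 - p.1) - (q.2 - q.1)| := by
  have a1 := h.not_lt_lt hp hq
  have a2 := h.not_lt_lt hq hp
  rw [Prod.dist_eq, Real.dist_eq, Real.dist_eq]
  rcases lt_trichotomy p.1 q.1 with hlt | heq | hgt
  · have h2 := a1 hlt
    rw [abs_of_neg (sub_neg.2 hlt), abs_of_nonneg (sub_nonneg.2 h2), abs_of_nonneg (by linarith)]
    exact max_le (by linarith) (by linarith)
  · rw [heq, sub_self, abs_zero]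
    refine max_le (abs_nonneg _) (le_of_eq ?_)
    congr 1; ring
  · have h2 := a2 hgt
    rw [abs_of_pos (sub_pos.2 hgt), abs_of_nonpos (sub_nonpos.2 h2), abs_of_nonpos (by linarith)]
    exact max_le (by linarith) (by linarith)

theorem swap_mem_upperBoundary {p : ℝ × ℝ} (hp : p ∈ upperBoundary I U) :
    p.swap ∈ upperBoundary I U :=
  ⟨⟨hp.1.2, hp.1.1⟩, fun hU => hp.2.1 (h.swap _ hU), fun ε hε hI =>
    h.swap _ (hp.2.2 ε hε ⟨hI.2, hI.1⟩)⟩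

theorem diag_mem_upperBoundary : (μ, μ) ∈ upperBoundary I U :=
  ⟨⟨h.mem, h.mem⟩, h.notMem, fun ε hε hI => h.corner _ hI
    (by simp only [Prod.fst_sub]; linarith) (by simp only [Prod.snd_sub]; linarith)⟩

/-- A parallel to the diagonal meets the boundary if and only if it meets both sides. -/
theorem exists_mem_upperBoundary_iff (d : ℝ) :
    (∃ p ∈ upperBoundary I U, p.2 - p.1 = d) ↔
      (∃ p ∈ U, p.2 - p.1 = d) ∧ ∃ p ∈ aboveRegion I U, p.2 - p.1 = d := by
  constructor
  · rintro ⟨p, hp, rfl⟩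
    have hopen := (h.isOpen_I.prod h.isOpen_I).mem_nhds hp.1
    have hc1 : Continuous fun ε : ℝ => p - (ε, ε) := by fun_prop
    have hc2 : Continuous fun ε : ℝ => p + (ε, ε) := by fun_prop
    have e1 : ∀ᶠ ε : ℝ in 𝓝[>] 0, p - (ε, ε) ∈ I ×ˢ I :=
      nhdsWithin_le_nhds (hc1.continuousAt.preimage_mem_nhds (by rwa [sub_zero_diag]))
    have e2 : ∀ᶠ ε : ℝ in 𝓝[>] 0, p + (ε, ε) ∈ I ×ˢ I :=
      nhdsWithin_le_nhds (hc2.continuousAt.preimage_mem_nhds (by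
        rwa [show p + ((0 : ℝ), (0 : ℝ)) = p from add_zero p]))
    obtain ⟨ε, h1, h2, hε⟩ := (e1.and (e2.and self_mem_nhdsWithin)).exists
    have hε : 0 < ε := hε
    refine ⟨⟨_, hp.2.2 ε hε h1, by simp⟩, ⟨p + (ε, ε), ⟨h2, ε, hε, ?_, ?_⟩, by simp⟩⟩
    · rw [add_sub_cancel_right]; exact hp.1
    · rw [add_sub_cancel_right]; exact hp.2.1
  · rintro ⟨⟨p, hp, rfl⟩, q, hq, hqd⟩
    have hpc : IsPreconnected (segment ℝ p q) := (convex_segment p q).isPreconnected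
    have hconv : Convex ℝ (I ×ˢ I) := h.ordConnected.convex.prod h.ordConnected.convex
    have hsub : segment ℝ p q ⊆ I ×ˢ I := hconv.segment_subset (h.subset hp) hq.1
    by_contra hcon
    have hcover : segment ℝ p q ⊆ U ∪ aboveRegion I U := by
      rw [← h.diff_upperBoundary]
      refine fun x hx => ⟨hsub hx, fun hxC => hcon ⟨x, hxC, ?_⟩⟩
      obtain ⟨s, t, -, -, hst, rfl⟩ := hx
      simp only [Prod.fst_add, Prod.snd_add, Prod.smul_fst, Prod.smul_snd, smul_eq_mul]
      linear_combination t * hqd + (p.2 - p.1) * hst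
    obtain ⟨x, -, hxU, hxA⟩ := hpc _ _ h.isOpen h.isOpen_above hcover
      ⟨p, left_mem_segment ℝ p q, hp⟩ ⟨q, right_mem_segment ℝ p q, hq⟩
    exact disjoint_left.1 h.disjoint_above hxU hxA

/-- The set of the parallels to the diagonal that meet the boundary is open and solid. -/
theorem exists_curve : ∃ γ : ℝ → ℝ × ℝ, Continuous γ ∧ Function.Injective γ ∧
    range γ = upperBoundary I U := by
  set D : Set ℝ := {d | ∃ p ∈ upperBoundary I U, p.2 - p.1 = d} with hD
  have hDU : D = (fun p : ℝ × ℝ => p.2 - p.1) '' U ∩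
      (fun p : ℝ × ℝ => p.2 - p.1) '' aboveRegion I U := by
    ext d; exact h.exists_mem_upperBoundary_iff d
  have hopenmap : IsOpenMap fun p : ℝ × ℝ => p.2 - p.1 := by
    refine (ContinuousLinearMap.snd ℝ ℝ ℝ - ContinuousLinearMap.fst ℝ ℝ ℝ).isOpenMap fun y => ⟨(0, y), ?_⟩
    simp
  have hDopen : IsOpen D := by
    rw [hDU]; exact (hopenmap _ h.isOpen).inter (hopenmap _ h.isOpen_above)
  have h0 : (0 : ℝ) ∈ D := ⟨_, h.diag_mem_upperBoundary, sub_self μ⟩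
  have hneg : ∀ d ∈ D, -d ∈ D := by
    rintro _ ⟨p, hp, rfl⟩
    exact ⟨p.swap, h.swap_mem_upperBoundary hp, by simp⟩
  have habs : ∀ d ∈ D, |d| ∈ D := fun d hd => by
    rcases abs_choice d with h | h <;> rw [h]; exacts [hd, hneg d hd]
  have hsolid : ∀ d ∈ D, ∀ d', |d'| ≤ |d| → d' ∈ D := by
    intro d hd d' hd'
    have key : |d'| ∈ D := by
      have hdD := habs d hd
      have hd0 := abs_nonneg d'
      rw [hDU] at hdD ⊢
      obtain ⟨⟨p, hp, hpd⟩, q, hq, hqd⟩ := hdD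
      simp only at hpd hqd
      have hpI := h.subset hp
      have hqI := hq.1
      have m1 : p.1 + |d'| ∈ I := h.ordConnected.out hpI.1 hpI.2 ⟨by linarith, by linarith⟩
      have m2 : q.2 - |d'| ∈ I := h.ordConnected.out hqI.1 hqI.2 ⟨by linarith, by linarith⟩
      -- Lowering one coordinate of `p ∈ U`, or raising one of `q` above, moves to the parallel `|d'|`.
      refine ⟨⟨(p.1, p.1 + |d'|), h.lower p hp _ ⟨hpI.1, m1⟩ ⟨le_rfl, ?_⟩, by simp⟩,
        ⟨(q.2 - |d'|, q.2), h.above_upper hq ⟨m2, hqI.2⟩ ⟨?_, le_rfl⟩, by simp⟩⟩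
      · simp only; linarith
      · simp only; linarith
    rcases abs_choice d' with h | h
    · rwa [h] at key
    · rw [h] at key; simpa using hneg _ key
  obtain ⟨σ, hσc, hσi, hσr⟩ := exists_parametrization hDopen h0 hsolid
  have hex : ∀ x, ∃ p ∈ upperBoundary I U, p.2 - p.1 = σ x := fun x => hσr.le ⟨x, rfl⟩
  choose γ hγC hγd using hex
  have hdist : ∀ x y, dist (γ x) (γ y) ≤ dist (σ x) (σ y) := fun x y => by
    rw [Real.dist_eq, ← hγd x, ← hγd y]
    exact h.dist_le (hγC x) (hγC y)
  refine ⟨γ, ?_, fun x y hxy => hσi (by rw [← hγd, ← hγd, hxy]), ?_⟩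
  · refine continuous_iff_continuousAt.2 fun x => tendsto_iff_dist_tendsto_zero.2 ?_
    exact squeeze_zero (fun _ => dist_nonneg) (fun y => hdist y x)
      (tendsto_iff_dist_tendsto_zero.1 hσc.continuousAt)
  · refine Subset.antisymm (range_subset_iff.2 hγC) fun p hp => ?_
    obtain ⟨x, hx⟩ := hσr.ge ⟨p, hp, rfl⟩
    refine ⟨x, dist_le_zero.1 ((h.dist_le (hγC x) hp).trans ?_)⟩
    rw [hγd, hx, sub_self, abs_zero]

/-- If the boundary is an antichain, it is the graph of a continuous decreasing function. -/
theorem exists_graph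
    (hanti : ∀ p ∈ upperBoundary I U, ∀ q ∈ upperBoundary I U, p ≤ q → p = q) :
    ∃ (J : Set ℝ) (f : ℝ → ℝ), J.OrdConnected ∧ ContinuousOn f J ∧ StrictAntiOn f J ∧
      upperBoundary I U = (fun a => (a, f a)) '' J := by
  obtain ⟨γ, hγc, hγi, hγr⟩ := h.exists_curve
  have hγC : ∀ x, γ x ∈ upperBoundary I U := fun x => hγr.le ⟨x, rfl⟩
  set g : ℝ → ℝ := fun x => (γ x).1 with hg
  have hgc : Continuous g := continuous_fst.comp hγc
  have hgi : Function.Injective g := fun x y hxy => by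
    rcases le_total (γ x).2 (γ y).2 with h2 | h2
    · exact hγi (hanti _ (hγC x) _ (hγC y) ⟨le_of_eq hxy, h2⟩)
    · exact (hγi (hanti _ (hγC y) _ (hγC x) ⟨ge_of_eq hxy, h2⟩)).symm
  have hord : (range g).OrdConnected := (isPreconnected_range hgc).ordConnected
  have hemb : IsEmbedding g := by
    rcases hgc.strictMono_of_inj hgi with hm | hm
    · exact hm.isEmbedding_of_ordConnected hord
    · have hm' : StrictMono fun x => - g x := fun x y hxy => neg_lt_neg (hm hxy)
      have : (range fun x => - g x).OrdConnected :=
        (isPreconnected_range hgc.neg).ordConnected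
      have he := (Homeomorph.neg ℝ).isEmbedding.comp (hm'.isEmbedding_of_ordConnected this)
      simpa [Function.comp_def] using he
  -- The first coordinate of the curve is an embedding, so the curve can be reparametrized by it.
  set f : ℝ → ℝ := fun a => (γ (Function.invFun g a)).2 with hf
  have hfg : ∀ x, f (g x) = (γ x).2 := fun x => by
    simp only [hf, Function.leftInverse_invFun hgi x]
  refine ⟨range g, f, hord, ?_, ?_, ?_⟩
  · rintro _ ⟨x, rfl⟩
    rw [ContinuousWithinAt, ← hemb.map_nhds_eq, tendsto_map'_iff, hfg]
    exact ((continuous_snd.comp hγc).tendsto x).congr fun y => (hfg y).symm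
  · rintro _ ⟨x, rfl⟩ _ ⟨y, rfl⟩ hxy
    rw [hfg, hfg]
    refine lt_of_le_of_ne (h.not_lt_lt (hγC x) (hγC y) hxy) fun heq => ?_
    have := hanti _ (hγC x) _ (hγC y) ⟨hxy.le, heq.ge⟩
    exact hxy.ne (congrArg Prod.fst this)
  · rw [← hγr, ← range_comp]
    congr 1
    ext1 x
    exact Prod.ext rfl (hfg x).symm

theorem exists_lt_mem : ∃ t ∈ I, t < μ := by
  have h1 : ∀ᶠ t in 𝓝[<] μ, t ∈ I := nhdsWithin_le_nhds (h.isOpen_I.mem_nhds h.mem)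
  obtain ⟨t, ht, hlt⟩ := (h1.and self_mem_nhdsWithin).exists
  exact ⟨t, ht, hlt⟩

theorem exists_gt_mem : ∃ t ∈ I, μ < t := by
  have h1 : ∀ᶠ t in 𝓝[>] μ, t ∈ I := nhdsWithin_le_nhds (h.isOpen_I.mem_nhds h.mem)
  obtain ⟨t, ht, hlt⟩ := (h1.and self_mem_nhdsWithin).exists
  exact ⟨t, ht, hlt⟩

/-- Every point of `U` spans, with the corner of the square, a rectangle inside `U`. -/
theorem isPreconnected_region : IsPreconnected U := by
  obtain ⟨t, ht, htμ⟩ := h.exists_lt_mem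
  refine isPreconnected_of_forall (t, t) fun p hp => ?_
  have hpI := h.subset hp
  have hrect : ∀ x y : ℝ, IsPreconnected ((I ∩ Iic x) ×ˢ (I ∩ Iic y)) := fun x y =>
    (h.ordConnected.inter ordConnected_Iic).isPreconnected.prod
      (h.ordConnected.inter ordConnected_Iic).isPreconnected
  refine ⟨(I ∩ Iic t) ×ˢ (I ∩ Iic t) ∪ (I ∩ Iic p.1) ×ˢ (I ∩ Iic p.2), ?_, ?_, ?_, ?_⟩
  · rintro q (⟨hq1, hq2⟩ | ⟨hq1, hq2⟩)
    · exact h.corner q ⟨hq1.1, hq2.1⟩ (hq1.2.trans_lt htμ) (hq2.2.trans_lt htμ)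
    · exact h.lower p hp q ⟨hq1.1, hq2.1⟩ ⟨hq1.2, hq2.2⟩
  · exact Or.inl ⟨⟨ht, self_mem_Iic⟩, ht, self_mem_Iic⟩
  · exact Or.inr ⟨⟨hpI.1, self_mem_Iic⟩, hpI.2, self_mem_Iic⟩
  · have hm : ∀ x ∈ I, min t x ∈ I := fun x hx => by
      rcases min_choice t x with h | h <;> rw [h]; exacts [ht, hx]
    exact IsPreconnected.union (min t p.1, min t p.2)
      ⟨⟨hm _ hpI.1, min_le_left t p.1⟩, hm _ hpI.2, min_le_left t p.2⟩
      ⟨⟨hm _ hpI.1, min_le_right t p.1⟩, hm _ hpI.2, min_le_right t p.2⟩ (hrect t t) (hrect _ _)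

theorem mem_above_of_gt {q : ℝ × ℝ} (hq : q ∈ I ×ˢ I) (h1 : μ < q.1) (h2 : μ < q.2) :
    q ∈ aboveRegion I U :=
  h.mem_above_of_lt (p := (μ, μ)) ⟨h.mem, h.mem⟩ h.notMem hq h1 h2

/-- Every point of the upper region spans, with the opposite corner of the square, a rectangle inside
the upper region. -/
theorem isPreconnected_above : IsPreconnected (aboveRegion I U) := by
  obtain ⟨t, ht, htμ⟩ := h.exists_gt_mem
  refine isPreconnected_of_forall (t, t) fun p hp => ?_
  have hpI := hp.1
  have hrect : ∀ x y : ℝ, IsPreconnected ((I ∩ Ici x) ×ˢ (I ∩ Ici y)) := fun x y =>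
    (h.ordConnected.inter ordConnected_Ici).isPreconnected.prod
      (h.ordConnected.inter ordConnected_Ici).isPreconnected
  refine ⟨(I ∩ Ici t) ×ˢ (I ∩ Ici t) ∪ (I ∩ Ici p.1) ×ˢ (I ∩ Ici p.2), ?_, ?_, ?_, ?_⟩
  · rintro q (⟨hq1, hq2⟩ | ⟨hq1, hq2⟩)
    · exact h.mem_above_of_gt ⟨hq1.1, hq2.1⟩ (htμ.trans_le hq1.2) (htμ.trans_le hq2.2)
    · exact h.above_upper hp ⟨hq1.1, hq2.1⟩ ⟨hq1.2, hq2.2⟩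
  · exact Or.inl ⟨⟨ht, self_mem_Ici⟩, ht, self_mem_Ici⟩
  · exact Or.inr ⟨⟨hpI.1, self_mem_Ici⟩, hpI.2, self_mem_Ici⟩
  · have hm : ∀ x ∈ I, max t x ∈ I := fun x hx => by
      rcases max_choice t x with h | h <;> rw [h]; exacts [ht, hx]
    exact IsPreconnected.union (max t p.1, max t p.2)
      ⟨⟨hm _ hpI.1, le_max_left t p.1⟩, hm _ hpI.2, le_max_left t p.2⟩
      ⟨⟨hm _ hpI.1, le_max_right t p.1⟩, hm _ hpI.2, le_max_right t p.2⟩ (hrect t t) (hrect _ _)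

theorem card_components :
    Nat.card (ConnectedComponents ↥((I ×ˢ I) \ upperBoundary I U)) = 2 := by
  have hdiff := h.diff_upperBoundary
  set X := (I ×ˢ I) \ upperBoundary I U with hX
  have himg : ∀ S : Set (ℝ × ℝ), S ⊆ X → ((↑) '' ((↑) ⁻¹' S : Set X) : Set (ℝ × ℝ)) = S :=
    fun S hS => by rw [Subtype.image_preimage_coe, inter_eq_right.2 hS]
  have hU : U ⊆ X := hdiff ▸ subset_union_left
  have hA : aboveRegion I U ⊆ X := hdiff ▸ subset_union_right
  obtain ⟨t, ht, htμ⟩ := h.exists_lt_mem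
  obtain ⟨s, hs, hsμ⟩ := h.exists_gt_mem
  have htU : (t, t) ∈ U := h.corner _ ⟨ht, ht⟩ htμ htμ
  have hsA : (s, s) ∈ aboveRegion I U := h.mem_above_of_gt ⟨hs, hs⟩ hsμ hsμ
  refine card_connectedComponents_eq_two (S := ((↑) ⁻¹' U : Set X))
    (T := ((↑) ⁻¹' aboveRegion I U : Set X)) (h.isOpen.preimage continuous_subtype_val)
    (h.isOpen_above.preimage continuous_subtype_val) (h.disjoint_above.preimage _) ?_ ?_ ?_
    ⟨(⟨(t, t), hU htU⟩ : X), mem_preimage.2 htU⟩ ⟨(⟨(s, s), hA hsA⟩ : X), mem_preimage.2 hsA⟩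
  · exact eq_univ_of_forall fun x => hdiff.le x.2
  · rw [← IsInducing.subtypeVal.isPreconnected_image, himg U hU]
    exact h.isPreconnected_region
  · rw [← IsInducing.subtypeVal.isPreconnected_image, himg _ hA]
    exact h.isPreconnected_above

theorem connectedComponentIn_subset {q : ℝ × ℝ} (hq : q ∈ U) :
    connectedComponentIn ((I ×ˢ I) \ upperBoundary I U) q ⊆ U := by
  refine isPreconnected_connectedComponentIn.subset_left_of_subset_union h.isOpen h.isOpen_above
    h.disjoint_above ?_ ⟨q, mem_connectedComponentIn ?_, hq⟩
  · rw [← h.diff_upperBoundary]; exact _root_.connectedComponentIn_subset _ _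
  · rw [h.diff_upperBoundary]; exact Or.inl hq

end IsLowerRegion

/-! ### Trigonometric systems in one variable -/

/-- `cos x + sin x`. The functions `t ↦ cas (n t)`, `n ∈ ℤ`, form an orthogonal basis of
`L²(0, 2π)`, with a single formula for cosines and sines. -/
def cas (x : ℝ) : ℝ := Real.cos x + Real.sin x

theorem continuous_cas : Continuous cas := by unfold cas; fun_prop

theorem integral_cos_int_mul (k l : ℤ) (hk : k ≠ 0) :
    ∫ s in (0 : ℝ)..(l * Real.pi), Real.cos (k * s) = 0 := by
  have hk' : (k : ℝ) ≠ 0 := Int.cast_ne_zero.2 hk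
  rw [intervalIntegral.integral_comp_mul_left (fun x => Real.cos x) hk', integral_cos]
  rw [← mul_assoc, ← Int.cast_mul, Real.sin_int_mul_pi]
  simp

theorem integral_sin_int_mul_two_pi (k : ℤ) :
    ∫ t in (0 : ℝ)..(2 * Real.pi), Real.sin (k * t) = 0 := by
  by_cases hk : k = 0
  · simp [hk]
  have hk' : (k : ℝ) ≠ 0 := Int.cast_ne_zero.2 hk
  rw [intervalIntegral.integral_comp_mul_left (fun x => Real.sin x) hk', integral_sin]
  rw [Real.cos_int_mul_two_pi]
  simp

theorem integral_cas_mul_cas (n n' : ℤ) :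
    ∫ t in (0 : ℝ)..(2 * Real.pi), cas (n * t) * cas (n' * t)
      = if n = n' then 2 * Real.pi else 0 := by
  have h : ∀ t : ℝ, cas (n * t) * cas (n' * t)
      = Real.cos ((n - n' : ℤ) * t) + Real.sin ((n + n' : ℤ) * t) := fun t => by
    push_cast
    rw [sub_mul, add_mul, Real.cos_sub, Real.sin_add, cas, cas]
    ring
  simp_rw [h]
  rw [intervalIntegral.integral_add (Continuous.intervalIntegrable (by fun_prop) _ _)
    (Continuous.intervalIntegrable (by fun_prop) _ _), integral_sin_int_mul_two_pi, add_zero]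
  split_ifs with hn
  · simp [hn]
  · exact_mod_cast integral_cos_int_mul (n - n') 2 (sub_ne_zero.2 hn)

theorem integral_sin_mul_sin {m m' : ℕ} (hm : 1 ≤ m) :
    ∫ s in (0 : ℝ)..Real.pi, Real.sin (m * s) * Real.sin (m' * s)
      = if m = m' then Real.pi / 2 else 0 := by
  have h : ∀ s : ℝ, Real.sin (m * s) * Real.sin (m' * s)
      = (Real.cos (((m : ℤ) - m' : ℤ) * s) - Real.cos (((m : ℤ) + m' : ℤ) * s)) / 2 := fun s => by
    push_cast
    rw [sub_mul, add_mul, Real.cos_sub, Real.cos_add]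
    ring
  have h2 := integral_cos_int_mul ((m : ℤ) + m') 1 (by omega)
  rw [Int.cast_one, one_mul] at h2
  simp_rw [h]
  rw [intervalIntegral.integral_div, intervalIntegral.integral_sub
    (Continuous.intervalIntegrable (by fun_prop) _ _)
    (Continuous.intervalIntegrable (by fun_prop) _ _), h2, sub_zero]
  split_ifs with hmm
  · simp [hmm]
  · have h1 := integral_cos_int_mul ((m : ℤ) - m') 1 (by omega)
    rw [Int.cast_one, one_mul] at h1
    rw [h1, zero_div]

theorem integral_cos_mul_cos {m m' : ℕ} (hm : 1 ≤ m) :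
    ∫ s in (0 : ℝ)..Real.pi, Real.cos (m * s) * Real.cos (m' * s)
      = if m = m' then Real.pi / 2 else 0 := by
  have h : ∀ s : ℝ, Real.cos (m * s) * Real.cos (m' * s)
      = (Real.cos (((m : ℤ) - m' : ℤ) * s) + Real.cos (((m : ℤ) + m' : ℤ) * s)) / 2 := fun s => by
    push_cast
    rw [sub_mul, add_mul, Real.cos_sub, Real.cos_add]
    ring
  have h2 := integral_cos_int_mul ((m : ℤ) + m') 1 (by omega)
  rw [Int.cast_one, one_mul] at h2
  simp_rw [h]
  rw [intervalIntegral.integral_div, intervalIntegral.integral_add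
    (Continuous.intervalIntegrable (by fun_prop) _ _)
    (Continuous.intervalIntegrable (by fun_prop) _ _), h2, add_zero]
  split_ifs with hmm
  · simp [hmm]
  · have h1 := integral_cos_int_mul ((m : ℤ) - m') 1 (by omega)
    rw [Int.cast_one, one_mul] at h1
    rw [h1, zero_div]

/-- Completeness of the system `cas (n t)`, from Parseval's identity for Fourier series. -/
theorem ae_eq_zero_of_integral_cas {f : ℝ → ℝ}
    (hf : MemLp f 2 (volume.restrict (Ioc 0 (2 * Real.pi))))
    (h : ∀ n : ℤ, ∫ t in Ioc 0 (2 * Real.pi), f t * cas (n * t) = 0) :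
    f =ᵐ[volume.restrict (Ioc 0 (2 * Real.pi))] 0 := by
  have hpi : (0 : ℝ) < 2 * Real.pi := by positivity
  set F : ℝ → ℂ := fun t => (f t : ℂ) with hF
  have hFL : MemLp F 2 (volume.restrict (Ioc 0 (2 * Real.pi))) := hf.ofReal
  have hfint : Integrable f (volume.restrict (Ioc 0 (2 * Real.pi))) := hf.integrable (by norm_num)
  have hint : ∀ g : ℝ → ℝ, Continuous g →
      IntegrableOn (fun t => f t * g t) (Ioc 0 (2 * Real.pi)) := fun g hg => by
    have hb : IntegrableOn (fun t => g t * f t) (Icc 0 (2 * Real.pi)) :=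
      IntegrableOn.continuousOn_mul hg.continuousOn
        ((integrableOn_Icc_iff_integrableOn_Ioc (by simp)).2 hfint) isCompact_Icc
    simpa only [mul_comm] using hb.mono_set Ioc_subset_Icc_self
  have hcas : ∀ n : ℤ, Continuous fun t : ℝ => cas (n * t) := fun n =>
    continuous_cas.comp (by fun_prop)
  have hcos : ∀ n : ℤ, ∫ t in Ioc 0 (2 * Real.pi), f t * Real.cos (n * t) = 0 := fun n => by
    have h1 := h n
    have h2 := h (-n)
    have e : ∀ t : ℝ, f t * Real.cos (n * t)
        = (f t * cas (n * t) + f t * cas ((-n : ℤ) * t)) / 2 := fun t => by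
      push_cast; rw [cas, cas, neg_mul, Real.cos_neg, Real.sin_neg]; ring
    simp_rw [e]
    rw [integral_div, integral_add (hint (fun t => cas (n * t)) (hcas n))
      (hint (fun t => cas ((-n : ℤ) * t)) (hcas _)), h1, h2]
    simp
  have hsin : ∀ n : ℤ, ∫ t in Ioc 0 (2 * Real.pi), f t * Real.sin (n * t) = 0 := fun n => by
    have h1 := h n
    have h2 := hcos n
    have e : ∀ t : ℝ, f t * Real.sin (n * t)
        = f t * cas (n * t) - f t * Real.cos (n * t) := fun t => by rw [cas]; ring
    simp_rw [e]
    rw [integral_sub (hint (fun t => cas (n * t)) (hcas n)) (hint _ (by fun_prop)), h1, h2,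
      sub_zero]
  have hcoef : ∀ n : ℤ, fourierCoeffOn hpi F n = 0 := fun n => by
    rw [fourierCoeffOn_eq_integral, intervalIntegral.integral_of_le hpi.le]
    have e : ∀ t : ℝ, (fourier (-n)) (t : AddCircle (2 * Real.pi - 0)) • F t
        = ((f t * Real.cos (n * t) : ℝ) : ℂ) - Complex.I * ((f t * Real.sin (n * t) : ℝ) : ℂ) := by
      intro t
      have hp : (Real.pi : ℂ) ≠ 0 := Complex.ofReal_ne_zero.2 Real.pi_ne_zero
      rw [fourier_coe_apply, smul_eq_mul, hF]
      have : 2 * (Real.pi : ℂ) * Complex.I * ((-n : ℤ) : ℂ) * (t : ℂ) / ((2 * Real.pi - 0 : ℝ) : ℂ)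
          = ((-(n * t) : ℝ) : ℂ) * Complex.I := by
        push_cast; field_simp; ring
      rw [this, Complex.exp_mul_I, ← Complex.ofReal_cos, ← Complex.ofReal_sin, Real.cos_neg,
        Real.sin_neg]
      push_cast
      ring
    simp_rw [e]
    rw [integral_sub ((hint _ (by fun_prop)).ofReal)
      (((hint _ (by fun_prop)).ofReal).const_mul _), integral_const_mul]
    rw [integral_complex_ofReal, integral_complex_ofReal, hcos, hsin]
    simp
  have hpars := hasSum_sq_fourierCoeffOn hpi hFL
  simp only [hcoef, norm_zero, ne_eq, OfNat.ofNat_ne_zero, not_false_eq_true, zero_pow] at hpars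
  have h0 := hpars.unique hasSum_zero
  rw [smul_eq_mul, mul_eq_zero, intervalIntegral.integral_of_le hpi.le] at h0
  have h1 := h0.resolve_left (by simp [Real.pi_ne_zero])
  rw [integral_eq_zero_iff_of_nonneg (fun _ => by positivity)] at h1
  · filter_upwards [h1] with t ht
    simpa [hF] using ht
  · simpa [hF] using hf.integrable_sq

/-- Completeness of the sine system on `]0, π[`: the extension to `]0, 2π[` that is odd about `π` has
vanishing coefficients. -/
theorem ae_eq_zero_of_integral_sin {f : ℝ → ℝ}
    (hf : MemLp f 2 (volume.restrict (Ioo 0 Real.pi)))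
    (h : ∀ m : ℕ, 1 ≤ m → ∫ s in Ioo 0 Real.pi, f s * Real.sin (m * s) = 0) :
    f =ᵐ[volume.restrict (Ioo 0 Real.pi)] 0 := by
  have hpi := Real.pi_pos
  set f₀ : ℝ → ℝ := (Ioo 0 Real.pi).indicator f with hf₀
  have hf₀L : MemLp f₀ 2 volume := (memLp_indicator_iff_restrict measurableSet_Ioo).2 hf
  have hrefl : MemLp (fun x => f₀ (2 * Real.pi - x)) 2 volume :=
    hf₀L.comp_measurePreserving (Measure.measurePreserving_sub_left volume (2 * Real.pi))
  have hf₀i : Integrable f₀ := by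
    rw [hf₀, integrable_indicator_iff measurableSet_Ioo]
    exact hf.integrable (by norm_num)
  have hint : ∀ g : ℝ → ℝ, Continuous g → (∃ C, ∀ x, ‖g x‖ ≤ C) →
      Integrable fun x => f₀ x * g x := fun g hg ⟨C, hC⟩ =>
    hf₀i.mul_bdd hg.aestronglyMeasurable (.of_forall hC)
  have hbdd : ∀ (c x : ℝ), ‖cas (c * x)‖ ≤ 2 := fun c x => by
    rw [Real.norm_eq_abs, cas]
    have := abs_add_le (Real.cos (c * x)) (Real.sin (c * x))
    linarith [Real.abs_cos_le_one (c * x), Real.abs_sin_le_one (c * x)]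
  have hcont : ∀ c : ℝ, Continuous fun x : ℝ => cas (c * x) := fun c =>
    continuous_cas.comp (by fun_prop)
  have hsin : ∀ n : ℤ, ∫ x, f₀ x * Real.sin (n * x) = 0 := by
    have hnat : ∀ m : ℕ, ∫ x, f₀ x * Real.sin (m * x) = 0 := fun m => by
      rcases Nat.eq_zero_or_pos m with rfl | hm
      · simp
      · rw [← h m hm, ← integral_indicator measurableSet_Ioo]
        congr 1
        ext x
        rw [hf₀, indicator_mul_left]
    intro n
    rcases Int.eq_nat_or_neg n with ⟨m, rfl | rfl⟩
    · exact_mod_cast hnat m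
    · push_cast
      simp only [neg_mul, Real.sin_neg, mul_neg, integral_neg, hnat m, neg_zero]
  -- Only the sine part of `cas` survives against a function that is odd about `π`.
  have key := ae_eq_zero_of_integral_cas (f := fun x => f₀ x - f₀ (2 * Real.pi - x))
    ((hf₀L.sub hrefl).restrict _) fun n => by
      have hper : ∀ x : ℝ, cas (n * (2 * Real.pi - x)) = cas ((-n : ℤ) * x) := fun x => by
        rw [cas, cas, show (n : ℝ) * (2 * Real.pi - x) = ((-n : ℤ) : ℝ) * x + n * (2 * Real.pi) by
          push_cast; ring, Real.cos_add_int_mul_two_pi, Real.sin_add_int_mul_two_pi]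
      have hint2 : Integrable fun x => f₀ (2 * Real.pi - x) * cas (n * x) := by
        have := (hint (fun x => cas ((-n : ℤ) * x)) (hcont _) ⟨2, hbdd _⟩).comp_sub_left
          (2 * Real.pi)
        refine this.congr (.of_forall fun x => ?_)
        simp only [← hper, sub_sub_cancel]
      rw [setIntegral_eq_integral_of_forall_compl_eq_zero]
      · simp_rw [sub_mul]
        rw [integral_sub (hint (fun x => cas (n * x)) (hcont _) ⟨2, hbdd _⟩) hint2]
        rw [← integral_sub_left_eq_self (fun x => f₀ (2 * Real.pi - x) * cas (n * x)) volume
          (2 * Real.pi)]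
        simp only [sub_sub_cancel, hper]
        rw [← integral_sub (hint (fun x => cas (n * x)) (hcont _) ⟨2, hbdd _⟩)
          (hint (fun x => cas ((-n : ℤ) * x)) (hcont _) ⟨2, hbdd _⟩)]
        have e : ∀ x, f₀ x * cas (n * x) - f₀ x * cas ((-n : ℤ) * x)
            = 2 * (f₀ x * Real.sin (n * x)) := fun x => by
          push_cast; rw [cas, cas, neg_mul, Real.cos_neg, Real.sin_neg]; ring
        simp_rw [e]
        rw [integral_const_mul, hsin, mul_zero]
      · intro x hx
        have h1 : x ∉ Ioo 0 Real.pi := fun h => hx ⟨h.1, by linarith [h.2]⟩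
        have h2 : 2 * Real.pi - x ∉ Ioo 0 Real.pi := fun h =>
          hx ⟨by linarith [h.2], by linarith [h.1]⟩
        rw [hf₀, indicator_of_notMem h1, indicator_of_notMem h2, sub_zero, zero_mul]
  have hsub : Ioo 0 Real.pi ⊆ Ioc 0 (2 * Real.pi) := fun x hx => ⟨hx.1, by linarith [hx.2]⟩
  filter_upwards [ae_restrict_of_ae_restrict_of_subset hsub key,
    ae_restrict_mem measurableSet_Ioo] with x hx hxm
  have h2 : 2 * Real.pi - x ∉ Ioo 0 Real.pi := fun h => by linarith [h.2, hxm.2]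
  simp only [hf₀, indicator_of_mem hxm, indicator_of_notMem h2, sub_zero] at hx
  exact hx

/-! ### The basis of eigenfunctions -/

theorem cyl_eq_prod : cyl = (volume.restrict (Icc 0 Real.pi)).prod
    (volume.restrict (Icc 0 (2 * Real.pi))) := by
  rw [cyl, Measure.prod_restrict, Measure.volume_eq_prod]

theorem integral_cyl_mul (g h : ℝ → ℝ) :
    ∫ p, g p.1 * h p.2 ∂cyl
      = (∫ s in (0 : ℝ)..Real.pi, g s) * ∫ t in (0 : ℝ)..(2 * Real.pi), h t := by
  rw [cyl_eq_prod, integral_prod_mul, intervalIntegral.integral_of_le Real.pi_pos.le,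
    intervalIntegral.integral_of_le (by positivity), integral_Icc_eq_integral_Ioc,
    integral_Icc_eq_integral_Ioc]

/-- The class in `L²` of a continuous function. -/
def ofCont (f : ℝ × ℝ → ℝ) (hf : Continuous f) : H := (memLp_of_continuous hf).toLp f

theorem coeFn_ofCont {f : ℝ × ℝ → ℝ} (hf : Continuous f) : ofCont f hf =ᵐ[cyl] f :=
  MemLp.coeFn_toLp _

theorem inner_ofCont {f : ℝ × ℝ → ℝ} (hf : Continuous f) (u : H) :
    ⟪ofCont f hf, u⟫_ℝ = ∫ p, u p * f p ∂cyl := by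
  rw [L2.inner_def]
  refine integral_congr_ae ?_
  filter_upwards [coeFn_ofCont hf] with p hp
  rw [hp]
  simp

theorem inner_ofCont_ofCont {f g : ℝ × ℝ → ℝ} (hf : Continuous f) (hg : Continuous g) :
    ⟪ofCont f hf, ofCont g hg⟫_ℝ = ∫ p, f p * g p ∂cyl := by
  rw [inner_ofCont]
  refine integral_congr_ae ?_
  filter_upwards [coeFn_ofCont hg] with p hp
  rw [hp, mul_comm]

theorem ofCont_eq_of_ae {f : ℝ × ℝ → ℝ} (hf : Continuous f) {v : H} (h : v =ᵐ[cyl] f) :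
    v = ofCont f hf :=
  Lp.ext (h.trans (coeFn_ofCont hf).symm)

/-- The normalized eigenfunction `π⁻¹ sin (m s) (cos (n t) + sin (n t))` of the wave operator, with
eigenvalue `m² - n²`. -/
def sinMode (m : ℕ) (n : ℤ) (p : ℝ × ℝ) : ℝ := Real.pi⁻¹ * Real.sin (m * p.1) * cas (n * p.2)

/-- The companion `π⁻¹ cos (m s) (cos (n t) + sin (n t))` of `sinMode`, which is proportional to its
derivative in `s`. -/
def cosMode (m : ℕ) (n : ℤ) (p : ℝ × ℝ) : ℝ := Real.pi⁻¹ * Real.cos (m * p.1) * cas (n * p.2)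

theorem contDiff_cas : ContDiff ℝ ∞ cas := Real.contDiff_cos.add Real.contDiff_sin

theorem contDiff_sinMode (m : ℕ) (n : ℤ) : ContDiff ℝ ∞ (sinMode m n) := by
  have h1 : ContDiff ℝ ∞ fun p : ℝ × ℝ => Real.sin (m * p.1) :=
    Real.contDiff_sin.comp (contDiff_const.mul contDiff_fst)
  have h2 : ContDiff ℝ ∞ fun p : ℝ × ℝ => cas (n * p.2) :=
    contDiff_cas.comp (contDiff_const.mul contDiff_snd)
  exact (contDiff_const.mul h1).mul h2

theorem contDiff_cosMode (m : ℕ) (n : ℤ) : ContDiff ℝ ∞ (cosMode m n) := by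
  have h1 : ContDiff ℝ ∞ fun p : ℝ × ℝ => Real.cos (m * p.1) :=
    Real.contDiff_cos.comp (contDiff_const.mul contDiff_fst)
  have h2 : ContDiff ℝ ∞ fun p : ℝ × ℝ => cas (n * p.2) :=
    contDiff_cas.comp (contDiff_const.mul contDiff_snd)
  exact (contDiff_const.mul h1).mul h2

theorem cas_periodic (n : ℤ) (t : ℝ) : cas (n * (t + 2 * Real.pi)) = cas (n * t) := by
  rw [mul_add, cas, cas, Real.cos_add_int_mul_two_pi, Real.sin_add_int_mul_two_pi]

theorem isSmooth_sinMode (m : ℕ) (n : ℤ) : IsSmoothOnCyl (sinMode m n) :=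
  ⟨contDiff_sinMode m n, fun s t => by simp only [sinMode, cas_periodic]⟩

theorem isSmooth_cosMode (m : ℕ) (n : ℤ) : IsSmoothOnCyl (cosMode m n) :=
  ⟨contDiff_cosMode m n, fun s t => by simp only [cosMode, cas_periodic]⟩

theorem integral_sinMode_mul_sinMode {m m' : ℕ} (hm : 1 ≤ m) (n n' : ℤ) :
    ∫ p, sinMode m n p * sinMode m' n' p ∂cyl = if m = m' ∧ n = n' then 1 else 0 := by
  have h : ∀ p : ℝ × ℝ, sinMode m n p * sinMode m' n' p
      = (Real.pi⁻¹ ^ 2 * (Real.sin (m * p.1) * Real.sin (m' * p.1)))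
        * (cas (n * p.2) * cas (n' * p.2)) := fun p => by simp only [sinMode]; ring
  simp_rw [h]
  rw [integral_cyl_mul (fun s => Real.pi⁻¹ ^ 2 * (Real.sin (m * s) * Real.sin (m' * s)))
    (fun t => cas (n * t) * cas (n' * t)), intervalIntegral.integral_const_mul,
    integral_sin_mul_sin hm, integral_cas_mul_cas]
  by_cases h1 : m = m' <;> by_cases h2 : n = n' <;> simp [h1, h2]
  field_simp

theorem integral_cosMode_mul_cosMode {m m' : ℕ} (hm : 1 ≤ m) (n n' : ℤ) :
    ∫ p, cosMode m n p * cosMode m' n' p ∂cyl = if m = m' ∧ n = n' then 1 else 0 := by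
  have h : ∀ p : ℝ × ℝ, cosMode m n p * cosMode m' n' p
      = (Real.pi⁻¹ ^ 2 * (Real.cos (m * p.1) * Real.cos (m' * p.1)))
        * (cas (n * p.2) * cas (n' * p.2)) := fun p => by simp only [cosMode]; ring
  simp_rw [h]
  rw [integral_cyl_mul (fun s => Real.pi⁻¹ ^ 2 * (Real.cos (m * s) * Real.cos (m' * s)))
    (fun t => cas (n * t) * cas (n' * t)), intervalIntegral.integral_const_mul,
    integral_cos_mul_cos hm, integral_cas_mul_cas]
  by_cases h1 : m = m' <;> by_cases h2 : n = n' <;> simp [h1, h2]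
  field_simp

/-- `sinMode m n` as an element of `L²`. -/
def sinL (m : ℕ) (n : ℤ) : H := ofCont (sinMode m n) (contDiff_sinMode m n).continuous

/-- `cosMode m n` as an element of `L²`. -/
def cosL (m : ℕ) (n : ℤ) : H := ofCont (cosMode m n) (contDiff_cosMode m n).continuous

theorem orthonormal_sinL : Orthonormal ℝ fun i : ℕ × ℤ => sinL (i.1 + 1) i.2 := by
  rw [orthonormal_iff_ite]
  intro i j
  rw [sinL, sinL, inner_ofCont_ofCont, integral_sinMode_mul_sinMode (Nat.le_add_left 1 _)]
  simp [Prod.ext_iff]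

theorem orthonormal_cosL : Orthonormal ℝ fun i : ℕ × ℤ => cosL (i.1 + 1) i.2 := by
  rw [orthonormal_iff_ite]
  intro i j
  rw [cosL, cosL, inner_ofCont_ofCont, integral_cosMode_mul_cosMode (Nat.le_add_left 1 _)]
  simp [Prod.ext_iff]

/-- The Cauchy–Schwarz inequality, squared. -/
theorem sq_integral_mul_le {X : Type*} [MeasurableSpace X] {ν : Measure X} {f g : X → ℝ}
    (hf : MemLp f 2 ν) (hg : MemLp g 2 ν) :
    (∫ x, f x * g x ∂ν) ^ 2 ≤ (∫ x, f x ^ 2 ∂ν) * ∫ x, g x ^ 2 ∂ν := by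
  have key : ∀ {f g : X → ℝ} (hf : MemLp f 2 ν) (hg : MemLp g 2 ν),
      ⟪hf.toLp f, hg.toLp g⟫_ℝ = ∫ x, f x * g x ∂ν := fun hf hg => by
    rw [L2.inner_def]
    refine integral_congr_ae ?_
    filter_upwards [hf.coeFn_toLp, hg.coeFn_toLp] with x h1 h2
    rw [h1, h2]
    simp [mul_comm]
  have h := real_inner_mul_inner_self_le (hf.toLp f) (hg.toLp g)
  rw [key, key, key] at h
  simpa only [sq] using h

/-- Completeness of the eigenfunctions: by Fubini and completeness in each of the two variables. -/
theorem ae_eq_zero_of_integral_sinMode {u : ℝ × ℝ → ℝ} (hum : StronglyMeasurable u)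
    (hu : MemLp u 2 cyl) (h : ∀ (m : ℕ) (n : ℤ), 1 ≤ m → ∫ p, u p * sinMode m n p ∂cyl = 0) :
    ∀ᵐ p ∂cyl, u p = 0 := by
  set ν₁ : Measure ℝ := volume.restrict (Icc 0 Real.pi) with hν₁
  set ν₂ : Measure ℝ := volume.restrict (Icc 0 (2 * Real.pi)) with hν₂
  have hcyl : cyl = ν₁.prod ν₂ := cyl_eq_prod
  have hν₁' : ν₁ = volume.restrict (Ioo 0 Real.pi) := (Measure.restrict_congr_set Ioo_ae_eq_Icc).symm
  have hν₂' : ν₂ = volume.restrict (Ioc 0 (2 * Real.pi)) := (Measure.restrict_congr_set Ioc_ae_eq_Icc).symm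
  have hfin : IsFiniteMeasure ν₂ := by
    rw [hν₂]; exact isFiniteMeasure_restrict.2 isCompact_Icc.measure_lt_top.ne
  rw [hcyl] at hu h ⊢
  have hsq : Integrable (fun p => u p ^ 2) (ν₁.prod ν₂) := hu.integrable_sq
  have hslice : ∀ᵐ s ∂ν₁, MemLp (fun t => u (s, t)) 2 ν₂ := by
    filter_upwards [hu.1.prodMk_left, hsq.prod_right_ae] with s h1 h2
    exact (memLp_two_iff_integrable_sq h1).2 h2
  have hcasL : ∀ n : ℤ, MemLp (fun t : ℝ => cas (n * t)) 2 ν₂ := fun n => by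
    refine MemLp.of_bound (continuous_cas.comp (by fun_prop)).aestronglyMeasurable 2
      (.of_forall fun t => ?_)
    rw [Real.norm_eq_abs, cas]
    have := abs_add_le (Real.cos (n * t)) (Real.sin (n * t))
    linarith [Real.abs_cos_le_one (n * t), Real.abs_sin_le_one (n * t)]
  have hcoef : ∀ n : ℤ, ∀ᵐ s ∂ν₁, ∫ t, u (s, t) * cas (n * t) ∂ν₂ = 0 := fun n => by
    have hmeas : AEStronglyMeasurable (fun s => ∫ t, u (s, t) * cas (n * t) ∂ν₂) ν₁ := by
      refine AEStronglyMeasurable.integral_prod_right' (f := fun p : ℝ × ℝ => u p * cas (n * p.2)) ?_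
      exact hu.1.mul (continuous_cas.comp (by fun_prop)).aestronglyMeasurable
    have hL : MemLp (fun s => ∫ t, u (s, t) * cas (n * t) ∂ν₂) 2 ν₁ := by
      rw [memLp_two_iff_integrable_sq hmeas]
      refine (hsq.integral_prod_left.mul_const (∫ t, cas (n * t) ^ 2 ∂ν₂)).mono'
        (hmeas.pow 2) ?_
      filter_upwards [hslice] with s hs
      rw [Real.norm_of_nonneg (sq_nonneg _)]
      exact sq_integral_mul_le hs (hcasL n)
    have h0 := ae_eq_zero_of_integral_sin (f := fun s => ∫ t, u (s, t) * cas (n * t) ∂ν₂)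
      (hν₁' ▸ hL) fun m hm => by
        have h1 := h m n hm
        have hm2 : MemLp (sinMode m n) 2 (ν₁.prod ν₂) :=
          hcyl ▸ memLp_of_continuous (contDiff_sinMode m n).continuous
        rw [integral_prod (fun p => u p * sinMode m n p) (hu.integrable_mul hm2)] at h1
        have h2 : ∀ s t : ℝ, u (s, t) * sinMode m n (s, t)
            = (Real.pi⁻¹ * Real.sin (m * s)) * (u (s, t) * cas (n * t)) := fun s t => by
          simp only [sinMode]; ring
        simp_rw [h2, integral_const_mul] at h1
        have h3 : ∀ s : ℝ, (Real.pi⁻¹ * Real.sin (m * s)) * ∫ t, u (s, t) * cas (n * t) ∂ν₂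
            = Real.pi⁻¹ * ((∫ t, u (s, t) * cas (n * t) ∂ν₂) * Real.sin (m * s)) := fun s => by ring
        simp_rw [h3] at h1
        rw [integral_const_mul, mul_eq_zero] at h1
        rw [← hν₁']
        exact h1.resolve_left (inv_ne_zero Real.pi_ne_zero)
    rw [← hν₁'] at h0
    exact h0
  have hzero : ∀ᵐ s ∂ν₁, ∀ᵐ t ∂ν₂, u (s, t) = 0 := by
    filter_upwards [hslice, ae_all_iff.2 hcoef] with s hs hc
    rw [hν₂'] at hs hc ⊢
    exact ae_eq_zero_of_integral_cas hs hc
  rw [Measure.ae_prod_iff_ae_ae]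
  · exact hzero
  · exact hum.measurable (measurableSet_singleton 0)

theorem eq_zero_of_inner_sinL (u : H) (h : ∀ (m : ℕ) (n : ℤ), 1 ≤ m → ⟪sinL m n, u⟫_ℝ = 0) :
    u = 0 :=
  Lp.eq_zero_iff_ae_eq_zero.2 <| ae_eq_zero_of_integral_sinMode (Lp.stronglyMeasurable u)
    (Lp.memLp u) fun m n hm => by rw [← inner_ofCont]; exact h m n hm

/-- The Hilbert basis of eigenfunctions of the wave operator, indexed by `(m - 1, n)`. -/
def modeBasis : HilbertBasis (ℕ × ℤ) ℝ H :=
  HilbertBasis.mkOfOrthogonalEqBot orthonormal_sinL <| by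
    rw [Submodule.eq_bot_iff]
    intro u hu
    refine eq_zero_of_inner_sinL u fun m n hm => ?_
    refine (Submodule.mem_orthogonal _ _).1 hu _ (Submodule.subset_span ⟨(m - 1, n), ?_⟩)
    simp only [Nat.sub_add_cancel hm]

theorem modeBasis_apply (i : ℕ × ℤ) : modeBasis i = sinL (i.1 + 1) i.2 := by
  rw [modeBasis, HilbertBasis.coe_mkOfOrthogonalEqBot]

/-- The eigenvalue `m² - n²` of the mode with index `(m - 1, n)`. -/
def modeEv (i : ℕ × ℤ) : ℝ := ((i.1 : ℝ) + 1) ^ 2 - (i.2 : ℝ) ^ 2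

/-! ### Integration by parts on the cylinder -/

theorem hasFDerivAt_mul_sep {g h : ℝ → ℝ} {g' h' : ℝ} {p : ℝ × ℝ} (hg : HasDerivAt g g' p.1)
    (hh : HasDerivAt h h' p.2) :
    HasFDerivAt (fun q : ℝ × ℝ => g q.1 * h q.2)
      (g p.1 • h' • ContinuousLinearMap.snd ℝ ℝ ℝ + h p.2 • g' • ContinuousLinearMap.fst ℝ ℝ ℝ) p :=
  (hg.comp_hasFDerivAt p hasFDerivAt_fst).mul (hh.comp_hasFDerivAt p hasFDerivAt_snd)

theorem hasDerivAt_cas_mul (n : ℤ) (t : ℝ) :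
    HasDerivAt (fun t : ℝ => cas (n * t)) (n * cas ((-n : ℤ) * t)) t := by
  have h1 : HasDerivAt (fun t : ℝ => (n : ℝ) * t) n t := by
    simpa using (hasDerivAt_id t).const_mul (n : ℝ)
  refine (h1.cos.add h1.sin).congr_deriv ?_
  push_cast
  rw [cas, neg_mul (n : ℝ) t, Real.cos_neg (n * t), Real.sin_neg (n * t)]
  ring

theorem hasFDerivAt_sinMode (m : ℕ) (n : ℤ) (p : ℝ × ℝ) :
    HasFDerivAt (sinMode m n) ((n * sinMode m (-n) p) • ContinuousLinearMap.snd ℝ ℝ ℝ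
      + (m * cosMode m n p) • ContinuousLinearMap.fst ℝ ℝ ℝ) p := by
  have h1 : HasDerivAt (fun s : ℝ => (m : ℝ) * s) m p.1 := by
    simpa using (hasDerivAt_id p.1).const_mul (m : ℝ)
  refine (hasFDerivAt_mul_sep (h1.sin.const_mul Real.pi⁻¹) (hasDerivAt_cas_mul n p.2)).congr_fderiv ?_
  rw [smul_smul, smul_smul]
  congr 2
  · simp only [sinMode]; push_cast; ring
  · simp only [cosMode]; ring

theorem hasFDerivAt_cosMode (m : ℕ) (n : ℤ) (p : ℝ × ℝ) :
    HasFDerivAt (cosMode m n) ((n * cosMode m (-n) p) • ContinuousLinearMap.snd ℝ ℝ ℝ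
      + (-m * sinMode m n p) • ContinuousLinearMap.fst ℝ ℝ ℝ) p := by
  have h1 : HasDerivAt (fun s : ℝ => (m : ℝ) * s) m p.1 := by
    simpa using (hasDerivAt_id p.1).const_mul (m : ℝ)
  refine (hasFDerivAt_mul_sep (h1.cos.const_mul Real.pi⁻¹) (hasDerivAt_cas_mul n p.2)).congr_fderiv ?_
  rw [smul_smul, smul_smul]
  congr 2
  · simp only [cosMode]; push_cast; ring
  · simp only [sinMode]; ring

theorem fderiv_sinMode_s (m : ℕ) (n : ℤ) (p : ℝ × ℝ) :
    fderiv ℝ (sinMode m n) p (1, 0) = m * cosMode m n p := by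
  rw [(hasFDerivAt_sinMode m n p).fderiv]; simp

theorem fderiv_sinMode_t (m : ℕ) (n : ℤ) (p : ℝ × ℝ) :
    fderiv ℝ (sinMode m n) p (0, 1) = n * sinMode m (-n) p := by
  rw [(hasFDerivAt_sinMode m n p).fderiv]; simp

theorem fderiv_cosMode_s (m : ℕ) (n : ℤ) (p : ℝ × ℝ) :
    fderiv ℝ (cosMode m n) p (1, 0) = -m * sinMode m n p := by
  rw [(hasFDerivAt_cosMode m n p).fderiv]; simp

theorem fderiv_cosMode_t (m : ℕ) (n : ℤ) (p : ℝ × ℝ) :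
    fderiv ℝ (cosMode m n) p (0, 1) = n * cosMode m (-n) p := by
  rw [(hasFDerivAt_cosMode m n p).fderiv]; simp

theorem integrable_cyl_of_continuous {f : ℝ × ℝ → ℝ} (hf : Continuous f) : Integrable f cyl :=
  (memLp_of_continuous hf).integrable (by norm_num)

theorem integral_fderiv_t {W : ℝ × ℝ → ℝ} (hW : IsSmoothOnCyl W) :
    ∫ p, fderiv ℝ W p (0, 1) ∂cyl = 0 := by
  have hint := integrable_cyl_of_continuous (hW.continuous_fderiv (0, 1))
  rw [cyl_eq_prod] at hint ⊢
  rw [integral_prod _ hint]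
  have h : ∀ s : ℝ, ∫ t in Icc 0 (2 * Real.pi), fderiv ℝ W (s, t) (0, 1) = 0 := fun s => by
    rw [integral_Icc_eq_integral_Ioc, ← intervalIntegral.integral_of_le (by positivity)]
    have hd : ∀ t : ℝ, HasDerivAt (fun t => W (s, t)) (fderiv ℝ W (s, t) (0, 1)) t := fun t =>
      ((hW.1.differentiable (by simp)) (s, t)).hasFDerivAt.comp_hasDerivAt t
        ((hasDerivAt_const t s).prodMk (hasDerivAt_id t))
    rw [intervalIntegral.integral_eq_sub_of_hasDerivAt (fun t _ => hd t)]
    · have := hW.2 s 0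
      rw [zero_add] at this
      rw [this, sub_self]
    · exact ((hW.continuous_fderiv (0, 1)).comp (by fun_prop)).intervalIntegrable _ _
  simp [h]

theorem integral_fderiv_s {W : ℝ × ℝ → ℝ} (hW : IsSmoothOnCyl W) (h0 : ∀ t, W (0, t) = 0)
    (hπ : ∀ t, W (Real.pi, t) = 0) : ∫ p, fderiv ℝ W p (1, 0) ∂cyl = 0 := by
  have hint := integrable_cyl_of_continuous (hW.continuous_fderiv (1, 0))
  rw [cyl_eq_prod] at hint ⊢
  rw [integral_prod_symm _ hint]
  have h : ∀ t : ℝ, ∫ s in Icc 0 Real.pi, fderiv ℝ W (s, t) (1, 0) = 0 := fun t => by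
    rw [integral_Icc_eq_integral_Ioc, ← intervalIntegral.integral_of_le Real.pi_pos.le]
    have hd : ∀ s : ℝ, HasDerivAt (fun s => W (s, t)) (fderiv ℝ W (s, t) (1, 0)) s := fun s =>
      ((hW.1.differentiable (by simp)) (s, t)).hasFDerivAt.comp_hasDerivAt s
        ((hasDerivAt_id s).prodMk (hasDerivAt_const s t))
    rw [intervalIntegral.integral_eq_sub_of_hasDerivAt (fun s _ => hd s)]
    · rw [h0, hπ, sub_self]
    · exact ((hW.continuous_fderiv (1, 0)).comp (by fun_prop)).intervalIntegrable _ _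
  simp [h]

theorem IsSmoothOnCyl.mul {f g : ℝ × ℝ → ℝ} (hf : IsSmoothOnCyl f) (hg : IsSmoothOnCyl g) :
    IsSmoothOnCyl fun p => f p * g p :=
  ⟨hf.1.mul hg.1, fun s t => by simp only [hf.2, hg.2]⟩

theorem fderiv_mul_apply {f g : ℝ × ℝ → ℝ} (hf : IsSmoothOnCyl f) (hg : IsSmoothOnCyl g)
    (p e : ℝ × ℝ) : fderiv ℝ (fun p => f p * g p) p e
      = f p * fderiv ℝ g p e + fderiv ℝ f p e * g p := by
  rw [fderiv_fun_mul (hf.1.differentiable (by simp) p) (hg.1.differentiable (by simp) p)]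
  simp [mul_comm]

theorem byParts_ofCont {e : ℝ × ℝ} {U η : ℝ × ℝ → ℝ} (hU : IsSmoothOnCyl U) (hη : IsSmoothOnCyl η)
    (h : ∫ p, fderiv ℝ (fun p => U p * η p) p e ∂cyl = 0) :
    ByParts e (ofCont U hU.1.continuous) (ofCont _ (hU.continuous_fderiv e)) η := by
  unfold ByParts
  rw [← inner_ofCont (hη.continuous_fderiv e), ← inner_ofCont hη.1.continuous, inner_ofCont_ofCont,
    inner_ofCont_ofCont]
  simp_rw [fderiv_mul_apply hU hη] at h
  rw [integral_add
    (integrable_cyl_of_continuous (hU.1.continuous.fun_mul (hη.continuous_fderiv e)))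
    (integrable_cyl_of_continuous ((hU.continuous_fderiv e).fun_mul hη.1.continuous))] at h
  simp_rw [mul_comm (fderiv ℝ η _ e), mul_comm (η _)]
  linarith

theorem ofCont_eq_smul {f g : ℝ × ℝ → ℝ} (hf : Continuous f) (hg : Continuous g) {c : ℝ}
    (h : ∀ p, f p = c * g p) : ofCont f hf = c • ofCont g hg := by
  obtain rfl : f = fun p => c * g p := funext h
  rfl

theorem sinMode_zero (m : ℕ) (n : ℤ) (t : ℝ) : sinMode m n (0, t) = 0 := by simp [sinMode]

theorem sinMode_pi (m : ℕ) (n : ℤ) (t : ℝ) : sinMode m n (Real.pi, t) = 0 := by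
  simp [sinMode, Real.sin_nat_mul_pi]

theorem hasZeroTrace_sinL (m : ℕ) (n : ℤ) : HasZeroTrace (sinL m n) ((m : ℝ) • cosL m n) :=
  fun η hη => by
    have h := byParts_ofCont (isSmooth_sinMode m n) hη (e := (1, 0))
      (integral_fderiv_s ((isSmooth_sinMode m n).mul hη) (fun t => by rw [sinMode_zero, zero_mul])
        fun t => by rw [sinMode_pi, zero_mul])
    rwa [ofCont_eq_smul _ (contDiff_cosMode m n).continuous (fderiv_sinMode_s m n)] at h

theorem byParts_sinL_t (m : ℕ) (n : ℤ) {η : ℝ × ℝ → ℝ} (hη : IsSmoothOnCyl η) :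
    ByParts (0, 1) (sinL m n) ((n : ℝ) • sinL m (-n)) η := by
  have h := byParts_ofCont (isSmooth_sinMode m n) hη (e := (0, 1))
    (integral_fderiv_t ((isSmooth_sinMode m n).mul hη))
  rwa [ofCont_eq_smul _ (contDiff_sinMode m (-n)).continuous (fderiv_sinMode_t m n)] at h

theorem byParts_cosL_t (m : ℕ) (n : ℤ) {η : ℝ × ℝ → ℝ} (hη : IsSmoothOnCyl η) :
    ByParts (0, 1) (cosL m n) ((n : ℝ) • cosL m (-n)) η := by
  have h := byParts_ofCont (isSmooth_cosMode m n) hη (e := (0, 1))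
    (integral_fderiv_t ((isSmooth_cosMode m n).mul hη))
  rwa [ofCont_eq_smul _ (contDiff_cosMode m (-n)).continuous (fderiv_cosMode_t m n)] at h

theorem isWeakDeriv_cosL_s (m : ℕ) (n : ℤ) :
    IsWeakDeriv (1, 0) (cosL m n) ((-m : ℝ) • sinL m n) := fun η hη hsupp => by
  have hvan : ∀ s t : ℝ, s ∉ Ioo 0 Real.pi → η (s, t) = 0 := fun s t hs =>
    image_eq_zero_of_notMem_tsupport fun hmem => hs (hsupp hmem).1
  have h := byParts_ofCont (isSmooth_cosMode m n) hη (e := (1, 0))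
    (integral_fderiv_s ((isSmooth_cosMode m n).mul hη)
      (fun t => by rw [hvan 0 t (by simp), mul_zero])
      fun t => by rw [hvan Real.pi t (by simp), mul_zero])
  rwa [ofCont_eq_smul _ (contDiff_sinMode m n).continuous (fderiv_cosMode_s m n)] at h

/-! ### Cutoff functions -/

/-- A smooth step that vanishes on `]-∞, 1]` and equals `1` on `[2, ∞[`. -/
def step (x : ℝ) : ℝ := Real.smoothTransition (x - 1)

theorem contDiff_step : ContDiff ℝ ∞ step :=
  Real.smoothTransition.contDiff.comp (contDiff_id.sub contDiff_const)

theorem step_of_le {x : ℝ} (hx : x ≤ 1) : step x = 0 :=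
  Real.smoothTransition.zero_of_nonpos (by linarith)

theorem step_of_ge {x : ℝ} (hx : 2 ≤ x) : step x = 1 :=
  Real.smoothTransition.one_of_one_le (by linarith)

theorem abs_step_le (x : ℝ) : |step x| ≤ 1 := by
  rw [step, abs_of_nonneg (Real.smoothTransition.nonneg _)]
  exact Real.smoothTransition.le_one _

theorem deriv_step_of_gt {x : ℝ} (hx : 2 < x) : deriv step x = 0 := by
  have : step =ᶠ[𝓝 x] fun _ => 1 := by
    filter_upwards [eventually_gt_nhds hx] with y hy using step_of_ge hy.le
  rw [this.deriv_eq, deriv_const]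

theorem exists_bound_mul_deriv_step : ∃ B, ∀ x, 0 ≤ x → |x * deriv step x| ≤ B := by
  have hc : Continuous fun x => x * deriv step x :=
    continuous_id.mul (contDiff_step.continuous_deriv (by simp))
  obtain ⟨B, hB⟩ := (isCompact_Icc (a := (0 : ℝ)) (b := 2)).exists_bound_of_continuousOn
    hc.continuousOn
  refine ⟨max B 0, fun x hx => ?_⟩
  rcases le_or_gt x 2 with h | h
  · exact (hB x ⟨hx, h⟩).trans (le_max_left _ _)
  · rw [deriv_step_of_gt h, mul_zero, abs_zero]; exact le_max_right _ _

/-- Cutoff functions that depend on `s` only, have support in `]0, π[ × 𝕋`, and converge to `1`. -/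
def cutoff (j : ℕ) (p : ℝ × ℝ) : ℝ := step ((j + 1) * (p.1 * (Real.pi - p.1)))

theorem isSmooth_cutoff (j : ℕ) : IsSmoothOnCyl (cutoff j) := by
  refine ⟨contDiff_step.comp ?_, fun s t => rfl⟩
  exact contDiff_const.mul (contDiff_fst.mul (contDiff_const.sub contDiff_fst))

theorem tsupport_cutoff_mul_subset (j : ℕ) (η : ℝ × ℝ → ℝ) :
    tsupport (fun p => cutoff j p * η p) ⊆ Ioo 0 Real.pi ×ˢ univ := by
  have hcl : IsClosed {p : ℝ × ℝ | 1 ≤ ((j : ℝ) + 1) * (p.1 * (Real.pi - p.1))} :=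
    isClosed_le continuous_const (by fun_prop)
  refine (closure_minimal (fun p hp => ?_) hcl).trans fun p hp => ⟨?_, mem_univ _⟩
  · by_contra hcon
    apply hp
    simp only [mem_ofPred_eq, not_le] at hcon
    simp only [cutoff, step_of_le hcon.le, zero_mul]
  · have h1 : 0 < p.1 * (Real.pi - p.1) := by
      by_contra! hcon
      have : ((j : ℝ) + 1) * (p.1 * (Real.pi - p.1)) ≤ 0 :=
        mul_nonpos_of_nonneg_of_nonpos (by positivity) hcon
      have hp' : 1 ≤ ((j : ℝ) + 1) * (p.1 * (Real.pi - p.1)) := hp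
      linarith
    have hpi := Real.pi_pos
    rcases pos_and_pos_or_neg_and_neg_of_mul_pos h1 with h | h
    · exact ⟨h.1, by linarith [h.2]⟩
    · linarith [h.1, h.2]

theorem fderiv_cutoff (j : ℕ) (p e : ℝ × ℝ) : fderiv ℝ (cutoff j) p e
    = deriv step ((j + 1) * (p.1 * (Real.pi - p.1))) * ((j + 1) * (Real.pi - 2 * p.1)) * e.1 := by
  have h1 : HasDerivAt (fun s : ℝ => ((j : ℝ) + 1) * (s * (Real.pi - s)))
      (((j : ℝ) + 1) * (Real.pi - 2 * p.1)) p.1 := by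
    refine (((hasDerivAt_id p.1).mul ((hasDerivAt_id p.1).const_sub Real.pi)).const_mul
      ((j : ℝ) + 1)).congr_deriv ?_
    simp only [id]; ring
  have h2 : HasDerivAt step (deriv step (((j : ℝ) + 1) * (p.1 * (Real.pi - p.1))))
      (((j : ℝ) + 1) * (p.1 * (Real.pi - p.1))) :=
    ((contDiff_step.differentiable (by simp)) _).hasDerivAt
  have h3 := (h2.comp p.1 h1).comp_hasFDerivAt p (hasFDerivAt_fst (𝕜 := ℝ) (E := ℝ) (F := ℝ))
  rw [show cutoff j = (step ∘ fun s : ℝ => ((j : ℝ) + 1) * (s * (Real.pi - s))) ∘ Prod.fst from rfl,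
    h3.fderiv]
  simp

theorem ae_cyl_interior : ∀ᵐ p ∂cyl, p.1 ∈ Ioo 0 Real.pi := by
  rw [cyl_eq_prod]
  have h : ∀ᵐ s ∂volume.restrict (Icc 0 Real.pi), s ∈ Ioo 0 Real.pi := by
    rw [← Measure.restrict_congr_set (Ioo_ae_eq_Icc (μ := volume) (a := 0) (b := Real.pi))]
    exact ae_restrict_mem measurableSet_Ioo
  exact Measure.quasiMeasurePreserving_fst.ae h

theorem tendsto_arg_atTop {p : ℝ × ℝ} (hp : p.1 ∈ Ioo 0 Real.pi) :
    Tendsto (fun j : ℕ => ((j : ℝ) + 1) * (p.1 * (Real.pi - p.1))) atTop atTop :=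
  (tendsto_atTop_add_const_right _ 1 tendsto_natCast_atTop_atTop).atTop_mul_const
    (mul_pos hp.1 (sub_pos.2 hp.2))

/-- Cutting off does not change an integral in the limit. -/
theorem tendsto_integral_cutoff (u : H) {f : ℝ × ℝ → ℝ} (hf : Continuous f) :
    Tendsto (fun j => ∫ p, u p * (cutoff j p * f p) ∂cyl) atTop (𝓝 (∫ p, u p * f p ∂cyl)) := by
  refine tendsto_integral_of_dominated_convergence (fun p => |u p * f p|)
    (fun j => (integrable_mul u ((isSmooth_cutoff j).1.continuous.mul hf)).1)
    (integrable_mul u hf).abs (fun j => .of_forall fun p => ?_) ?_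
  · rw [Real.norm_eq_abs, mul_left_comm, abs_mul]
    exact mul_le_of_le_one_left (abs_nonneg _) (abs_step_le _)
  · filter_upwards [ae_cyl_interior] with p hp
    refine tendsto_const_nhds.congr' ?_
    filter_upwards [(tendsto_arg_atTop hp).eventually_ge_atTop 2] with j hj
    rw [cutoff, step_of_ge hj, one_mul]

/-- In the direction of `t` all smooth functions are admissible test functions. -/
theorem IsWeakDeriv.byParts_t {u g : H} (h : IsWeakDeriv (0, 1) u g) {η : ℝ × ℝ → ℝ}
    (hη : IsSmoothOnCyl η) : ByParts (0, 1) u g η := by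
  have hj : ∀ j, ∫ p, u p * (cutoff j p * fderiv ℝ η p (0, 1)) ∂cyl
      = -∫ p, g p * (cutoff j p * η p) ∂cyl := fun j => by
    have hb := h _ ((isSmooth_cutoff j).mul hη) (tsupport_cutoff_mul_subset j η)
    unfold ByParts at hb
    rw [← hb]
    congr 1
    ext p
    rw [fderiv_mul_apply (isSmooth_cutoff j) hη, fderiv_cutoff]
    simp
  have l1 := tendsto_integral_cutoff u (hη.continuous_fderiv (0, 1))
  have l2 := (tendsto_integral_cutoff g hη.1.continuous).neg
  simp_rw [hj] at l1
  exact tendsto_nhds_unique l1 l2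

/-- The sine is bounded by `m` times the distance to the boundary of `]0, π[`, hence by a multiple of
`s (π - s)`. -/
theorem abs_sin_nat_mul_le (m : ℕ) {s : ℝ} (hs : s ∈ Ioo 0 Real.pi) :
    |Real.sin (m * s)| ≤ m * (2 / Real.pi) * (s * (Real.pi - s)) := by
  have hpi := Real.pi_pos
  have hm : (0 : ℝ) ≤ m := Nat.cast_nonneg m
  have h1 : |Real.sin (m * s)| ≤ m * s := by
    refine Real.abs_sin_le_abs.trans (le_of_eq (abs_of_nonneg (mul_nonneg hm hs.1.le)))
  have h2 : |Real.sin (m * s)| ≤ m * (Real.pi - s) := by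
    have e : Real.sin (m * s) = -((-1) ^ m * Real.sin (m * (Real.pi - s))) := by
      rw [show (m : ℝ) * s = m * Real.pi - m * (Real.pi - s) by ring, Real.sin_nat_mul_pi_sub]
    rw [e, abs_neg, abs_mul, abs_pow, abs_neg, abs_one, one_pow, one_mul]
    exact Real.abs_sin_le_abs.trans (le_of_eq (abs_of_nonneg
      (mul_nonneg hm (by linarith [hs.2]))))
  rcases le_total s (Real.pi / 2) with h | h
  · refine h1.trans ?_
    rw [mul_assoc]
    refine mul_le_mul_of_nonneg_left ?_ hm
    rw [div_mul_eq_mul_div, le_div_iff₀ hpi]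
    nlinarith [hs.1]
  · refine h2.trans ?_
    rw [mul_assoc]
    refine mul_le_mul_of_nonneg_left ?_ hm
    rw [div_mul_eq_mul_div, le_div_iff₀ hpi]
    nlinarith [hs.2]

/-- The modes `sinMode`, which vanish on the boundary, are admissible test functions for the
derivative in `s` although their support is not compact. The derivative of the cutoff is large only
where the mode is small. -/
theorem IsWeakDeriv.byParts_sinMode {u g : H} (h : IsWeakDeriv (1, 0) u g) (m : ℕ) (n : ℤ) :
    ByParts (1, 0) u g (sinMode m n) := by
  have hη := isSmooth_sinMode m n
  obtain ⟨B, hB⟩ := exists_bound_mul_deriv_step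
  have hpi := Real.pi_pos
  have hcontE : ∀ j, Continuous fun p => fderiv ℝ (cutoff j) p (1, 0) * sinMode m n p := fun j =>
    ((isSmooth_cutoff j).continuous_fderiv (1, 0)).mul hη.1.continuous
  have hj : ∀ j, ∫ p, u p * (cutoff j p * fderiv ℝ (sinMode m n) p (1, 0)) ∂cyl
      + ∫ p, u p * (fderiv ℝ (cutoff j) p (1, 0) * sinMode m n p) ∂cyl
      = -∫ p, g p * (cutoff j p * sinMode m n p) ∂cyl := fun j => by
    have hb := h _ ((isSmooth_cutoff j).mul hη) (tsupport_cutoff_mul_subset j _)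
    unfold ByParts at hb
    rw [← hb, ← integral_add (integrable_mul u ((isSmooth_cutoff j).1.continuous.fun_mul
      (hη.continuous_fderiv (1, 0)))) (integrable_mul u (hcontE j))]
    congr 1
    ext p
    rw [fderiv_mul_apply (isSmooth_cutoff j) hη]
    ring
  have l1 := tendsto_integral_cutoff u (hη.continuous_fderiv (1, 0))
  have l2 := (tendsto_integral_cutoff g hη.1.continuous).neg
  have l3 : Tendsto (fun j => ∫ p, u p * (fderiv ℝ (cutoff j) p (1, 0) * sinMode m n p) ∂cyl) atTop
      (𝓝 0) := by
    have hu : Integrable (fun p => u p) cyl := (Lp.memLp u).integrable (by norm_num)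
    have := tendsto_integral_of_dominated_convergence (μ := cyl) (f := fun _ => (0 : ℝ))
      (F := fun j p => u p * (fderiv ℝ (cutoff j) p (1, 0) * sinMode m n p))
      (fun p => |u p| * (B * (Real.pi * (Real.pi⁻¹ * (m * (2 / Real.pi)) * 2))))
      (fun j => (integrable_mul u (hcontE j)).1) (hu.abs.mul_const _) (fun j => ?_) ?_
    · simpa using this
    · filter_upwards [ae_cyl_interior] with p hp
      rw [Real.norm_eq_abs, abs_mul]
      refine mul_le_mul_of_nonneg_left ?_ (abs_nonneg _)
      set y := p.1 * (Real.pi - p.1) with hy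
      have hy0 : 0 < y := mul_pos hp.1 (sub_pos.2 hp.2)
      have hx0 : 0 ≤ ((j : ℝ) + 1) * y := by positivity
      have b1 := hB _ hx0
      have b2 : |Real.pi - 2 * p.1| ≤ Real.pi := by
        rw [abs_le]; constructor <;> linarith [hp.1, hp.2]
      have b3 : |cas (n * p.2)| ≤ 2 := by
        rw [cas]
        have := abs_add_le (Real.cos (n * p.2)) (Real.sin (n * p.2))
        linarith [Real.abs_cos_le_one (n * p.2), Real.abs_sin_le_one (n * p.2)]
      have b4 : |sinMode m n p| ≤ Real.pi⁻¹ * (m * (2 / Real.pi) * y) * 2 := by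
        rw [sinMode, abs_mul, abs_mul, abs_of_pos (inv_pos.2 hpi)]
        have := abs_sin_nat_mul_le m hp
        gcongr
      rw [fderiv_cutoff, mul_one, abs_mul, abs_mul, abs_mul, abs_of_nonneg
        (by positivity : (0 : ℝ) ≤ (j : ℝ) + 1)]
      -- The factor `y` of the mode compensates the growth `j + 1` of the derivative of the cutoff.
      calc |deriv step ((j + 1) * y)| * (((j : ℝ) + 1) * |Real.pi - 2 * p.1|) * |sinMode m n p|
          ≤ |deriv step ((j + 1) * y)| * (((j : ℝ) + 1) * Real.pi)
              * (Real.pi⁻¹ * (m * (2 / Real.pi) * y) * 2) := by gcongr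
        _ = |((j : ℝ) + 1) * y * deriv step ((j + 1) * y)|
              * (Real.pi * (Real.pi⁻¹ * (m * (2 / Real.pi)) * 2)) := by
            rw [abs_mul, abs_of_nonneg hx0]; ring
        _ ≤ _ := by gcongr
    · filter_upwards [ae_cyl_interior] with p hp
      refine tendsto_const_nhds.congr' ?_
      filter_upwards [(tendsto_arg_atTop hp).eventually_gt_atTop 2] with j hj
      rw [fderiv_cutoff, deriv_step_of_gt hj]
      simp
  have l4 := l1.add l3
  simp_rw [hj, add_zero] at l4
  exact tendsto_nhds_unique l4 l2

/-! ### Coefficients of weak derivatives -/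

theorem ByParts.inner_eq {e : ℝ × ℝ} {u g : H} {η : ℝ × ℝ → ℝ} (hη : IsSmoothOnCyl η)
    (h : ByParts e u g η) :
    ⟪ofCont _ (hη.continuous_fderiv e), u⟫_ℝ = -⟪ofCont η hη.1.continuous, g⟫_ℝ := by
  rw [inner_ofCont, inner_ofCont]; exact h

/-- The cosine modes are test functions that see the boundary, so that this needs the zero trace. -/
theorem HasZeroTrace.inner_cosL {u g : H} (h : HasZeroTrace u g) (m : ℕ) (n : ℤ) :
    ⟪cosL m n, g⟫_ℝ = m * ⟪sinL m n, u⟫_ℝ := by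
  have h1 := (h _ (isSmooth_cosMode m n)).inner_eq (isSmooth_cosMode m n)
  rw [ofCont_eq_smul _ (contDiff_sinMode m n).continuous (fderiv_cosMode_s m n),
    real_inner_smul_left] at h1
  change _ * ⟪sinL m n, u⟫_ℝ = -⟪cosL m n, g⟫_ℝ at h1
  linarith

theorem IsWeakDeriv.inner_sinL_s {u g : H} (h : IsWeakDeriv (1, 0) u g) (m : ℕ) (n : ℤ) :
    ⟪sinL m n, g⟫_ℝ = -(m * ⟪cosL m n, u⟫_ℝ) := by
  have h1 := (h.byParts_sinMode m n).inner_eq (isSmooth_sinMode m n)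
  rw [ofCont_eq_smul _ (contDiff_cosMode m n).continuous (fderiv_sinMode_s m n),
    real_inner_smul_left] at h1
  change _ * ⟪cosL m n, u⟫_ℝ = -⟪sinL m n, g⟫_ℝ at h1
  linarith

theorem IsWeakDeriv.inner_sinL_t {u g : H} (h : IsWeakDeriv (0, 1) u g) (m : ℕ) (n : ℤ) :
    ⟪sinL m (-n), g⟫_ℝ = n * ⟪sinL m n, u⟫_ℝ := by
  have h1 := (h.byParts_t (isSmooth_sinMode m (-n))).inner_eq (isSmooth_sinMode m (-n))
  rw [ofCont_eq_smul _ (contDiff_sinMode m (- -n)).continuous (fderiv_sinMode_t m (-n)),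
    real_inner_smul_left] at h1
  change _ * ⟪sinL m (- -n), u⟫_ℝ = -⟪sinL m (-n), g⟫_ℝ at h1
  rw [neg_neg] at h1
  push_cast at h1
  linarith

/-! ### The eigenvalues of the wave operator -/

/-- An eigenfunction has a nonzero coefficient, and comparing this coefficient on both sides of the
eigenvalue equation gives the eigenvalue. -/
theorem exists_modeEv_of_isWaveEigenvalue {c : ℝ} (h : IsWaveEigenvalue c) :
    ∃ i, modeEv i = c := by
  obtain ⟨u, u_s, u_t, u_ss, u_st, u_tt, hs, ht, hss, -, -, htt, htr, hu, heq⟩ := h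
  obtain ⟨i, hi⟩ : ∃ i, ⟪modeBasis i, u⟫_ℝ ≠ 0 := by
    by_contra! hcon
    exact hu (hilbertBasis_ext modeBasis fun i => by rw [hcon i, inner_zero_right])
  refine ⟨i, mul_right_cancel₀ hi ?_⟩
  rw [modeBasis_apply]
  have h1 : ⟪sinL (i.1 + 1) i.2, u_tt - u_ss⟫_ℝ = ⟪sinL (i.1 + 1) i.2, c • u⟫_ℝ := by rw [heq]
  have h2 := htt.inner_sinL_t (i.1 + 1) (-i.2)
  rw [neg_neg, ht.inner_sinL_t] at h2
  rw [inner_sub_right, inner_smul_right, h2, hss.inner_sinL_s, htr.inner_cosL] at h1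
  rw [← h1, modeEv]
  push_cast
  ring

theorem IsWeakDeriv.of_hasZeroTrace {u g : H} (h : HasZeroTrace u g) : IsWeakDeriv (1, 0) u g :=
  fun η hη _ => h η hη

theorem isWaveEigenvalue_modeEv (i : ℕ × ℤ) : IsWaveEigenvalue (modeEv i) := by
  obtain ⟨k, n⟩ := i
  set m := k + 1 with hm
  have hne : sinL m n ≠ 0 := by
    have h1 : ‖sinL m n‖ = 1 := orthonormal_sinL.1 (k, n)
    exact norm_ne_zero_iff.1 (by rw [h1]; exact one_ne_zero)
  refine ⟨sinL m n, (m : ℝ) • cosL m n, (n : ℝ) • sinL m (-n), (m : ℝ) • (-m : ℝ) • sinL m n,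
    (m : ℝ) • (n : ℝ) • cosL m (-n), (n : ℝ) • ((-n : ℤ) : ℝ) • sinL m (- -n),
    .of_hasZeroTrace (hasZeroTrace_sinL m n), fun η hη _ => byParts_sinL_t m n hη,
    fun η hη hs => (isWeakDeriv_cosL_s m n η hη hs).smul _,
    fun η hη _ => (byParts_cosL_t m n hη).smul _, fun η hη _ => ?_,
    fun η hη _ => (byParts_sinL_t m (-n) hη).smul _, hasZeroTrace_sinL m n, hne, ?_⟩
  · rw [smul_comm]
    exact (hasZeroTrace_sinL m (-n) η hη).smul _
  · rw [neg_neg, smul_smul, smul_smul, ← sub_smul, modeEv, hm]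
    congr 1
    push_cast
    ring

/-- Since `m² - n² = (m - n) (m + n)` with nonzero integer factors, `m` and `|n|` are at most
`|m² - n²|`. -/
theorem sq_le_modeEv_sq {i : ℕ × ℤ} (h : modeEv i ≠ 0) :
    ((i.1 + 1 : ℕ) : ℝ) ^ 2 ≤ modeEv i ^ 2 ∧ (i.2 : ℝ) ^ 2 ≤ modeEv i ^ 2 := by
  obtain ⟨k, n⟩ := i
  set m : ℤ := (k : ℤ) + 1 with hm
  have hev : modeEv (k, n) = (((m - n) * (m + n) : ℤ) : ℝ) := by
    rw [modeEv, hm]; push_cast; ring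
  rw [hev] at h ⊢
  have h0 : (m - n) * (m + n) ≠ 0 := by exact_mod_cast h
  have hp : 1 ≤ |m - n| := Int.one_le_abs (left_ne_zero_of_mul h0)
  have hq : 1 ≤ |m + n| := Int.one_le_abs (right_ne_zero_of_mul h0)
  have hpq : |m - n| + |m + n| ≤ 2 * |(m - n) * (m + n)| := by
    rw [abs_mul]; nlinarith
  have h1 : |2 * m| ≤ |m - n| + |m + n| := by
    rw [show 2 * m = (m - n) + (m + n) by ring]; exact abs_add_le _ _
  have h2 : |2 * n| ≤ |m - n| + |m + n| := by
    rw [show 2 * n = (m + n) - (m - n) by ring]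
    exact (abs_sub (m + n) (m - n)).trans_eq (add_comm _ _)
  rw [abs_mul, abs_two] at h1 h2
  constructor
  · have : m ^ 2 ≤ ((m - n) * (m + n)) ^ 2 := sq_le_sq.2 (by linarith)
    have e : ((k + 1 : ℕ) : ℝ) = (m : ℝ) := by rw [hm]; push_cast; rfl
    rw [e]
    exact_mod_cast this
  · have : n ^ 2 ≤ ((m - n) * (m + n)) ^ 2 := sq_le_sq.2 (by linarith)
    exact_mod_cast this

theorem finite_modeEv {C : ℝ} : {i : ℕ × ℤ | modeEv i ≠ 0 ∧ |modeEv i| ≤ C}.Finite := by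
  -- The index `i.1` stands for `m - 1`, so `m ≤ L` is more than enough.
  obtain ⟨L, hL⟩ := exists_nat_gt C
  refine ((Set.finite_Iic L).prod (Set.finite_Icc (-(L : ℤ)) L)).subset ?_
  rintro i ⟨h0, hC⟩
  obtain ⟨h1, h2⟩ := sq_le_modeEv_sq h0
  have hCL : |modeEv i| ≤ L := hC.trans hL.le
  have h3 : ((i.1 + 1 : ℕ) : ℝ) ≤ L := by
    have := (sq_le_sq.1 h1).trans hCL
    rwa [abs_of_nonneg (Nat.cast_nonneg _)] at this
  have h4 : |(i.2 : ℝ)| ≤ L := (sq_le_sq.1 h2).trans hCL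
  rw [abs_le] at h4
  refine ⟨?_, ?_, ?_⟩
  · have : i.1 + 1 ≤ L := by exact_mod_cast h3
    exact (Nat.le_succ _).trans this
  · exact_mod_cast h4.1
  · exact_mod_cast h4.2

theorem modeEv_eq_zero_iff (i : ℕ × ℤ) : modeEv i = 0 ↔ i.1 + 1 = i.2.natAbs := by
  have h : modeEv i = (((i.1 : ℤ) + 1) ^ 2 - i.2 ^ 2 : ℤ) := by rw [modeEv]; push_cast; rfl
  rw [h, Int.cast_eq_zero, sub_eq_zero, sq_eq_sq_iff_abs_eq_abs,
    Int.abs_eq_natAbs, Int.abs_eq_natAbs]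
  omega

/-! ### The closed subspaces `R` and `N` -/

theorem continuous_phi (m n : ℕ) : Continuous (phi m n) := by unfold phi; fun_prop

theorem continuous_psi (m n : ℕ) : Continuous (psi m n) := by unfold psi; fun_prop

theorem phi_eq (m n : ℕ) (p : ℝ × ℝ) :
    phi m n p = (Real.sqrt 2)⁻¹ * (sinMode m n p + sinMode m (-n) p) := by
  have h2 : Real.sqrt 2 ≠ 0 := by positivity
  simp only [phi, sinMode, cas]
  push_cast
  rw [neg_mul, Real.cos_neg, Real.sin_neg]
  field_simp
  rw [Real.sq_sqrt (by norm_num)]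
  ring

theorem psi_eq (m n : ℕ) (p : ℝ × ℝ) :
    psi m n p = (Real.sqrt 2)⁻¹ * (sinMode m n p - sinMode m (-n) p) := by
  have h2 : Real.sqrt 2 ≠ 0 := by positivity
  simp only [psi, sinMode, cas]
  push_cast
  rw [neg_mul, Real.cos_neg, Real.sin_neg]
  field_simp
  rw [Real.sq_sqrt (by norm_num)]
  ring

theorem ofCont_phi (m n : ℕ) :
    ofCont (phi m n) (continuous_phi m n) = (Real.sqrt 2)⁻¹ • (sinL m n + sinL m (-n)) :=
  ofCont_eq_smul _ ((contDiff_sinMode m n).continuous.add (contDiff_sinMode m (-n)).continuous)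
    (phi_eq m n)

theorem ofCont_psi (m n : ℕ) :
    ofCont (psi m n) (continuous_psi m n) = (Real.sqrt 2)⁻¹ • (sinL m n - sinL m (-n)) :=
  ofCont_eq_smul _ ((contDiff_sinMode m n).continuous.sub (contDiff_sinMode m (-n)).continuous)
    (psi_eq m n)

theorem sinL_eq_phi_psi (m : ℕ) (n : ℤ) :
    ∃ ε : ℝ, sinL m n = (Real.sqrt 2)⁻¹ • ofCont (phi m n.natAbs) (continuous_phi m _)
      + ε • ofCont (psi m n.natAbs) (continuous_psi m _) := by
  have h2 : (Real.sqrt 2)⁻¹ * (Real.sqrt 2)⁻¹ = 1 / 2 := by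
    rw [← mul_inv, Real.mul_self_sqrt (by norm_num)]; norm_num
  rcases Int.natAbs_eq n with h | h
  · refine ⟨(Real.sqrt 2)⁻¹, ?_⟩
    rw [ofCont_phi, ofCont_psi, smul_smul, smul_smul, h2, ← h]
    module
  · refine ⟨-(Real.sqrt 2)⁻¹, ?_⟩
    rw [ofCont_phi, ofCont_psi, smul_smul, smul_smul, neg_mul, h2, ← h,
      show (n.natAbs : ℤ) = -n by omega]
    module

theorem sinL_mem_R {m : ℕ} {n : ℤ} (hm : 1 ≤ m) (hmn : m ≠ n.natAbs) : sinL m n ∈ R := by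
  obtain ⟨ε, hε⟩ := sinL_eq_phi_psi m n
  rw [hε]
  refine Submodule.le_topologicalClosure _ (Submodule.add_mem _ (Submodule.smul_mem _ _
    (Submodule.subset_span ?_)) (Submodule.smul_mem _ _ (Submodule.subset_span ?_)))
  · exact ⟨m, n.natAbs, hm, hmn, Or.inl (coeFn_ofCont _)⟩
  · exact ⟨m, n.natAbs, hm, hmn, Or.inr (coeFn_ofCont _)⟩

theorem sinL_mem_N {m : ℕ} {n : ℤ} (hm : 1 ≤ m) (hmn : m = n.natAbs) : sinL m n ∈ N := by
  obtain ⟨ε, hε⟩ := sinL_eq_phi_psi m n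
  rw [hε, ← hmn]
  refine Submodule.le_topologicalClosure _ (Submodule.add_mem _ (Submodule.smul_mem _ _
    (Submodule.subset_span ?_)) (Submodule.smul_mem _ _ (Submodule.subset_span ?_)))
  · exact ⟨m, hm, Or.inl (coeFn_ofCont _)⟩
  · exact ⟨m, hm, Or.inr (coeFn_ofCont _)⟩

theorem inner_sinL_sinL {m m' : ℕ} (hm : 1 ≤ m) (n n' : ℤ) :
    ⟪sinL m n, sinL m' n'⟫_ℝ = if m = m' ∧ n = n' then 1 else 0 := by
  rw [sinL, sinL, inner_ofCont_ofCont, integral_sinMode_mul_sinMode hm]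

/-- A mode is orthogonal to `φ_(m',n')` and `ψ_(m',n')` unless `m = m'` and `|n| = n'`. -/
theorem inner_sinL_eq_zero {m m' n' : ℕ} {n : ℤ} (hm : 1 ≤ m) (h : ¬ (m = m' ∧ n.natAbs = n'))
    {v : H} (hv : v =ᵐ[cyl] phi m' n' ∨ v =ᵐ[cyl] psi m' n') : ⟪sinL m n, v⟫_ℝ = 0 := by
  have h1 : ⟪sinL m n, sinL m' n'⟫_ℝ = 0 := by
    rw [inner_sinL_sinL hm, if_neg]; omega
  have h2 : ⟪sinL m n, sinL m' (-n')⟫_ℝ = 0 := by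
    rw [inner_sinL_sinL hm, if_neg]; omega
  rcases hv with hv | hv
  · rw [ofCont_eq_of_ae (continuous_phi _ _) hv, ofCont_phi, inner_smul_right, inner_add_right, h1,
      h2, add_zero, mul_zero]
  · rw [ofCont_eq_of_ae (continuous_psi _ _) hv, ofCont_psi, inner_smul_right, inner_sub_right, h1,
      h2, sub_zero, mul_zero]

theorem inner_eq_zero_of_mem_closure {S : Set H} {e x : H} (h : ∀ v ∈ S, ⟪e, v⟫_ℝ = 0)
    (hx : x ∈ (Submodule.span ℝ S).topologicalClosure) : ⟪e, x⟫_ℝ = 0 := by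
  have hle : (Submodule.span ℝ S).topologicalClosure ≤ (innerSL ℝ e).ker := by
    refine Submodule.topologicalClosure_minimal _ (Submodule.span_le.2 fun v hv => ?_)
      (innerSL ℝ e).isClosed_ker
    simpa using h v hv
  simpa using hle hx

theorem inner_sinL_of_mem_N {m : ℕ} {n : ℤ} (hm : 1 ≤ m) (hmn : m ≠ n.natAbs) {x : H}
    (hx : x ∈ N) : ⟪sinL m n, x⟫_ℝ = 0 := by
  refine inner_eq_zero_of_mem_closure (fun v hv => ?_) hx
  obtain ⟨l, -, hv⟩ := hv
  exact inner_sinL_eq_zero hm (by omega) hv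

/-! ### Critical points of the energy -/

theorem isPosPart_Lp : IsPosPart (Lp.posPart : H → H) where
  sub_eq u := by
    refine Lp.ext ?_
    filter_upwards [Lp.coeFn_sub (Lp.posPart u) (Lp.posPart (-u)), Lp.coeFn_posPart u,
      Lp.coeFn_posPart (-u), Lp.coeFn_neg u] with p h1 h2 h3 h4
    rw [h1, Pi.sub_apply, h2, h3, h4, Pi.neg_apply]
    rcases le_total 0 (u p) with h | h
    · rw [max_eq_left h, max_eq_right (by linarith), sub_zero]
    · rw [max_eq_right h, max_eq_left (by linarith)]; ring
  inner_self u := by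
    rw [L2.inner_def, ← integral_zero (ℝ × ℝ) ℝ]
    refine integral_congr_ae ?_
    filter_upwards [Lp.coeFn_posPart u, Lp.coeFn_posPart (-u), Lp.coeFn_neg u] with p h2 h3 h4
    rw [h2, h3, h4, Pi.neg_apply]
    rcases le_total 0 (u p) with h | h
    · rw [max_eq_right (by linarith : -u p ≤ 0), inner_zero_right]
    · rw [max_eq_right h, inner_zero_left]
  inner_nonneg u v := by
    rw [L2.inner_def]
    refine integral_nonneg_of_ae ?_
    filter_upwards [Lp.coeFn_posPart u, Lp.coeFn_posPart v] with p h1 h2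
    rw [h1, h2]
    simp only [Pi.zero_apply, RCLike.inner_apply, conj_trivial]
    exact mul_nonneg (le_max_right _ _) (le_max_right _ _)
  smul t u ht := by
    refine Lp.ext ?_
    filter_upwards [Lp.coeFn_posPart (t • u), Lp.coeFn_smul t u, Lp.coeFn_smul t (Lp.posPart u),
      Lp.coeFn_posPart u] with p h1 h2 h3 h4
    rw [h1, h2, h3, Pi.smul_apply, Pi.smul_apply, h4, smul_eq_mul, smul_eq_mul,
      mul_max_of_nonneg _ _ ht, mul_zero]

/-- The derivative of `‖u⁺‖²` is `2 u⁺`, with a remainder of at most `2 ‖v - u‖²`. -/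
theorem IsPosPart.hasFDerivAt_norm_sq {E : Type*} [NormedAddCommGroup E] [InnerProductSpace ℝ E]
    {pos : E → E} (hc : IsPosPart pos) (u : E) :
    HasFDerivAt (fun v => ‖pos v‖ ^ 2) ((2 : ℝ) • innerSL ℝ (pos u)) u := by
  rw [hasFDerivAt_iff_isLittleO]
  have hO : (fun v => ‖pos v‖ ^ 2 - ‖pos u‖ ^ 2 - ((2 : ℝ) • innerSL ℝ (pos u)) (v - u))
      =O[𝓝 u] fun v => ‖v - u‖ ^ 2 := by
    refine Asymptotics.IsBigO.of_bound 2 (.of_forall fun v => ?_)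
    have hu := hc.inner_self u
    have hv := hc.inner_self v
    have n1 := hc.inner_nonneg u (-v)
    have n2 := hc.inner_nonneg v (-u)
    have hsplit : ‖v - u‖ ^ 2 = ‖pos v - pos u‖ ^ 2 + ‖pos (-v) - pos (-u)‖ ^ 2
        + 2 * (⟪pos u, pos (-v)⟫_ℝ + ⟪pos v, pos (-u)⟫_ℝ) := by
      have h : v - u = (pos v - pos u) - (pos (-v) - pos (-u)) := by
        conv_lhs => rw [← hc.sub_eq u, ← hc.sub_eq v]
        abel
      rw [h, norm_sub_sq_real (pos v - pos u)]
      simp only [inner_sub_left, inner_sub_right]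
      linarith
    have hid : ‖pos v‖ ^ 2 - ‖pos u‖ ^ 2 - ((2 : ℝ) • innerSL ℝ (pos u)) (v - u)
        = ‖pos v - pos u‖ ^ 2 + 2 * ⟪pos u, pos (-v)⟫_ℝ := by
      have h : ((2 : ℝ) • innerSL ℝ (pos u)) (v - u)
          = 2 * ⟪pos u, (pos v - pos (-v)) - (pos u - pos (-u))⟫_ℝ := by
        rw [hc.sub_eq, hc.sub_eq]; simp
      rw [h, norm_sub_sq_real (pos v)]
      simp only [inner_sub_right]
      rw [real_inner_comm (pos u) (pos v), real_inner_self_eq_norm_sq]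
      linarith
    rw [hid, Real.norm_eq_abs, norm_pow, norm_norm, abs_of_nonneg (by positivity)]
    nlinarith [sq_nonneg ‖pos (-v) - pos (-u)‖, sq_nonneg ‖pos v - pos u‖]
  refine hO.trans_isLittleO ?_
  have h := (Asymptotics.isLittleO_norm_pow_id (E' := E) one_lt_two).comp_tendsto
    (tendsto_sub_nhds_zero_iff.2 (tendsto_id (x := 𝓝 u)))
  simpa [Function.comp_def] using h

/-- `(x, y) ↦ x_s`. -/
def partialS : (H1 × N) →L[ℝ] H :=
  (ContinuousLinearMap.fst ℝ H H).comp ((ContinuousLinearMap.snd ℝ H (H × H)).comp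
    (H1.subtypeL.comp (ContinuousLinearMap.fst ℝ H1 N)))

/-- `(x, y) ↦ x_t`. -/
def partialT : (H1 × N) →L[ℝ] H :=
  (ContinuousLinearMap.snd ℝ H H).comp ((ContinuousLinearMap.snd ℝ H (H × H)).comp
    (H1.subtypeL.comp (ContinuousLinearMap.fst ℝ H1 N)))

/-- `(x, y) ↦ x + y`. -/
def sumL : (H1 × N) →L[ℝ] H :=
  (ContinuousLinearMap.fst ℝ H (H × H)).comp (H1.subtypeL.comp (ContinuousLinearMap.fst ℝ H1 N))
    + N.subtypeL.comp (ContinuousLinearMap.snd ℝ H1 N)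

theorem sumL_apply (z : H1 × N) : sumL z = toFun z := rfl

theorem hasFDerivAt_energy_functional (a b : ℝ) (z : H1 × N) :
    HasFDerivAt (energy a b) ((innerSL ℝ (partialS z)).comp partialS
      - (innerSL ℝ (partialT z)).comp partialT
      - (innerSL ℝ (jump Lp.posPart (a, b) (toFun z))).comp sumL) z := by
  have hS := (partialS.hasFDerivAt (x := z)).norm_sq
  have hT := (partialT.hasFDerivAt (x := z)).norm_sq
  have hp := (isPosPart_Lp.hasFDerivAt_norm_sq (sumL z)).comp z sumL.hasFDerivAt
  have hn := (isPosPart_Lp.hasFDerivAt_norm_sq (-sumL z)).comp z sumL.hasFDerivAt.neg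
  refine ((((hS.sub hT).sub (hp.const_mul a)).sub (hn.const_mul b)).const_mul (1 / 2)).congr_fderiv ?_
  refine ContinuousLinearMap.ext fun w => ?_
  simp only [sub_apply, smul_apply, neg_apply,
    ContinuousLinearMap.comp_apply, innerSL_apply_apply, smul_eq_mul,
    inner_neg_right, jump, inner_sub_left, real_inner_smul_left, ← sumL_apply]
  ring

/-! ### Weak solutions in coefficients -/

/-- The weak form of the equation. -/
theorem isWeakSolution_iff {a b : ℝ} {z : H1 × N} :
    IsWeakSolution a b z ↔ ∀ w, ⟪partialS z, partialS w⟫_ℝ - ⟪partialT z, partialT w⟫_ℝ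
      = ⟪jump Lp.posPart (a, b) (toFun z), toFun w⟫_ℝ := by
  have hD := hasFDerivAt_energy_functional a b z
  have h1 : IsWeakSolution a b z ↔ (innerSL ℝ (partialS z)).comp partialS
      - (innerSL ℝ (partialT z)).comp partialT
      - (innerSL ℝ (jump Lp.posPart (a, b) (toFun z))).comp sumL = 0 :=
    ⟨fun h => hD.unique h, fun h => by rw [h] at hD; exact hD⟩
  rw [h1, ContinuousLinearMap.ext_iff]
  refine forall_congr' fun w => ?_
  simp only [sub_apply, ContinuousLinearMap.comp_apply, innerSL_apply_apply, zero_apply, sumL_apply]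
  rw [sub_eq_zero]

/-- A mode off the diagonal `m = |n|`, as an element of `H1`. -/
def modeH1 {m : ℕ} {n : ℤ} (hm : 1 ≤ m) (hmn : m ≠ n.natAbs) : H1 :=
  ⟨(sinL m n, (m : ℝ) • cosL m n, (n : ℝ) • sinL m (-n)), sinL_mem_R hm hmn,
    .of_hasZeroTrace (hasZeroTrace_sinL m n), fun _ hη _ => byParts_sinL_t m n hη,
    hasZeroTrace_sinL m n⟩

theorem H1.inner_partialS (z : H1 × N) (m : ℕ) (n : ℤ) :
    ⟪cosL m n, partialS z⟫_ℝ = m * ⟪sinL m n, z.1.1.1⟫_ℝ :=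
  HasZeroTrace.inner_cosL z.1.2.2.2.2 m n

theorem H1.inner_partialT (z : H1 × N) (m : ℕ) (n : ℤ) :
    ⟪sinL m (-n), partialT z⟫_ℝ = n * ⟪sinL m n, z.1.1.1⟫_ℝ :=
  IsWeakDeriv.inner_sinL_t z.1.2.2.2.1 m n

theorem IsWeakSolution.isSol {a b : ℝ} {z : H1 × N} (h : IsWeakSolution a b z) :
    IsSol modeBasis modeEv Lp.posPart (a, b) (toFun z) := by
  rw [isWeakSolution_iff] at h
  intro i
  have hm : 1 ≤ i.1 + 1 := Nat.le_add_left 1 _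
  rw [modeBasis_apply, real_inner_comm (jump _ _ _)]
  by_cases hi : i.1 + 1 = i.2.natAbs
  -- The mode is a test function in `N` if `m = |n|`, and in `H1` otherwise.
  · have hw := h (0, ⟨sinL (i.1 + 1) i.2, sinL_mem_N hm hi⟩)
    have h0 : partialS (0, ⟨sinL (i.1 + 1) i.2, sinL_mem_N hm hi⟩) = 0 := rfl
    have h1 : partialT (0, ⟨sinL (i.1 + 1) i.2, sinL_mem_N hm hi⟩) = 0 := rfl
    have h2 : toFun (0, ⟨sinL (i.1 + 1) i.2, sinL_mem_N hm hi⟩) = sinL (i.1 + 1) i.2 := zero_add _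
    rw [h0, h1, h2, inner_zero_right, inner_zero_right, sub_zero] at hw
    rw [(modeEv_eq_zero_iff i).2 hi, zero_mul, hw]
  · have hw := h (modeH1 hm hi, 0)
    have h0 : partialS (modeH1 hm hi, 0) = ((i.1 + 1 : ℕ) : ℝ) • cosL (i.1 + 1) i.2 := rfl
    have h1 : partialT (modeH1 hm hi, 0) = (i.2 : ℝ) • sinL (i.1 + 1) (-i.2) := rfl
    have h2 : toFun (modeH1 hm hi, 0) = sinL (i.1 + 1) i.2 := add_zero _
    have h3 : ⟪sinL (i.1 + 1) i.2, toFun z⟫_ℝ = ⟪sinL (i.1 + 1) i.2, z.1.1.1⟫_ℝ := by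
      rw [toFun, inner_add_right, inner_sinL_of_mem_N hm hi z.2.2, add_zero]
    rw [h0, h1, h2, inner_smul_right, inner_smul_right, real_inner_comm, H1.inner_partialS,
      real_inner_comm (sinL (i.1 + 1) (-i.2)), H1.inner_partialT] at hw
    rw [h3, ← hw, modeEv]
    push_cast
    ring

theorem summable_smul_of_orthonormal {ι E : Type*} [NormedAddCommGroup E] [InnerProductSpace ℝ E]
    [CompleteSpace E] {v : ι → E} (hv : Orthonormal ℝ v) {a : ι → ℝ}
    (ha : Summable fun i => a i ^ 2) : Summable fun i => a i • v i := by
  have h := (hv.orthogonalFamily.summable_iff_norm_sq_summable a).2 (by simpa using ha)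
  simpa using h

theorem ByParts.hasSum {ι : Type*} {e : ℝ × ℝ} {u g : H} {η : ℝ × ℝ → ℝ} (hη : IsSmoothOnCyl η)
    {f f' : ι → H} (hu : HasSum f u) (hg : HasSum f' g) (h : ∀ i, ByParts e (f i) (f' i) η) :
    ByParts e u g η := by
  have h1 := hu.mapL (innerSL ℝ (ofCont _ (hη.continuous_fderiv e)))
  have h2 := (hg.mapL (innerSL ℝ (ofCont η hη.1.continuous))).neg
  have h3 : ∀ i, innerSL ℝ (ofCont _ (hη.continuous_fderiv e)) (f i)
      = -innerSL ℝ (ofCont η hη.1.continuous) (f' i) := fun i => (h i).inner_eq hη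
  simp only [h3] at h1
  have h4 := h1.unique h2
  rw [innerSL_apply_apply, innerSL_apply_apply, inner_ofCont, inner_ofCont] at h4
  exact h4

theorem mem_topologicalClosure_of_hasSum {ι E : Type*} [NormedAddCommGroup E] [NormedSpace ℝ E]
    {V : Submodule ℝ E} {f : ι → E} {x : E} (hx : HasSum f x)
    (h : ∀ i, f i ∈ V.topologicalClosure) : x ∈ V.topologicalClosure :=
  V.isClosed_topologicalClosure.mem_of_tendsto hx
    (.of_forall fun _ => Submodule.sum_mem _ fun i _ => h i)

/-- Regularity: off the diagonal `ev i * ⟪e_i, u⟫` is square summable and bounds the coefficients of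
both weak derivatives, so that the projection of a coefficient solution to `R` lies in `H1`. -/
theorem exists_isWeakSolution {a b : ℝ} {u : H}
    (h : IsSol modeBasis modeEv Lp.posPart (a, b) u) :
    ∃ z : H1 × N, toFun z = u ∧ IsWeakSolution a b z := by
  -- The coefficients of the component of `u` in `R`.
  set c : ℕ × ℤ → ℝ := fun i => if modeEv i = 0 then 0 else ⟪sinL (i.1 + 1) i.2, u⟫_ℝ with hc
  have hc0 : ∀ i, modeEv i = 0 → c i = 0 := fun i hi => if_pos hi
  have hc1 : ∀ i, modeEv i ≠ 0 → c i = ⟪sinL (i.1 + 1) i.2, u⟫_ℝ := fun i hi => if_neg hi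
  have hm : ∀ i : ℕ × ℤ, 1 ≤ i.1 + 1 := fun i => Nat.le_add_left 1 _
  have hu := hilbertBasis_hasSum_sq modeBasis u
  have hj := hilbertBasis_hasSum_sq modeBasis (jump Lp.posPart (a, b) u)
  have hsum0 : Summable fun i => c i ^ 2 := by
    refine hu.summable.of_nonneg_of_le (fun i => sq_nonneg _) fun i => ?_
    rw [modeBasis_apply]
    by_cases hi : modeEv i = 0
    · rw [hc0 i hi, zero_pow two_ne_zero]; exact sq_nonneg _
    · rw [hc1 i hi]
  -- By the equation `(modeEv i * c i)²` is summable, as `jump` takes values in `L²`.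
  have hbound : ∀ k : ℕ × ℤ → ℝ, (∀ i, modeEv i ≠ 0 → k i ^ 2 ≤ modeEv i ^ 2) →
      Summable fun i => (c i * k i) ^ 2 := by
    intro k hk
    refine hj.summable.of_nonneg_of_le (fun i => sq_nonneg _) fun i => ?_
    rw [← h i, modeBasis_apply]
    by_cases hi : modeEv i = 0
    · rw [hc0 i hi, zero_mul, zero_pow two_ne_zero]; exact sq_nonneg _
    · rw [hc1 i hi, mul_pow, mul_pow, mul_comm]
      exact mul_le_mul_of_nonneg_right (hk i hi) (sq_nonneg _)
  have hneg : Orthonormal ℝ fun i : ℕ × ℤ => sinL (i.1 + 1) (-i.2) :=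
    orthonormal_sinL.comp (fun i : ℕ × ℤ => (i.1, -i.2)) fun i j hij => by
      simp only [Prod.mk.injEq, neg_inj] at hij
      exact Prod.ext hij.1 hij.2
  obtain ⟨x, hx⟩ := summable_smul_of_orthonormal orthonormal_sinL hsum0
  obtain ⟨xs, hxs⟩ := summable_smul_of_orthonormal orthonormal_cosL
    (hbound (fun i => ((i.1 + 1 : ℕ) : ℝ)) fun i hi => (sq_le_modeEv_sq hi).1)
  obtain ⟨xt, hxt⟩ := summable_smul_of_orthonormal hneg
    (hbound (fun i => (i.2 : ℝ)) fun i hi => (sq_le_modeEv_sq hi).2)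
  simp only [mul_smul] at hxs hxt
  have hxR : x ∈ R := mem_topologicalClosure_of_hasSum hx fun i => by
    by_cases hi : modeEv i = 0
    · rw [hc0 i hi, zero_smul]; exact zero_mem _
    · exact R.smul_mem _ (sinL_mem_R (hm i) (mt (modeEv_eq_zero_iff i).2 hi))
  have hxtr : HasZeroTrace x xs := fun η hη =>
    ByParts.hasSum hη hx hxs fun i => (hasZeroTrace_sinL _ _ η hη).smul _
  have hxtt : IsWeakDeriv (0, 1) x xt := fun η hη _ =>
    ByParts.hasSum hη hx hxt fun i => (byParts_sinL_t _ _ hη).smul _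
  have hyN : u - x ∈ N := by
    refine mem_topologicalClosure_of_hasSum ((modeBasis.hasSum_repr u).sub hx) fun i => ?_
    rw [modeBasis.repr_apply_apply, modeBasis_apply, ← sub_smul]
    by_cases hi : modeEv i = 0
    · exact N.smul_mem _ (sinL_mem_N (hm i) ((modeEv_eq_zero_iff i).1 hi))
    · rw [hc1 i hi, sub_self, zero_smul]; exact zero_mem _
  refine ⟨(⟨(x, xs, xt), hxR, .of_hasZeroTrace hxtr, hxtt, hxtr⟩, ⟨u - x, hyN⟩),
    add_sub_cancel x u, ?_⟩
  rw [isWeakSolution_iff]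
  intro w
  have e1 : toFun ((⟨(x, xs, xt), hxR, .of_hasZeroTrace hxtr, hxtt, hxtr⟩, ⟨u - x, hyN⟩) : H1 × N)
      = u := add_sub_cancel x u
  rw [e1]
  change ⟪xs, partialS w⟫_ℝ - ⟪xt, partialT w⟫_ℝ = _
  have s1 := hxs.mapL (innerSL ℝ (partialS w))
  have s2 := hxt.mapL (innerSL ℝ (partialT w))
  have s3 := modeBasis.hasSum_inner_mul_inner (toFun w) (jump Lp.posPart (a, b) u)
  simp only [innerSL_apply_apply] at s1 s2
  rw [real_inner_comm (partialS w), real_inner_comm (partialT w), real_inner_comm (toFun w)]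
  have key : ∀ i, ⟪toFun w, modeBasis i⟫_ℝ * ⟪modeBasis i, jump Lp.posPart (a, b) u⟫_ℝ
      = ⟪partialS w, c i • ((i.1 + 1 : ℕ) : ℝ) • cosL (i.1 + 1) i.2⟫_ℝ
        - ⟪partialT w, c i • (i.2 : ℝ) • sinL (i.1 + 1) (-i.2)⟫_ℝ := by
    intro i
    rw [← h i, modeBasis_apply, inner_smul_right, inner_smul_right, inner_smul_right,
      inner_smul_right, real_inner_comm (cosL _ _), H1.inner_partialS,
      real_inner_comm (sinL _ (-i.2)), H1.inner_partialT, real_inner_comm (sinL _ _) (toFun w)]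
    by_cases hi : modeEv i = 0
    · rw [hc0 i hi, hi]; ring
    · rw [hc1 i hi, toFun, inner_add_right,
        inner_sinL_of_mem_N (hm i) (mt (modeEv_eq_zero_iff i).2 hi) w.2.2, modeEv]
      push_cast
      ring
  simp only [key] at s3
  exact (s1.sub s2).unique s3

theorem hasNontrivialWeakSolution_iff (a b : ℝ) :
    HasNontrivialWeakSolution a b ↔ Solvable modeBasis modeEv Lp.posPart (a, b) := by
  constructor
  · rintro ⟨z, hz, h0⟩
    exact ⟨toFun z, h0, hz.isSol⟩
  · rintro ⟨u, hu, h⟩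
    obtain ⟨z, rfl, hz⟩ := exists_isWeakSolution h
    exact ⟨z, hz, hu⟩

/-! ### Sign changes and the choice of the interval -/

/-- A nonzero nonnegative function has a positive coefficient at the mode `π⁻¹ sin s`. -/
theorem inner_sinL_pos {u : H} (hu : u ≠ 0) (h : Lp.posPart (-u) = 0) : 0 < ⟪sinL 1 0, u⟫_ℝ := by
  have hu0 : u = Lp.posPart u := by
    conv_lhs => rw [← isPosPart_Lp.sub_eq u, h, sub_zero]
  have hnn : ∀ᵐ p ∂cyl, 0 ≤ u p := by
    filter_upwards [Lp.coeFn_posPart u] with p hp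
    rw [hu0, hp]
    exact le_max_right _ _
  have hmode : ∀ p : ℝ × ℝ, sinMode 1 0 p = Real.pi⁻¹ * Real.sin p.1 := fun p => by
    simp [sinMode, cas]
  have hpos : ∀ᵐ p ∂cyl, 0 < sinMode 1 0 p := by
    filter_upwards [ae_cyl_interior] with p hp
    rw [hmode]
    exact mul_pos (inv_pos.2 Real.pi_pos) (Real.sin_pos_of_mem_Ioo hp)
  have hint : 0 ≤ᵐ[cyl] fun p => u p * sinMode 1 0 p := by
    filter_upwards [hnn, hpos] with p h1 h2 using mul_nonneg h1 h2.le
  rw [sinL, inner_ofCont]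
  refine lt_of_le_of_ne (integral_nonneg_of_ae hint) fun h0 => hu ?_
  have h1 := (integral_eq_zero_iff_of_nonneg_ae hint
    (integrable_mul u (contDiff_sinMode 1 0).continuous)).1 h0.symm
  refine (Lp.eq_zero_iff_ae_eq_zero).2 ?_
  filter_upwards [h1, hpos] with p h2 h3
  exact (mul_eq_zero.1 h2).resolve_right h3.ne'

/-- A nontrivial nonnegative solution satisfies `L u = p.1 • u`; testing with the positive mode `sin s`,
which has eigenvalue `1`, gives `p.1 = 1`. -/
theorem IsSol.fst_eq_one {p : ℝ × ℝ} {u : H} (hu : u ≠ 0)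
    (h : IsSol modeBasis modeEv Lp.posPart p u) (h0 : Lp.posPart (-u) = 0) : p.1 = 1 := by
  have hpos := inner_sinL_pos hu h0
  have hu0 : Lp.posPart u = u := by
    conv_rhs => rw [← isPosPart_Lp.sub_eq u, h0, sub_zero]
  have h1 := h (0, 0)
  rw [modeBasis_apply, jump, h0, hu0, smul_zero, sub_zero, inner_smul_right] at h1
  have h2 : modeEv (0, 0) = 1 := by simp [modeEv]
  rw [h2] at h1
  exact (mul_right_cancel₀ hpos.ne' h1).symm

theorem IsSol.changes_sign {I : Set ℝ} (hI : (1 : ℝ) ∉ I) {p : ℝ × ℝ} (hp : p ∈ I ×ˢ I) {u : H}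
    (hu : u ≠ 0) (h : IsSol modeBasis modeEv Lp.posPart p u) :
    Lp.posPart u ≠ 0 ∧ Lp.posPart (-u) ≠ 0 := by
  refine ⟨fun h0 => hI ?_, fun h0 => hI (h.fst_eq_one hu h0 ▸ hp.1)⟩
  have hs : IsSol modeBasis modeEv Lp.posPart p.swap (-u) := fun i => by
    rw [jump_neg, inner_neg_right, inner_neg_right, ← h i, mul_neg]
  have h1 : p.swap.1 = 1 := hs.fst_eq_one (neg_ne_zero.2 hu) (by rwa [neg_neg])
  exact h1 ▸ hp.2

/-- The side of the square `Q lam k`. -/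
def side (lam : ℤ → ℝ) (k : ℤ) : Set ℝ :=
  if 0 < lam k then Ioi (lam (k - 1)) else Ioo (lam (k - 1)) 0

theorem Q_eq (lam : ℤ → ℝ) (k : ℤ) : Q lam k = side lam k ×ˢ side lam k := by
  unfold Q side
  split_ifs <;> rfl

namespace EnumeratesEigenvalues

variable {lam : ℤ → ℝ}

theorem exists_eq_modeEv (h : EnumeratesEigenvalues lam) (i : ℕ × ℤ) : ∃ j, lam j = modeEv i :=
  (h.2.2 _).1 (isWaveEigenvalue_modeEv i)

theorem exists_modeEv_eq (h : EnumeratesEigenvalues lam) (k : ℤ) : ∃ i, modeEv i = lam k :=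
  exists_modeEv_of_isWaveEigenvalue ((h.2.2 _).2 ⟨k, rfl⟩)

/-- If `λ_k > 0`, then `λ_{k-1} ≥ 0`; so the infinite dimensional kernel never meets the window. -/
theorem isSpectralInterval (h : EnumeratesEigenvalues lam) {k : ℤ} (hk : lam k ≠ 0) :
    IsSpectralInterval modeEv (side lam k) (lam (k - 1)) (lam k) := by
  have hlt : lam (k - 1) < lam k := h.1 (by omega)
  have hgap : ∀ i, modeEv i ≤ lam (k - 1) ∨ lam k ≤ modeEv i := fun i => by
    obtain ⟨j, hj⟩ := h.exists_eq_modeEv i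
    rw [← hj, h.1.le_iff_le, h.1.le_iff_le]
    omega
  by_cases hpos : 0 < lam k
  · have h0 : 0 ≤ lam (k - 1) := by
      rw [← h.2.1, h.1.lt_iff_lt] at hpos
      rw [← h.2.1, h.1.le_iff_le]
      omega
    have hside : side lam k = Ioi (lam (k - 1)) := if_pos hpos
    refine ⟨hside.le, fun x hx => ⟨x + 1, lt_add_one x, hside ▸ Ioo_subset_Ioi_self, ?_⟩, hgap,
      hside ▸ hlt, h.exists_modeEv_eq k⟩
    refine (finite_modeEv (C := x + 1)).subset fun i hi => ?_
    have hi0 : 0 < modeEv i := h0.trans_lt hi.1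
    exact ⟨hi0.ne', by rw [abs_of_pos hi0]; exact hi.2.le⟩
  · have hside : side lam k = Ioo (lam (k - 1)) 0 := if_neg hpos
    refine ⟨hside ▸ Ioo_subset_Ioi_self, fun x hx => ?_, hgap,
      hside ▸ ⟨hlt, lt_of_le_of_ne (not_lt.1 hpos) hk⟩, h.exists_modeEv_eq k⟩
    rw [hside] at hx ⊢
    refine ⟨0, hx.2, le_rfl, (finite_modeEv (C := -lam (k - 1))).subset fun i hi => ?_⟩
    exact ⟨hi.2.ne, by rw [abs_of_neg hi.2]; exact neg_le_neg hi.1.le⟩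

/-- The eigenvalues are integers, so that `λ_1 ≥ 1`. -/
theorem one_notMem_side (h : EnumeratesEigenvalues lam) {k : ℤ} (hk : k ≠ 1) :
    (1 : ℝ) ∉ side lam k := by
  unfold side
  split_ifs with hpos
  · rw [mem_Ioi, not_lt]
    obtain ⟨i, hi⟩ := h.exists_modeEv_eq 1
    have h1 : 0 < lam 1 := by rw [← h.2.1]; exact h.1 one_pos
    have hint : modeEv i = (((i.1 : ℤ) + 1) ^ 2 - i.2 ^ 2 : ℤ) := by rw [modeEv]; push_cast; rfl
    rw [← hi, hint, Int.cast_pos] at h1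
    have h2 : (1 : ℝ) ≤ lam 1 := by
      rw [← hi, hint]
      exact_mod_cast h1
    refine h2.trans ?_
    rw [← h.2.1, h.1.lt_iff_lt] at hpos
    rw [h.1.le_iff_le]
    omega
  · exact fun hm => absurd hm.2 (by norm_num)

end EnumeratesEigenvalues

section Region

variable {E ι : Type*} [NormedAddCommGroup E] [InnerProductSpace ℝ E] [CompleteSpace E]
  {b : HilbertBasis ι ℝ E} {ev : ι → ℝ} {pos : E → E} {I : Set ℝ} {α μ : ℝ}

theorem IsSpectralInterval.isLowerRegion (hI : IsSpectralInterval ev I α μ) (hc : IsPosPart pos) :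
    IsLowerRegion I μ (solutionFree b ev pos I) where
  isOpen_I := hI.isOpen
  ordConnected := hI.ordConnected
  mem := hI.mem
  isOpen := isOpen_solutionFree hI hc
  subset _ hp := hp.1
  lower _ hp _ hp' hle := solutionFree_lower hp hp' hle
  swap _ hp := solutionFree_swap hp
  corner _ hp h1 h2 := corner_subset_solutionFree hI hc ⟨hI.subset hp.1, h1⟩ ⟨hI.subset hp.2, h2⟩
  notMem := notMem_solutionFree hI hc

end Region

end WaveFucik

end

theorem mainTheorem1 (lam : ℤ → ℝ) (hlam : WaveFucik.EnumeratesEigenvalues lam)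
    (k : ℤ) (hk : lam k ≠ 0) :
    ∃ C : Set (ℝ × ℝ),
      -- `C` is a continuous simple curve
      (∃ γ : ℝ → ℝ × ℝ, Continuous γ ∧ Function.Injective γ ∧ Set.range γ = C) ∧
      C ⊆ WaveFucik.Q lam k ∧
      (lam k, lam k) ∈ C ∧
      -- it is symmetric about the line `b = a`
      (∀ a b : ℝ, (a, b) ∈ C → (b, a) ∈ C) ∧
      -- for `k ≠ 1` it is the graph of a strictly decreasing continuous function on an interval
      (k ≠ 1 → ∃ (J : Set ℝ) (f : ℝ → ℝ), J.OrdConnected ∧ ContinuousOn f J ∧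
        StrictAntiOn f J ∧ C = (fun a => (a, f a)) '' J) ∧
      -- it divides `Q` into two components, one of which contains `]λ_{k-1}, λ_k[²`
      Nat.card (ConnectedComponents ↥(WaveFucik.Q lam k \ C)) = 2 ∧
      WaveFucik.corner lam k ⊆ WaveFucik.Q lam k \ C ∧
      -- nontrivial weak solutions exist on the curve, and there are none below it
      (∀ a b : ℝ, (a, b) ∈ C → WaveFucik.HasNontrivialWeakSolution a b) ∧
      (∀ a b : ℝ, (a, b) ∈ WaveFucik.Below lam k C →
        ¬ WaveFucik.HasNontrivialWeakSolution a b) := by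
  have hI := hlam.isSpectralInterval hk
  have hU := hI.isLowerRegion (b := WaveFucik.modeBasis) WaveFucik.isPosPart_Lp
  have hcorner : WaveFucik.corner lam k
      ⊆ WaveFucik.solutionFree WaveFucik.modeBasis WaveFucik.modeEv Lp.posPart
        (WaveFucik.side lam k) :=
    fun p hp => WaveFucik.corner_subset_solutionFree hI WaveFucik.isPosPart_Lp hp.1 hp.2
  rw [WaveFucik.Q_eq]
  refine ⟨_, hU.exists_curve, fun p hp => hp.1, hU.diag_mem_upperBoundary,
    fun a b hab => hU.swap_mem_upperBoundary hab, fun hk1 => hU.exists_graph fun p hp q hq hle =>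
      WaveFucik.eq_of_le_of_mem_upperBoundary hI WaveFucik.isPosPart_Lp
        (fun p hp u hu h => h.changes_sign (hlam.one_notMem_side hk1) hp hu) hp hq hle,
    hU.card_components, ?_, fun a b hab => ?_, fun a b hab hsol => ?_⟩
  · rw [hU.diff_upperBoundary]
    exact hcorner.trans subset_union_left
  · exact (WaveFucik.hasNontrivialWeakSolution_iff a b).2
      (WaveFucik.solvable_of_mem_upperBoundary hI WaveFucik.isPosPart_Lp hab)
  · rw [WaveFucik.Below, WaveFucik.Q_eq, mem_iUnion₂] at hab
    obtain ⟨q, hq, hab⟩ := hab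
    have hfree := hU.connectedComponentIn_subset (hcorner hq) hab
    exact hfree.2 (a, b) hfree.1 le_rfl ((WaveFucik.hasNontrivialWeakSolution_iff a b).1 hsol)
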